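/- Let $N\ge 1$. Consider pairs $\overline f=(f,\varphi)$ of a morphism $f:\mathbb P^N\to\mathbb P^N$ over $\mathbb C$ and an isomorphism $\varphi:\mathcal O(1)^{\otimes d_f}\to f^*\mathcal O(1)$ with $d_f\ge 2$; equivalently, homogeneous polynomials $F_k=\varphi^*f^*(X_k)$ $(0\le k\le N)$ of degree $d_f$ with no common zero except $0$. Let $\|\cdot\|_{FS}$ be the Fubini–Study metric on $\mathcal O(1)$, and set $$\overline c(\overline f)=\sup_{x\in\mathbb P^N(\mathbb C)}\left|\log\frac{(\varphi^*f^*\|\cdot\|_{FS})^{1/d_f}}{\|\cdot\|_{FS}}(x)\right|,\qquad \overline c(\boldsymbol{\overline f})=\sup_{i\ge1}\overline c(\overline{f_i})$$ for a sequence $\boldsymbol{\overline f}=(\overline{f_i})_{i\ge1}$. The sequence is called bounded if $\overline c(\boldsymbol{\overline f})<\infty$. Let $S$ be the shift $(\overline{f_i})_i\mapsto(\overline{f_{i+1}})_i$. There is a unique way to attach to every bounded sequence $\boldsymbol{\overline f}$ a continuous metric $\|\cdot\|^{\wedge}_{\boldsymbol{\overline f}}$ on $\mathcal O(1)$, the admissible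 metric, such that $\sup_x\big|\log(\|\cdot\|^{\wedge}_{\boldsymbol{\overline f}}/\|\cdot\|_{FS})(x)\big|\le 2\,\overline c(\boldsymbol{\overline f})$ and $\varphi_1^*f_1^*\|\cdot\|^{\wedge}_{S(\boldsymbol{\overline f})}=(\|\cdot\|^{\wedge}_{\boldsymbol{\overline f}})^{d_{f_1}}$. Let $\boldsymbol{\overline f}$ be a bounded sequence, $F^i=(F^i_0,\dots,F^i_N):\mathbb C^{N+1}\to\mathbb C^{N+1}$ the map given by the polynomials of $\overline{f_i}$, and let $\pi:\mathbb C^{N+1}\setminus\{0\}\to\mathbb P^N(\mathbb C)$ be the projection. Write $dd^c=\frac{i}{2\pi}\partial\overline\partial$ and $|x|^2=\sum_k|x_k|^2$. The functions $$G_l(x)=\frac{1}{d_{f_1}\cdots d_{f_l}}\log|F^l\circ\cdots\circ F^1(x)|^2$$ converge uniformly on $\mathbb C^{N+1}\setminus\{0\}$ to a function $G_{\boldsymbol{\overline f}}$, and there is a unique positive closed $(1,1)$-current $T_{\boldsymbol{\overline f}}$ on $\mathbb P^N(\mathbb C)$, the Green current, with $\pi^*T_{\boldsymbol{\overline f}}=dd^c\,G_{\boldsymbol{\overline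 f}}$. For every nonzero global section $s$ of $\mathcal O(1)$ the first Chern current $$c_1\big(\mathcal O(1),\|\cdot\|^{\wedge}_{\boldsymbol{\overline f}}\big):=dd^c\big[-\log(\|s\|^{\wedge}_{\boldsymbol{\overline f}})^2\big]+\delta_{\operatorname{div}(s)}$$ is well defined (the integrals that define its values on smooth forms converge absolutely), and $$c_1\big(\mathcal O(1),\|\cdot\|^{\wedge}_{\boldsymbol{\overline f}}\big)=T_{\boldsymbol{\overline f}}.$$ -/

import Mathlib

open scoped ENNReal LinearAlgebra.Projectivization
open Filter

noncomputable section

namespace RandomDyn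

/-! ### Projective space, the line bundle O(1) and its metrics -/

/-- The affine cone `ℂ^{N+1}` over `ℙ^N(ℂ)`. -/
abbrev V (N : ℕ) : Type := Fin (N + 1) → ℂ

/-- `ℙ^N(ℂ)`. -/
abbrev PN (N : ℕ) : Type := ℙ ℂ (V N)

/-- The Euclidean norm `|x| = (∑ |x_i|²)^{1/2}` on `ℂ^{N+1}`. -/
def euclNorm {N : ℕ} (x : V N) : ℝ := Real.sqrt (∑ i, ‖x i‖ ^ 2)

/-- The fibre of `O(1)` at `p`: linear forms on the line `p ⊆ ℂ^{N+1}`. -/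
abbrev Fibre {N : ℕ} (p : PN N) : Type := Module.Dual ℂ p.submodule

/-- The value at `p` of the global section of `O(1)` given by the linear form `s`. -/
def sectionAt {N : ℕ} (s : Module.Dual ℂ (V N)) (p : PN N) : Fibre p :=
  s.domRestrict p.submodule

/-- A (not necessarily continuous) metric on the line bundle `O(1)` over `ℙ^N(ℂ)`. -/
@[ext]
structure BundleMetric (N : ℕ) where
  norm : ∀ p : PN N, Fibre p → ℝ
  norm_smul : ∀ (p : PN N) (c : ℂ) (v : Fibre p), norm p (c • v) = ‖c‖ * norm p v
  norm_pos : ∀ (p : PN N) (v : Fibre p), v ≠ 0 → 0 < norm p v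

/-- Continuity of a metric: the norms of the global sections (which generate `O(1)`) are
continuous functions on `ℙ^N(ℂ)`, the quotient of `ℂ^{N+1} ∖ {0}`. -/
def BundleMetric.IsContinuous {N : ℕ} (h : BundleMetric N) : Prop :=
  ∀ s : Module.Dual ℂ (V N), Continuous fun x : {x : V N // x ≠ 0} =>
    h.norm (Projectivization.mk' ℂ x) (sectionAt s (Projectivization.mk' ℂ x))

theorem rep_mem {N : ℕ} (p : PN N) : p.rep ∈ p.submodule := by
  rw [Projectivization.submodule_eq]
  exact Submodule.mem_span_singleton_self _

/-- The chosen representative of `p`, as a vector of the line `p`. -/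
def repVec {N : ℕ} (p : PN N) : p.submodule := ⟨p.rep, rep_mem p⟩

theorem exists_smul_repVec {N : ℕ} (p : PN N) (y : p.submodule) : ∃ c : ℂ, c • repVec p = y := by
  have h : (y : V N) ∈ Submodule.span ℂ {p.rep} := by
    rw [← Projectivization.submodule_eq]; exact y.2
  obtain ⟨c, hc⟩ := Submodule.mem_span_singleton.1 h
  exact ⟨c, Subtype.ext hc⟩

theorem euclNorm_pos {N : ℕ} {x : V N} (hx : x ≠ 0) : 0 < euclNorm x := by
  obtain ⟨i, hi⟩ := Function.ne_iff.1 hx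
  refine Real.sqrt_pos.2 (Finset.sum_pos' (fun _ _ => by positivity) ⟨i, Finset.mem_univ i, ?_⟩)
  have : 0 < ‖x i‖ := norm_pos_iff.2 hi
  positivity

/-- The Fubini-Study metric on `O(1)`: `‖v‖(p) = |v(x)| / |x|` for any `0 ≠ x ∈ p`. -/
def fubiniStudy (N : ℕ) : BundleMetric N where
  norm p v := ‖v (repVec p)‖ / euclNorm p.rep
  norm_smul p c v := by simp [mul_div_assoc]
  norm_pos p v hv := by
    refine div_pos (norm_pos_iff.2 fun h0 => hv (LinearMap.ext fun y => ?_))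
      (euclNorm_pos p.rep_nonzero)
    obtain ⟨c, rfl⟩ := exists_smul_repVec p y
    simp [h0]

/-! ### Pairs `(f, φ)` and bounded sequences -/

/-- A pair `(f, φ)` of a morphism `f : ℙ^N → ℙ^N` and an isomorphism `φ : O(1)^{⊗d} ≃ f^*O(1)`,
`d ≥ 2`, given by the homogeneous polynomials `F_k = φ^* f^* (X_k)` of degree `d`
without nontrivial common zero. -/
structure PolarizedMap (N : ℕ) where
  deg : ℕ
  two_le_deg : 2 ≤ deg
  poly : Fin (N + 1) → MvPolynomial (Fin (N + 1)) ℂ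
  homogeneous : ∀ k, (poly k).IsHomogeneous deg
  no_zero : ∀ x : V N, (∀ k, MvPolynomial.eval x (poly k) = 0) → x = 0

/-- The map `F = (F_0, …, F_N) : ℂ^{N+1} → ℂ^{N+1}`. -/
def PolarizedMap.lift {N : ℕ} (f : PolarizedMap N) (x : V N) : V N :=
  fun k => MvPolynomial.eval x (f.poly k)

theorem PolarizedMap.lift_ne_zero {N : ℕ} (f : PolarizedMap N) {x : V N} (hx : x ≠ 0) :
    f.lift x ≠ 0 :=
  fun h => hx (f.no_zero x fun k => congrFun h k)

theorem PolarizedMap.lift_smul {N : ℕ} (f : PolarizedMap N) (c : ℂ) (x : V N) :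
    f.lift (c • x) = c ^ f.deg • f.lift x := by
  funext k
  simp only [PolarizedMap.lift, Pi.smul_apply, smul_eq_mul, MvPolynomial.eval_eq', Finset.mul_sum]
  refine Finset.sum_congr rfl fun m hm => ?_
  have hd : ∑ i, m i = f.deg := by
    have := f.homogeneous k (MvPolynomial.mem_support_iff.1 hm)
    rw [← this, Finsupp.weight_apply, Finsupp.sum_fintype _ _ (by simp)]
    simp
  rw [← hd]
  simp only [mul_pow, Finset.prod_mul_distrib, Finset.prod_pow_eq_pow_sum]
  ring

/-- The morphism `f = (F_0 : … : F_N)` on `ℙ^N(ℂ)`. -/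
def PolarizedMap.map {N : ℕ} (f : PolarizedMap N) (p : PN N) : PN N :=
  Projectivization.mk ℂ (f.lift p.rep) (f.lift_ne_zero p.rep_nonzero)

/-- The map `v ↦ φ(v^{⊗d})`, from the fibre of `O(1)` at `p` to its fibre at `f(p)`:
`φ(v^{⊗d})` is the linear form on the line `f(p) = ℂ F(x)`, `0 ≠ x ∈ p`, whose value at `F(x)` is
`v(x)^d` (see `fibreMap_apply` for the independence of `x`). -/
def PolarizedMap.fibreMap {N : ℕ} (f : PolarizedMap N) (p : PN N) (v : Fibre p) :
    Fibre (f.map p) :=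
  (v (repVec p) ^ f.deg) •
    (LinearEquiv.coord ℂ (V N) (f.lift p.rep) (f.lift_ne_zero p.rep_nonzero)).toLinearMap

theorem PolarizedMap.lift_mem {N : ℕ} (f : PolarizedMap N) (p : PN N) (y : p.submodule) :
    f.lift y ∈ (f.map p).submodule := by
  obtain ⟨c, rfl⟩ := exists_smul_repVec p y
  have : f.lift ((c • repVec p : p.submodule) : V N) = c ^ f.deg • f.lift p.rep :=
    f.lift_smul c p.rep
  rw [this]
  exact Submodule.smul_mem _ _ (Submodule.mem_span_singleton_self _)

theorem PolarizedMap.fibreMap_apply {N : ℕ} (f : PolarizedMap N) (p : PN N) (v : Fibre p)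
    (y : p.submodule) : f.fibreMap p v ⟨f.lift y, f.lift_mem p y⟩ = v y ^ f.deg := by
  obtain ⟨c, rfl⟩ := exists_smul_repVec p y
  have h1 : (⟨f.lift ((c • repVec p : p.submodule) : V N), f.lift_mem p _⟩ :
      (f.map p).submodule) = c ^ f.deg • ⟨f.lift p.rep, Submodule.mem_span_singleton_self _⟩ :=
    Subtype.ext (f.lift_smul c p.rep)
  rw [h1, map_smul, map_smul]
  have h2 := LinearEquiv.coord_self ℂ (V N) (f.lift p.rep) (f.lift_ne_zero p.rep_nonzero)
  have h3 : f.fibreMap p v ⟨f.lift p.rep, Submodule.mem_span_singleton_self _⟩ =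
      v (repVec p) ^ f.deg * (LinearEquiv.coord ℂ (V N) (f.lift p.rep)
        (f.lift_ne_zero p.rep_nonzero)) ⟨f.lift p.rep, Submodule.mem_span_singleton_self _⟩ := rfl
  rw [h3, h2]
  simp [mul_pow]

/-- `c̄(f) = sup_p |log ((φ^*f^*‖·‖_FS)^{1/d} / ‖·‖_FS)(p)|`; the quotient of two metrics at `p` is
evaluated on a nonzero vector `v` of the fibre at `p`. -/
def cBar {N : ℕ} (f : PolarizedMap N) : ℝ≥0∞ :=
  ⨆ (p : PN N) (v : Fibre p) (_ : v ≠ 0), ENNReal.ofReal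
    |Real.log (((fubiniStudy N).norm (f.map p) (f.fibreMap p v)) ^ (1 / (f.deg : ℝ)) /
      (fubiniStudy N).norm p v)|

/-- `c̄` of a sequence `f_1, f_2, …`; here `f i` stands for `f_{i+1}`. -/
def cBarSeq {N : ℕ} (f : ℕ → PolarizedMap N) : ℝ≥0∞ := ⨆ i, cBar (f i)

/-- The bounded sequences. -/
def BddSeq (N : ℕ) : Type := {f : ℕ → PolarizedMap N // cBarSeq f < ⊤}

/-- The shift on bounded sequences. -/
def BddSeq.shift {N : ℕ} (f : BddSeq N) : BddSeq N :=
  ⟨fun i => f.1 (i + 1), lt_of_le_of_lt (iSup_le fun i => le_iSup (fun j => cBar (f.1 j)) (i + 1))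
    f.2⟩

/-- The two properties that characterize the assignment `f ↦ ‖·‖^_f` of the admissible metrics to
the bounded sequences. -/
def IsAdmissibleFamily {N : ℕ} (h : BddSeq N → BundleMetric N) : Prop :=
  ∀ f : BddSeq N,
    (h f).IsContinuous ∧
    (∀ (p : PN N) (v : Fibre p), v ≠ 0 →
      ENNReal.ofReal |Real.log ((h f).norm p v / (fubiniStudy N).norm p v)| ≤ 2 * cBarSeq f.1) ∧
    ∀ (p : PN N) (v : Fibre p),
      (h f.shift).norm ((f.1 0).map p) ((f.1 0).fibreMap p v) = (h f).norm p v ^ (f.1 0).deg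

/-- `F^l ∘ ⋯ ∘ F^1`. -/
def iterLift {N : ℕ} (f : ℕ → PolarizedMap N) : ℕ → V N → V N
  | 0, x => x
  | l + 1, x => (f l).lift (iterLift f l x)

/-- `G_l(x) = (d_1 ⋯ d_l)⁻¹ log |F^l ∘ ⋯ ∘ F^1 (x)|²`. -/
def greenApprox {N : ℕ} (f : ℕ → PolarizedMap N) (l : ℕ) (x : V N) : ℝ :=
  1 / ((∏ i ∈ Finset.range l, (f i).deg : ℕ) : ℝ) * Real.log (euclNorm (iterLift f l x) ^ 2)

/-- The Green function, the limit of the `G_l` (on `ℂ^{N+1} ∖ {0}`). -/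
def greenFunction {N : ℕ} (f : ℕ → PolarizedMap N) (x : V N) : ℝ :=
  limUnder atTop fun l => greenApprox f l x

/-! ### Differential forms

Real differential forms of degree `k` on `ℂ^{N+1} ∖ {0}` are functions with values in the
alternating forms; their values at `0` are irrelevant. -/

/-- Multiplication by `c` as a real linear map. -/
def mulBy (N : ℕ) (c : ℂ) : V N →L[ℝ] V N := c • ContinuousLinearMap.id ℝ (V N)

/-- `d^c = (4π)⁻¹ J⁻¹ d J = (i/4π)(∂̄ - ∂)`, where `(Jω)(v_1, …) = ω(i v_1, …)`. -/
def dc {N k : ℕ} (ω : V N → V N [⋀^Fin k]→L[ℝ] ℝ) (x : V N) : V N [⋀^Fin (k + 1)]→L[ℝ] ℝ :=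
  (1 / (4 * Real.pi)) •
    (extDeriv (fun y => (ω y).compContinuousLinearMap (mulBy N Complex.I)) x
      ).compContinuousLinearMap (mulBy N (-Complex.I))

/-- `dd^c = (i/2π) ∂∂̄`. -/
def ddc {N k : ℕ} (ω : V N → V N [⋀^Fin k]→L[ℝ] ℝ) :
    V N → V N [⋀^Fin (k + 1 + 1)]→L[ℝ] ℝ :=
  extDeriv (dc ω)

/-- The smooth real `k`-forms on `ℙ^N(ℂ)`, identified through `π^*` with the forms on
`ℂ^{N+1} ∖ {0}` that are smooth, `ℂ^*`-invariant and horizontal (they vanish as soon as one argument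
is tangent to the fibre of `π`). The value at `0` is normalized to `0`. -/
def ProjForm (N k : ℕ) : Submodule ℝ (V N → V N [⋀^Fin k]→L[ℝ] ℝ) where
  carrier := {ω | ω 0 = 0 ∧ ContDiffOn ℝ ((⊤ : ℕ∞) : WithTop ℕ∞) ω {0}ᶜ ∧
    (∀ (c : ℂ) (x : V N) (v : Fin k → V N), c ≠ 0 → x ≠ 0 →
      ω (c • x) (fun j => c • v j) = ω x v) ∧
    ∀ (x : V N) (v : Fin k → V N), x ≠ 0 → (∃ (j : Fin k) (c : ℂ), v j = c • x) → ω x v = 0}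
  zero_mem' := ⟨rfl, contDiffOn_const, fun _ _ _ _ _ => rfl, fun _ _ _ _ => rfl⟩
  add_mem' := by
    rintro a b ⟨a0, a1, a2, a3⟩ ⟨b0, b1, b2, b3⟩
    refine ⟨by simp [a0, b0], a1.add b1, fun c x v hc hx => ?_, fun x v hx hv => ?_⟩
    · simp [a2 c x v hc hx, b2 c x v hc hx]
    · simp [a3 x v hx hv, b3 x v hx hv]
  smul_mem' := by
    rintro r a ⟨a0, a1, a2, a3⟩
    refine ⟨by simp [a0], a1.const_smul r, fun c x v hc hx => ?_, fun x v hx hv => ?_⟩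
    · simp [a2 c x v hc hx]
    · simp [a3 x v hx hv]

/-- The smooth real `k`-forms with compact support in `ℂ^{N+1} ∖ {0}`. -/
def IsTestForm {N k : ℕ} (η : V N → V N [⋀^Fin k]→L[ℝ] ℝ) : Prop :=
  ContDiff ℝ ((⊤ : ℕ∞) : WithTop ℕ∞) η ∧ HasCompactSupport η ∧ (0 : V N) ∉ tsupport η

/-- `ω = π_* η`, integration over the fibres of `π : ℂ^{N+1} ∖ {0} → ℙ^N(ℂ)`. The fibre through `x`
is parametrized by `t ↦ t x`, `t = a + i b ∈ ℂ^*`, so `∂_a = x` and `∂_b = i x`; a lift to `t x` of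
the tangent vector represented by `v` at `x` is `t v`. -/
def IsFibreIntegral {N k : ℕ} (η : V N → V N [⋀^Fin (k + 1 + 1)]→L[ℝ] ℝ)
    (ω : ProjForm N k) : Prop :=
  ∀ (x : V N) (v : Fin k → V N), x ≠ 0 →
    ω.1 x v = ∫ t : ℂ, η (t • x)
      (Fin.cons x (Fin.cons (Complex.I • x) (fun j => t • v j) : Fin (k + 1) → V N))

/-- The positively oriented real frame `e_0, i e_0, e_1, i e_1, …` of `ℂ^k` (for `m = 2k`). -/
def frame (k m : ℕ) (j : Fin m) : Fin k → ℂ :=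
  fun i => if (i : ℕ) = (j : ℕ) / 2 then (if (j : ℕ) % 2 = 0 then 1 else Complex.I) else 0

/-- Let `b : ℂ^{k+1} → ℂ^{N+1}` be linear and injective and `Ω` a `2k`-form on `ℙ^N(ℂ)` (`m = 2k`).
In the affine chart `z ↦ b(1, z)`, which covers the linear subspace `ℙ(im b) ≅ ℙ^k` up to a null
set, the restriction of `Ω` to `ℙ(im b)` is this function times the Lebesgue volume form. -/
def chartCoeff {N k m : ℕ} (b : V k →ₗ[ℂ] V N) (Ω : V N → V N [⋀^Fin m]→L[ℝ] ℝ)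
    (z : Fin k → ℂ) : ℝ :=
  Ω (b (Fin.cons (1 : ℂ) z : V k))
    (fun j => b (Fin.cons (0 : ℂ) (frame k m j) : V k))

theorem cons_one_ne_zero {N : ℕ} (z : Fin N → ℂ) : (Fin.cons (1 : ℂ) z : V N) ≠ 0 :=
  fun h => one_ne_zero (α := ℂ) (by simpa using congrFun h 0)

/-- The point `(1 : z_1 : … : z_N)`. -/
def chartPoint {N : ℕ} (z : Fin N → ℂ) : PN N :=
  Projectivization.mk ℂ (Fin.cons (1 : ℂ) z : V N) (cons_one_ne_zero z)

theorem exists_divisorParam {n : ℕ} (s : Module.Dual ℂ (V (n + 1))) (hs : s ≠ 0) :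
    ∃ b : V n →ₗ[ℂ] V (n + 1), Function.Injective b ∧ LinearMap.range b = LinearMap.ker s := by
  have hr := Module.Dual.finrank_ker_add_one_of_ne_zero hs
  have h : Module.finrank ℂ (V n) = Module.finrank ℂ (LinearMap.ker s) := by
    simp only [Module.finrank_fin_fun] at hr ⊢
    omega
  let e := LinearEquiv.ofFinrankEq (V n) (LinearMap.ker s) h
  refine ⟨(LinearMap.ker s).subtype ∘ₗ e.toLinearMap, ?_, ?_⟩
  · exact (Submodule.injective_subtype _).comp e.injective
  · rw [LinearMap.range_comp, LinearEquiv.range, Submodule.map_top, Submodule.range_subtype]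

/-- A linear parametrization of the hyperplane `div(s) ⊆ ℙ^{n+1}(ℂ)` by `ℙ^n(ℂ)`. (Integrals over
`div(s)` do not depend on the choice.) -/
def divisorParam {n : ℕ} (s : Module.Dual ℂ (V (n + 1))) (hs : s ≠ 0) : V n →ₗ[ℂ] V (n + 1) :=
  (exists_divisorParam s hs).choose

/-! ### Currents

A real current of degree 2 on `ℙ^{n+1}(ℂ)` is a continuous linear functional on the
smooth real `2n`-forms. -/

/-- Continuity of a functional on the smooth forms in the `C^∞` topology: it is bounded by a `C^r`
seminorm over a compact set that meets all fibres of `π`. -/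
def IsCurrent {N k : ℕ} (T : ProjForm N k →ₗ[ℝ] ℝ) : Prop :=
  ∃ (r : ℕ) (C : ℝ), ∀ (ω : ProjForm N k) (B : ℝ),
    (∀ j ≤ r, ∀ x : V N, ‖x‖ = 1 → ‖iteratedFDeriv ℝ j ω.1 x‖ ≤ B) → |T ω| ≤ C * B

/-- A current of degree 2 has bidegree `(1,1)` if it kills the forms of type `(p,q)` with `p ≠ q`,
i.e. is invariant under `ω ↦ ω(c ·, …, c ·)` for `|c| = 1`, which acts on the `(p,q)`-forms
as `c^{p-q}`. -/
def IsBidegreeOneOne {N k : ℕ} (T : ProjForm N k →ₗ[ℝ] ℝ) : Prop :=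
  ∀ (c : ℂ) (ω ω' : ProjForm N k), ‖c‖ = 1 →
    (∀ (x : V N) (v : Fin k → V N), ω'.1 x v = ω.1 x fun j => c • v j) → T ω' = T ω

/-- Closedness of a current: it vanishes on exact forms. -/
def IsClosedCurrent {N k : ℕ} (T : ProjForm N k →ₗ[ℝ] ℝ) : Prop :=
  ∀ (l : ℕ) (hl : k = l + 1) (β : ProjForm N l) (ω : ProjForm N k),
    (∀ (x : V N) (v : Fin k → V N), x ≠ 0 →
      ω.1 x v = extDeriv β.1 x fun j => v (Fin.cast hl.symm j)) → T ω = 0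

/-- Positivity of a current of bidegree `(1,1)` on `ℙ^{n+1}(ℂ)`: it is nonnegative on the forms
whose `(n,n)`-part is positive, i.e. with `ω(w_1, i w_1, …, w_n, i w_n) ≥ 0` for all `w` (the other
parts of `ω` do not contribute to this value). -/
def IsPositiveCurrent {n : ℕ} (T : ProjForm (n + 1) (2 * n) →ₗ[ℝ] ℝ) : Prop :=
  ∀ ω : ProjForm (n + 1) (2 * n),
    (∀ (x : V (n + 1)) (w : ℕ → V (n + 1)), x ≠ 0 →
      0 ≤ ω.1 x fun j => if (j : ℕ) % 2 = 0 then w ((j : ℕ) / 2)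
        else Complex.I • w ((j : ℕ) / 2)) →
    0 ≤ T ω

/-- `T` is the Green current for `f`: a positive closed `(1,1)`-current on `ℙ^{n+1}(ℂ)` with
`π^* T = dd^c G_f` as currents on `ℂ^{n+2} ∖ {0}`. Here `⟨π^* T, η⟩ = ⟨T, π_* η⟩` and
`⟨dd^c G, η⟩ = ∫ G dd^c η`. -/
def IsGreenCurrent {n : ℕ} (f : ℕ → PolarizedMap (n + 1))
    (T : ProjForm (n + 1) (2 * n) →ₗ[ℝ] ℝ) : Prop :=
  IsCurrent T ∧ IsBidegreeOneOne T ∧ IsClosedCurrent T ∧ IsPositiveCurrent T ∧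
  ∀ (η : V (n + 1) → V (n + 1) [⋀^Fin (2 * n + 1 + 1)]→L[ℝ] ℝ)
    (ω : ProjForm (n + 1) (2 * n)), IsTestForm η → IsFibreIntegral η ω →
    T ω = ∫ x : V (n + 1), greenFunction f x * ddc η x (frame (n + 2) _)

/-- In the affine chart, the function whose integral is
`⟨dd^c [-log ‖s‖²], ω⟩ = ∫_{ℙ^{n+1}} -log ‖s‖² dd^c ω`. -/
def logTerm {n : ℕ} (h : BundleMetric (n + 1)) (s : Module.Dual ℂ (V (n + 1)))
    (ω : ProjForm (n + 1) (2 * n)) (z : Fin (n + 1) → ℂ) : ℝ :=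
  -Real.log (h.norm (chartPoint z) (sectionAt s (chartPoint z)) ^ 2) *
    chartCoeff LinearMap.id (ddc ω.1) z

/-- In an affine chart of `div(s)`, the function whose integral is
`⟨δ_{div(s)}, ω⟩ = ∫_{div(s)} ω`. -/
def divTerm {n : ℕ} (s : Module.Dual ℂ (V (n + 1))) (hs : s ≠ 0)
    (ω : ProjForm (n + 1) (2 * n)) (z : Fin n → ℂ) : ℝ :=
  chartCoeff (divisorParam s hs) ω.1 z

/-- The first Chern current `c_1(O(1), ‖·‖) = dd^c [-log ‖s‖²] + δ_{div(s)}`, computed with the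
nonzero section `s` and evaluated at the form `ω`. -/
def chernCurrent {n : ℕ} (h : BundleMetric (n + 1)) (s : Module.Dual ℂ (V (n + 1))) (hs : s ≠ 0)
    (ω : ProjForm (n + 1) (2 * n)) : ℝ :=
  (∫ z : Fin (n + 1) → ℂ, logTerm h s ω z) + ∫ z : Fin n → ℂ, divTerm s hs ω z

end RandomDyn

end

open RandomDyn

noncomputable section

namespace RandomDyn

/-! ### Differentiability of antisymmetrized multilinear maps -/

section CLM

variable {E F G : Type*} [NormedAddCommGroup E] [NormedSpace ℝ E] [NormedAddCommGroup F]
  [NormedSpace ℝ F] [NormedAddCommGroup G] [NormedSpace ℝ G]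

/-! The admissible metric is explicit: `‖v‖ = |v(x)| exp(-G(x)/2)`, where `G` is the Green function
(`greenMetric`). Since all degrees are at least 2, the increments `G_{l+1} - G_l` are bounded by `2
c̄ / 2^l`. Hence the `G_l` converge uniformly and `|G - log |x|²| ≤ 4 c̄`. In the limit `G(cx) =
G(x) + log |c|²`, which makes the metric independent of the representative `x`, and `G_{Sf}(F¹(x)) =
d₁ G_f(x)`, which is the shift relation. The logarithm of the quotient of two admissible metrics is
at most `4 c̄`, and each use of the shift relation at least halves this bound
(`abs_log_norm_div_le`). Hence uniqueness.

For a nonzero linear form `s` one gets `-log ‖s‖² = G - log |s|²` on the cone. By Poincaré–Lelong,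
`dd^c log |s|²` is integration over `ker s`, so for every test form `η` on the cone `∫ G dd^c η = ∫
-log ‖s‖² dd^c η + ∫_{ker s} η`. The function `-log ‖s‖²` is constant on the fibres of `π`, and
integration over the fibres commutes with `dd^c`. With `ω = π_* η` the right side is therefore the
Chern current at `ω` (`integral_greenFunction_mul_ddc`), and in particular the left side depends on
`η` only through `ω`. Conversely, every `ω` is the fibre integral of the test form `coneLift ω`, the
product of `ω` with a `(1,1)`-form that is cut off in the fibre direction and has mass 1 on each
fibre. So the equation `π^* T = dd^c G` is equivalent to `T ω = ∫ G dd^c (coneLift ω)` for all `ω`.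
This gives existence and uniqueness of `T` and its equality with the Chern current for every `s`.

That this `T` is a positive closed `(1,1)`-current is checked on the formula. Continuity: two
derivatives of `coneLift ω` are controlled by those of `ω` on the unit sphere, by homogeneity.
Bidegree: `dd^c` commutes with unit rotations of the arguments. Closedness: `dd^c d = 0`, and
Stokes' theorem holds on the hyperplane. Positivity: `G` is the limit of positive multiples of `log
∑ |F_k|²` with polynomials `F_k`.

The Levi form of `log ∑ |F_k|²` is, by Lagrange's identity, a sum of squares of the forms `F_k dF_j
- F_j dF_k` (`leviForm_log_sum`). It is used twice: for positivity with the components of `F^l ∘ ⋯ ∘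
F^1`, and for Poincaré–Lelong with the pair `x₀, δ` as `δ → 0`, where it produces an approximate
identity. Fibre integration is done in the coordinates `(t, z) ↦ (t, t z)`, in which `π` becomes the
projection of a product. -/

theorem hasFDerivAt_clm_comp (L : F →L[ℝ] G) {f : E → F} {f' : E →L[ℝ] F} {x : E}
    (h : HasFDerivAt f f' x) : HasFDerivAt (fun y => L (f y)) (L.comp f') x :=
  L.hasFDerivAt.comp x h

theorem contDiffAt_clm_comp (L : F →L[ℝ] G) {f : E → F} {x : E} {n : WithTop ℕ∞}
    (h : ContDiffAt ℝ n f x) : ContDiffAt ℝ n (fun y => L (f y)) x :=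
  L.contDiff.contDiffAt.comp x h

open ContinuousAlternatingMap

theorem hasFDerivAt_alternatize {m : ℕ} {f : E → E →L[ℝ] E [⋀^Fin m]→L[ℝ] ℝ}
    {f' : E →L[ℝ] E →L[ℝ] E [⋀^Fin m]→L[ℝ] ℝ} {x : E} (h : HasFDerivAt f f' x) :
    HasFDerivAt (fun y => alternatizeUncurryFin (f y))
      ((alternatizeUncurryFinCLM ℝ E ℝ).comp f') x :=
  hasFDerivAt_clm_comp (E := E) (F := E →L[ℝ] E [⋀^Fin m]→L[ℝ] ℝ)
    (G := E [⋀^Fin (m + 1)]→L[ℝ] ℝ) (alternatizeUncurryFinCLM ℝ E ℝ) h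

theorem hasFDerivAt_alternatize_comp {m : ℕ} {f : E → E →L[ℝ] E [⋀^Fin m]→L[ℝ] ℝ}
    {f' : E →L[ℝ] E →L[ℝ] E [⋀^Fin m]→L[ℝ] ℝ} {x : E} (L : E →L[ℝ] E) (h : HasFDerivAt f f' x) :
    HasFDerivAt (fun y => alternatizeUncurryFin ((f y).comp L))
      ((alternatizeUncurryFinCLM ℝ E ℝ).comp
        (((ContinuousLinearMap.compL ℝ E E (E [⋀^Fin m]→L[ℝ] ℝ)).flip L).comp f')) x :=
  hasFDerivAt_alternatize (hasFDerivAt_clm_comp (E := E) (F := E →L[ℝ] E [⋀^Fin m]→L[ℝ] ℝ)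
    (G := E →L[ℝ] E [⋀^Fin m]→L[ℝ] ℝ)
    ((ContinuousLinearMap.compL ℝ E E (E [⋀^Fin m]→L[ℝ] ℝ)).flip L) h)

theorem contDiffAt_alternatize {m : ℕ} {f : E → E →L[ℝ] E [⋀^Fin m]→L[ℝ] ℝ} {x : E}
    {n : WithTop ℕ∞} (h : ContDiffAt ℝ n f x) :
    ContDiffAt ℝ n (fun y => alternatizeUncurryFin (f y)) x :=
  contDiffAt_clm_comp (E := E) (F := E →L[ℝ] E [⋀^Fin m]→L[ℝ] ℝ)
    (G := E [⋀^Fin (m + 1)]→L[ℝ] ℝ) (alternatizeUncurryFinCLM ℝ E ℝ) h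

theorem contDiffAt_alternatize_comp {m : ℕ} {f : E → E →L[ℝ] E [⋀^Fin m]→L[ℝ] ℝ} {x : E}
    {n : WithTop ℕ∞} (L : E →L[ℝ] E) (h : ContDiffAt ℝ n f x) :
    ContDiffAt ℝ n (fun y => alternatizeUncurryFin ((f y).comp L)) x :=
  contDiffAt_alternatize (contDiffAt_clm_comp (E := E) (F := E →L[ℝ] E [⋀^Fin m]→L[ℝ] ℝ)
    (G := E →L[ℝ] E [⋀^Fin m]→L[ℝ] ℝ)
    ((ContinuousLinearMap.compL ℝ E E (E [⋀^Fin m]→L[ℝ] ℝ)).flip L) h)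

end CLM

open ContinuousAlternatingMap in
/-- Antisymmetrization in all slots of a form-valued bilinear map. -/
def antisymm₂ {E : Type*} [NormedAddCommGroup E] [NormedSpace ℝ E] {m : ℕ}
    (S : E →L[ℝ] E →L[ℝ] E [⋀^Fin m]→L[ℝ] ℝ) : E [⋀^Fin (m + 1 + 1)]→L[ℝ] ℝ :=
  alternatizeUncurryFin (alternatizeUncurryFinCLM ℝ E ℝ ∘L S)

section Antisymm

open ContinuousAlternatingMap

variable {E : Type*} [NormedAddCommGroup E] [NormedSpace ℝ E] {m : ℕ}

theorem antisymm₂_apply (S : E →L[ℝ] E →L[ℝ] E [⋀^Fin m]→L[ℝ] ℝ) (v : Fin (m + 1 + 1) → E) :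
    antisymm₂ S v = ∑ i : Fin (m + 1), ∑ j ≥ i, (-1 : ℝ) ^ (i + j : ℕ) *
      (S (v i.castSucc) (v j.succ) (j.removeNth <| i.castSucc.removeNth v) -
        S (v j.succ) (v i.castSucc) (j.removeNth <| i.castSucc.removeNth v)) := by
  rw [antisymm₂, alternatizeUncurryFin_alternatizeUncurryFinCLM_comp_apply]
  simp [zsmul_eq_mul]

/-- Exchanging the first two arguments of the bilinear map swaps the two terms of each bracket in
`antisymm₂_apply`. -/
theorem antisymm₂_eq_neg {S S' : E →L[ℝ] E →L[ℝ] E [⋀^Fin m]→L[ℝ] ℝ}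
    (h : ∀ v w u, S v w u = S' w v u) : antisymm₂ S = -antisymm₂ S' := by
  ext v
  simp only [antisymm₂_apply, h, ContinuousAlternatingMap.neg_apply, ← Finset.sum_neg_distrib]
  refine Finset.sum_congr rfl fun i _ => Finset.sum_congr rfl fun j _ => ?_
  ring

end Antisymm

theorem mulBy_apply {N : ℕ} (c : ℂ) (x : V N) : mulBy N c x = c • x := by
  simp [mulBy]

/-! ### The operators `d^c` and `dd^c` -/

section Forms

open ContinuousAlternatingMap

variable {N m : ℕ}

/-- `4π d^c`, as the antisymmetrization of the derivative along `-i v`. -/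
theorem dc_eq {ω : V N → V N [⋀^Fin m]→L[ℝ] ℝ} {x : V N} (h : DifferentiableAt ℝ ω x) :
    dc ω x = (1 / (4 * Real.pi)) •
      alternatizeUncurryFin ((fderiv ℝ ω x).comp (mulBy N (-Complex.I))) := by
  have h1 : HasFDerivAt (fun y => (ω y).compContinuousLinearMap (mulBy N Complex.I))
      ((compContinuousLinearMapCLM (mulBy N Complex.I)).comp (fderiv ℝ ω x)) x :=
    (compContinuousLinearMapCLM (𝕜 := ℝ) (F := ℝ) (ι := Fin m)
      (mulBy N Complex.I)).hasFDerivAt.comp x h.hasFDerivAt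
  rw [dc, extDeriv, h1.fderiv]
  congr 1
  ext v
  simp only [compContinuousLinearMap_apply, alternatizeUncurryFin_apply]
  refine Finset.sum_congr rfl fun i _ => ?_
  congr 1
  -- On the remaining arguments `i · (-i) = 1` cancels; only the direction of differentiation keeps
  -- the factor `-i`.
  change fderiv ℝ ω x (mulBy N (-Complex.I) (v i)) _ = fderiv ℝ ω x (mulBy N (-Complex.I) (v i)) _
  congr 1
  ext j k
  simp [Fin.removeNth, mulBy_apply, ← mul_assoc]

/-- The second derivative of `ω`, the second argument being multiplied by `-i`. -/
def twistedHess (ω : V N → V N [⋀^Fin m]→L[ℝ] ℝ) (x : V N) :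
    V N →L[ℝ] V N →L[ℝ] V N [⋀^Fin m]→L[ℝ] ℝ :=
  ((ContinuousLinearMap.compL ℝ (V N) (V N) (V N [⋀^Fin m]→L[ℝ] ℝ)).flip
    (mulBy N (-Complex.I))).comp (fderiv ℝ (fderiv ℝ ω) x)

theorem twistedHess_apply (ω : V N → V N [⋀^Fin m]→L[ℝ] ℝ) (x v w : V N) :
    twistedHess ω x v w = fderiv ℝ (fderiv ℝ ω) x v (-Complex.I • w) := by
  simp [twistedHess, mulBy_apply]

/-- The formula `dc_eq` holds in a neighbourhood of `x` and can be differentiated once more; the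
factor `-i` stays on the inner derivative. All pointwise identities for `dd^c` are reduced to this
expression in the second derivative. -/
theorem ddc_eq {ω : V N → V N [⋀^Fin m]→L[ℝ] ℝ} {x : V N} (h : ContDiffAt ℝ 2 ω x) :
    ddc ω x = (1 / (4 * Real.pi)) • antisymm₂ (twistedHess ω x) := by
  have hd : DifferentiableAt ℝ (fderiv ℝ ω) x :=
    (h.fderiv_right (m := 1) le_rfl).differentiableAt one_ne_zero
  have h1 : dc ω =ᶠ[nhds x] fun y => (1 / (4 * Real.pi)) •
      alternatizeUncurryFin ((fderiv ℝ ω y).comp (mulBy N (-Complex.I))) := by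
    filter_upwards [h.eventually (by simp)] with y hy
    exact dc_eq (hy.differentiableAt two_ne_zero)
  have h2 : HasFDerivAt (fun y => (1 / (4 * Real.pi)) •
      alternatizeUncurryFin ((fderiv ℝ ω y).comp (mulBy N (-Complex.I))))
      ((1 / (4 * Real.pi)) • (alternatizeUncurryFinCLM ℝ (V N) ℝ).comp (twistedHess ω x)) x :=
    (hasFDerivAt_alternatize_comp (mulBy N (-Complex.I)) hd.hasFDerivAt).const_smul
      (1 / (4 * Real.pi))
  rw [ddc, h1.extDeriv_eq, extDeriv, h2.fderiv, alternatizeUncurryFin_smul]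
  rfl

/-- Symmetry of the second derivative moves the factor `-i` from one slot to the other, and the
antisymmetrization turns this exchange into a sign. -/
theorem dc_extDeriv {ω : V N → V N [⋀^Fin m]→L[ℝ] ℝ} {x : V N} (h : ContDiffAt ℝ 2 ω x) :
    dc (extDeriv ω) x = -ddc ω x := by
  have hd : DifferentiableAt ℝ (fderiv ℝ ω) x :=
    (h.fderiv_right (m := 1) le_rfl).differentiableAt one_ne_zero
  have h2 : HasFDerivAt (extDeriv ω)
      ((alternatizeUncurryFinCLM ℝ (V N) ℝ).comp (fderiv ℝ (fderiv ℝ ω) x)) x :=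
    hasFDerivAt_alternatize hd.hasFDerivAt
  have hs : IsSymmSndFDerivAt ℝ ω x := h.isSymmSndFDerivAt (by simp)
  have h3 : antisymm₂ ((fderiv ℝ (fderiv ℝ ω) x).comp (mulBy N (-Complex.I))) =
      -antisymm₂ (twistedHess ω x) := by
    refine antisymm₂_eq_neg fun v w u => ?_
    rw [twistedHess_apply, ← hs.eq]
    simp [mulBy_apply]
  rw [dc_eq h2.differentiableAt, h2.fderiv, ddc_eq h]
  ext v
  have h4 := congrArg (fun τ => 1 / (4 * Real.pi) * τ v) h3
  exact h4.trans (mul_neg _ _)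

/-- `dd^c` kills closed forms. -/
theorem ddc_extDeriv {ω : V N → V N [⋀^Fin m]→L[ℝ] ℝ} {x : V N} (h : ContDiffAt ℝ 3 ω x) :
    ddc (extDeriv ω) x = 0 := by
  -- Since `d^c d = -d d^c` near `x`, the outer `d` is applied to an exact form.
  have h1 : dc (extDeriv ω) =ᶠ[nhds x] (-1 : ℝ) • extDeriv (dc ω) := by
    filter_upwards [h.eventually (by simp)] with y hy
    rw [dc_extDeriv (hy.of_le (by norm_cast))]
    simp [ddc]
  have h3 : ContDiffAt ℝ 2 (dc ω) x := by
    have h4 : dc ω =ᶠ[nhds x] fun y => (1 / (4 * Real.pi)) •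
      alternatizeUncurryFin ((fderiv ℝ ω y).comp (mulBy N (-Complex.I))) := by
      filter_upwards [h.eventually (by simp)] with y hy
      exact dc_eq (hy.differentiableAt three_ne_zero)
    refine ContDiffAt.congr_of_eventuallyEq ?_ h4
    have h5 : ContDiffAt ℝ 2 (fderiv ℝ ω) x := h.fderiv_right (m := 2) (by norm_cast)
    exact (contDiffAt_alternatize_comp (mulBy N (-Complex.I)) h5).const_smul _
  rw [ddc, h1.extDeriv_eq, extDeriv_smul, extDeriv_extDeriv_apply h3 (by simp), smul_zero]

/-- `dd^c` commutes with the action of the unit complex numbers on the values of forms. -/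
theorem ddc_comp_mulBy {ω : V N → V N [⋀^Fin m]→L[ℝ] ℝ} {x : V N} (h : ContDiffAt ℝ 2 ω x)
    {c : ℂ} (hc : ‖c‖ = 1) :
    ddc (fun y => (ω y).compContinuousLinearMap (mulBy N c)) x =
      (ddc ω x).compContinuousLinearMap (mulBy N c) := by
  have hC : ContDiffAt ℝ 2 (fun y => (ω y).compContinuousLinearMap (mulBy N c)) x :=
    (compContinuousLinearMapCLM (𝕜 := ℝ) (F := ℝ) (ι := Fin m)
      (mulBy N c)).contDiff.contDiffAt.comp x h
  have hs : IsSymmSndFDerivAt ℝ ω x := h.isSymmSndFDerivAt (by simp)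
  have e1 : fderiv ℝ (fun y => (ω y).compContinuousLinearMap (mulBy N c)) =ᶠ[nhds x]
      fun y => ContinuousLinearMap.compL ℝ (V N) _ _ (compContinuousLinearMapCLM (𝕜 := ℝ) (F := ℝ)
        (ι := Fin m) (mulBy N c)) (fderiv ℝ ω y) := by
    filter_upwards [h.eventually (by simp)] with y hy
    exact ((compContinuousLinearMapCLM (𝕜 := ℝ) (F := ℝ) (ι := Fin m)
      (mulBy N c)).hasFDerivAt.comp y (hy.differentiableAt two_ne_zero).hasFDerivAt).fderiv
  have hd : DifferentiableAt ℝ (fderiv ℝ ω) x :=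
    (h.fderiv_right (m := 1) le_rfl).differentiableAt one_ne_zero
  have e2 : fderiv ℝ (fderiv ℝ (fun y => (ω y).compContinuousLinearMap (mulBy N c))) x =
      (ContinuousLinearMap.compL ℝ (V N) _ _ (compContinuousLinearMapCLM (𝕜 := ℝ) (F := ℝ)
        (ι := Fin m) (mulBy N c))).comp (fderiv ℝ (fderiv ℝ ω) x) := by
    rw [e1.fderiv_eq]
    exact (hasFDerivAt_clm_comp (E := V N) (F := V N →L[ℝ] V N [⋀^Fin m]→L[ℝ] ℝ)
      (G := V N →L[ℝ] V N [⋀^Fin m]→L[ℝ] ℝ) (ContinuousLinearMap.compL ℝ (V N) _ _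
      (compContinuousLinearMapCLM (𝕜 := ℝ) (F := ℝ) (ι := Fin m) (mulBy N c)))
      hd.hasFDerivAt).fderiv
  rw [ddc_eq hC, ddc_eq h]
  ext v
  rw [compContinuousLinearMap_apply]
  change _ * antisymm₂ _ _ = _ * antisymm₂ _ _
  congr 1
  simp only [antisymm₂_apply, twistedHess_apply, e2]
  refine Finset.sum_congr rfl fun i _ => Finset.sum_congr rfl fun j _ => ?_
  congr 1
  set D := fderiv ℝ (fderiv ℝ ω) x
  -- The antisymmetrized twisted Hessian is of type `(1,1)` in its two distinguished arguments,
  -- hence invariant under `|c| = 1`. After expanding `c = re c + i im c`, the mixed terms cancel by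
  -- symmetry and the others add up with weight `re² + im² = 1`.
  have key : ∀ (a b : V N) (u : Fin m → V N), D a (-Complex.I • b) u - D b (-Complex.I • a) u =
      D (c • a) (-Complex.I • c • b) u - D (c • b) (-Complex.I • c • a) u := by
    intro a b u
    have hre : ∀ y : V N, c • y = c.re • y + c.im • (Complex.I • y) := by
      intro y
      ext k
      simp only [Pi.smul_apply, Pi.add_apply, smul_eq_mul, Complex.real_smul]
      nth_rewrite 1 [← Complex.re_add_im c]
      ring
    have hI : ∀ y : V N, -Complex.I • c • y = c.im • y - c.re • (Complex.I • y) := by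
      intro y
      rw [hre]
      ext k
      simp only [Pi.smul_apply, Pi.add_apply, Pi.sub_apply, smul_eq_mul, Complex.real_smul]
      linear_combination (-c.im * y k) * Complex.I_mul_I
    have hn : c.re ^ 2 + c.im ^ 2 = 1 := by
      have := Complex.sq_norm c
      rw [hc, Complex.normSq_apply] at this
      nlinarith
    have s1 := congrArg (fun τ => τ u) (hs.eq a b)
    have s2 := congrArg (fun τ => τ u) (hs.eq a (Complex.I • b))
    have s3 := congrArg (fun τ => τ u) (hs.eq b (Complex.I • a))
    have s4 := congrArg (fun τ => τ u) (hs.eq (Complex.I • a) (Complex.I • b))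
    change D a b u = D b a u at s1
    change D a (Complex.I • b) u = D (Complex.I • b) a u at s2
    change D b (Complex.I • a) u = D (Complex.I • a) b u at s3
    change D (Complex.I • a) (Complex.I • b) u = D (Complex.I • b) (Complex.I • a) u at s4
    rw [hI a, hI b, hre a, hre b]
    simp only [map_add, map_sub, map_smul, neg_smul, map_neg]
    change -D a (Complex.I • b) u - -D b (Complex.I • a) u =
      (c.im * (c.re * D a b u + c.im * D (Complex.I • a) b u) -
        c.re * (c.re * D a (Complex.I • b) u + c.im * D (Complex.I • a) (Complex.I • b) u)) -
      (c.im * (c.re * D b a u + c.im * D (Complex.I • b) a u) -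
        c.re * (c.re * D b (Complex.I • a) u + c.im * D (Complex.I • b) (Complex.I • a) u))
    rw [s1, s4, ← s2, ← s3]
    linear_combination (D b (Complex.I • a) u - D a (Complex.I • b) u) * (-hn)
  exact (key _ _ _).trans (by simp [mulBy_apply]; rfl)

/-- The exterior derivative commutes with pullback, for a map with given derivatives. -/
theorem extDeriv_pullback_of_contDiff {E F : Type*} [NormedAddCommGroup E] [NormedSpace ℝ E]
    [NormedAddCommGroup F] [NormedSpace ℝ F] {ω : F → F [⋀^Fin m]→L[ℝ] ℝ} {f : E → F}
    (hf : ContDiff ℝ 2 f) {x : E} (hω : DifferentiableAt ℝ ω (f x)) :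
    extDeriv (fun y => (ω (f y)).compContinuousLinearMap (fderiv ℝ f y)) x =
      (extDeriv ω (f x)).compContinuousLinearMap (fderiv ℝ f x) :=
  extDeriv_pullback hω hf.contDiffAt (by simp)

theorem pullback_mulBy {M : ℕ} {f : V N → V M}
    (hJ : ∀ x (c : ℂ) v, fderiv ℝ f x (c • v) = c • fderiv ℝ f x v) (x : V N) (c : ℂ)
    (τ : V M [⋀^Fin m]→L[ℝ] ℝ) :
    (τ.compContinuousLinearMap (fderiv ℝ f x)).compContinuousLinearMap (mulBy N c) =
      (τ.compContinuousLinearMap (mulBy M c)).compContinuousLinearMap (fderiv ℝ f x) := by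
  ext v
  simp only [compContinuousLinearMap_apply]
  congr 1
  ext j
  simp [mulBy_apply, hJ]

theorem dc_pullback {M : ℕ} {f : V N → V M} (hf : ContDiff ℝ 2 f)
    (hJ : ∀ x (c : ℂ) v, fderiv ℝ f x (c • v) = c • fderiv ℝ f x v)
    {ω : V M → V M [⋀^Fin m]→L[ℝ] ℝ} {x : V N} (hω : DifferentiableAt ℝ ω (f x)) :
    dc (fun y => (ω (f y)).compContinuousLinearMap (fderiv ℝ f y)) x =
      (dc ω (f x)).compContinuousLinearMap (fderiv ℝ f x) := by
  have h1 : DifferentiableAt ℝ (fun y => (ω y).compContinuousLinearMap (mulBy M Complex.I)) (f x) :=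
    (compContinuousLinearMapCLM (𝕜 := ℝ) (F := ℝ) (ι := Fin m)
      (mulBy M Complex.I)).differentiableAt.comp _ hω
  simp only [dc, pullback_mulBy hJ]
  rw [extDeriv_pullback_of_contDiff (ω := fun y => (ω y).compContinuousLinearMap
    (mulBy M Complex.I)) hf h1, pullback_mulBy hJ]
  rfl

/-- `dd^c` commutes with pullback by holomorphic maps. -/
theorem ddc_pullback {M : ℕ} {f : V N → V M} (hf : ContDiff ℝ 2 f)
    (hJ : ∀ x (c : ℂ) v, fderiv ℝ f x (c • v) = c • fderiv ℝ f x v)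
    {ω : V M → V M [⋀^Fin m]→L[ℝ] ℝ} {x : V N} (hω : ContDiffAt ℝ 2 ω (f x)) :
    ddc (fun y => (ω (f y)).compContinuousLinearMap (fderiv ℝ f y)) x =
      (ddc ω (f x)).compContinuousLinearMap (fderiv ℝ f x) := by
  have h1 : dc (fun y => (ω (f y)).compContinuousLinearMap (fderiv ℝ f y)) =ᶠ[nhds x]
      fun y => (dc ω (f y)).compContinuousLinearMap (fderiv ℝ f y) := by
    filter_upwards [hf.continuous.continuousAt.eventually (hω.eventually (by simp))] with y hy
    exact dc_pullback hf hJ (hy.differentiableAt two_ne_zero)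
  rw [ddc, h1.extDeriv_eq, extDeriv_pullback_of_contDiff hf]
  · rfl
  have h4 : dc ω =ᶠ[nhds (f x)] fun y => (1 / (4 * Real.pi)) •
      alternatizeUncurryFin ((fderiv ℝ ω y).comp (mulBy M (-Complex.I))) := by
    filter_upwards [hω.eventually (by simp)] with y hy
    exact dc_eq (hy.differentiableAt two_ne_zero)
  refine DifferentiableAt.congr_of_eventuallyEq ?_ h4
  have h5 : DifferentiableAt ℝ (fderiv ℝ ω) (f x) :=
    (hω.fderiv_right (m := 1) le_rfl).differentiableAt one_ne_zero
  exact (hasFDerivAt_alternatize_comp (mulBy M (-Complex.I)) h5.hasFDerivAt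
    ).differentiableAt.const_smul (1 / (4 * Real.pi))

end Forms

/-! ### Wedge products with a bilinear form -/

section Wedge

open ContinuousAlternatingMap

variable {E F : Type*} [NormedAddCommGroup E] [NormedSpace ℝ E] [NormedAddCommGroup F]
  [NormedSpace ℝ F] {m : ℕ}

/-- The wedge product (without normalization) of a bilinear form and an alternating form. -/
def wedge (b : E →L[ℝ] E →L[ℝ] ℝ) (τ : E [⋀^Fin m]→L[ℝ] ℝ) : E [⋀^Fin (m + 1 + 1)]→L[ℝ] ℝ :=
  antisymm₂ (((ContinuousLinearMap.smulRightL ℝ E (E [⋀^Fin m]→L[ℝ] ℝ)).flip τ).comp b)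

theorem wedge_apply (b : E →L[ℝ] E →L[ℝ] ℝ) (τ : E [⋀^Fin m]→L[ℝ] ℝ)
    (v : Fin (m + 1 + 1) → E) :
    wedge b τ v = ∑ i : Fin (m + 1), ∑ j ≥ i, (-1 : ℝ) ^ (i + j : ℕ) *
      ((b (v i.castSucc) (v j.succ) - b (v j.succ) (v i.castSucc)) *
        τ (j.removeNth <| i.castSucc.removeNth v)) := by
  rw [wedge, antisymm₂_apply]
  refine Finset.sum_congr rfl fun i _ => Finset.sum_congr rfl fun j _ => ?_
  congr 1
  rw [sub_mul]
  rfl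

/-- Only the antisymmetric part of `b` enters. This allows a twisted Hessian to be replaced by the
manifestly positive expression for its Levi form. -/
theorem wedge_congr {b b' : E →L[ℝ] E →L[ℝ] ℝ} (h : ∀ v w, b v w - b w v = b' v w - b' w v)
    (τ : E [⋀^Fin m]→L[ℝ] ℝ) : wedge b τ = wedge b' τ := by
  ext v
  simp only [wedge_apply, h]

theorem wedge_pullback (b : F →L[ℝ] F →L[ℝ] ℝ) (τ : F [⋀^Fin m]→L[ℝ] ℝ) (A : E →L[ℝ] F)
    (v : Fin (m + 1 + 1) → E) :
    wedge b τ (A ∘ v) =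
      wedge (((ContinuousLinearMap.compL ℝ E F ℝ).flip A).comp (b.comp A))
        (τ.compContinuousLinearMap A) v := by
  simp only [wedge_apply]
  rfl

theorem wedge_add_left (b b' : E →L[ℝ] E →L[ℝ] ℝ) (τ : E [⋀^Fin m]→L[ℝ] ℝ) :
    wedge (b + b') τ = wedge b τ + wedge b' τ := by
  ext v
  change _ = wedge b τ v + wedge b' τ v
  simp only [wedge_apply, ← Finset.sum_add_distrib]
  refine Finset.sum_congr rfl fun i _ => Finset.sum_congr rfl fun j _ => ?_
  change _ * (((b _ _ + b' _ _) - (b _ _ + b' _ _)) * _) = _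
  ring

theorem wedge_smul_left (c : ℝ) (b : E →L[ℝ] E →L[ℝ] ℝ) (τ : E [⋀^Fin m]→L[ℝ] ℝ) :
    wedge (c • b) τ = c • wedge b τ := by
  ext v
  change _ = c * wedge b τ v
  simp only [wedge_apply, Finset.mul_sum]
  refine Finset.sum_congr rfl fun i _ => Finset.sum_congr rfl fun j _ => ?_
  change _ * ((c * b _ _ - c * b _ _) * _) = _
  ring

theorem wedge_add_right (b : E →L[ℝ] E →L[ℝ] ℝ) (τ τ' : E [⋀^Fin m]→L[ℝ] ℝ) :
    wedge b (τ + τ') = wedge b τ + wedge b τ' := by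
  ext v
  change _ = wedge b τ v + wedge b τ' v
  simp only [wedge_apply, ← Finset.sum_add_distrib]
  refine Finset.sum_congr rfl fun i _ => Finset.sum_congr rfl fun j _ => ?_
  change _ * (_ * (τ _ + τ' _)) = _
  ring

theorem wedge_smul_right (c : ℝ) (b : E →L[ℝ] E →L[ℝ] ℝ) (τ : E [⋀^Fin m]→L[ℝ] ℝ) :
    wedge b (c • τ) = c • wedge b τ := by
  ext v
  change _ = c * wedge b τ v
  simp only [wedge_apply, Finset.mul_sum]
  refine Finset.sum_congr rfl fun i _ => Finset.sum_congr rfl fun j _ => ?_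
  change _ * (_ * (c * τ _)) = _
  ring

/-- The two successive antisymmetrizations are sums of `m + 1` and `m + 2` terms, which accounts for
the constant. -/
theorem norm_wedge_le (b : E →L[ℝ] E →L[ℝ] ℝ) (τ : E [⋀^Fin m]→L[ℝ] ℝ) :
    ‖wedge b τ‖ ≤ ((m + 1 : ℕ) + 1) * (m + 1) * ‖b‖ * ‖τ‖ := by
  rw [wedge, antisymm₂]
  refine (norm_alternatizeUncurryFin_le _).trans ?_
  rw [mul_assoc, mul_assoc]
  refine mul_le_mul_of_nonneg_left ?_ (by positivity)
  refine ContinuousLinearMap.opNorm_le_bound _ (by positivity) fun v => ?_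
  refine (norm_alternatizeUncurryFin_le _).trans ?_
  rw [mul_assoc]
  refine mul_le_mul_of_nonneg_left ?_ (by positivity)
  refine ContinuousLinearMap.opNorm_le_bound _ (by positivity) fun w => ?_
  change ‖b v w • τ‖ ≤ _
  rw [norm_smul]
  have : ‖b v w‖ ≤ ‖b‖ * ‖v‖ * ‖w‖ := b.le_opNorm₂ v w
  calc ‖b v w‖ * ‖τ‖ ≤ (‖b‖ * ‖v‖ * ‖w‖) * ‖τ‖ := by gcongr
    _ = _ := by ring

/-- The wedge product with a fixed bilinear form as a continuous linear map. -/
def wedgeRight (b : E →L[ℝ] E →L[ℝ] ℝ) :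
    (E [⋀^Fin m]→L[ℝ] ℝ) →L[ℝ] E [⋀^Fin (m + 1 + 1)]→L[ℝ] ℝ :=
  LinearMap.mkContinuous ⟨⟨wedge b, wedge_add_right b⟩, fun c => wedge_smul_right c b⟩
    (((m + 1 : ℕ) + 1) * (m + 1) * ‖b‖) (norm_wedge_le b)

theorem norm_wedgeRight_le (b : E →L[ℝ] E →L[ℝ] ℝ) :
    ‖wedgeRight (m := m) b‖ ≤ ((m + 1 : ℕ) + 1) * (m + 1) * ‖b‖ :=
  LinearMap.mkContinuous_norm_le _ (by positivity) _

/-- The wedge product as a linear map in the bilinear form. -/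
def wedgeLM (E : Type*) [NormedAddCommGroup E] [NormedSpace ℝ E] (m : ℕ) :
    (E →L[ℝ] E →L[ℝ] ℝ) →ₗ[ℝ] (E [⋀^Fin m]→L[ℝ] ℝ) →L[ℝ] E [⋀^Fin (m + 1 + 1)]→L[ℝ] ℝ where
  toFun := wedgeRight
  map_add' b b' := by
    ext1 τ
    exact wedge_add_left b b' τ
  map_smul' c b := by
    ext1 τ
    exact wedge_smul_left c b τ

/-- The wedge product as a continuous bilinear map. -/
def wedgeL (E : Type*) [NormedAddCommGroup E] [NormedSpace ℝ E] (m : ℕ) :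
    (E →L[ℝ] E →L[ℝ] ℝ) →L[ℝ] (E [⋀^Fin m]→L[ℝ] ℝ) →L[ℝ] E [⋀^Fin (m + 1 + 1)]→L[ℝ] ℝ :=
  LinearMap.mkContinuous (E := E →L[ℝ] E →L[ℝ] ℝ)
    (F := (E [⋀^Fin m]→L[ℝ] ℝ) →L[ℝ] E [⋀^Fin (m + 1 + 1)]→L[ℝ] ℝ) (wedgeLM E m)
    (((m + 1 : ℕ) + 1) * (m + 1)) norm_wedgeRight_le

theorem wedgeL_apply (b : E →L[ℝ] E →L[ℝ] ℝ) (τ : E [⋀^Fin m]→L[ℝ] ℝ) :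
    wedgeL E m b τ = wedge b τ := rfl

end Wedge

/-! ### Forms of top degree, determinants and the standard frame -/

section TopDegree

variable {k m : ℕ}

theorem finrank_real_pi_complex (k : ℕ) : Module.finrank ℝ (Fin k → ℂ) = 2 * k := by
  rw [Module.finrank_pi_fintype]; simp [mul_comm]

/-- In top degree every alternating form is a multiple of the determinant in a basis. -/
theorem topForm_comp (hm : m = 2 * k) (τ : (Fin k → ℂ) [⋀^Fin m]→L[ℝ] ℝ)
    (A : (Fin k → ℂ) →L[ℝ] (Fin k → ℂ)) (v : Fin m → Fin k → ℂ) :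
    τ (A ∘ v) = A.det * τ v := by
  have hf : Module.finrank ℝ (Fin k → ℂ) = m := by rw [finrank_real_pi_complex, hm]
  let e := Module.finBasisOfFinrankEq ℝ (Fin k → ℂ) hf
  have h1 := AlternatingMap.eq_smul_basis_det e τ.toAlternatingMap
  have h2 : ∀ u : Fin m → Fin k → ℂ, τ u = τ.toAlternatingMap e * e.det u := fun u =>
    congrArg (fun f => f u) h1
  have h3 := e.det_comp (A : (Fin k → ℂ) →ₗ[ℝ] (Fin k → ℂ)) v
  rw [h2, h2 v]
  have h4 : e.det (A ∘ v) = A.det * e.det v := h3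
  rw [h4]
  ring

/-- The real determinant is the squared modulus of the complex one. Holomorphic changes of variables
thus need no absolute value of the Jacobian. -/
theorem det_nonneg_of_complexLinear {A : (Fin k → ℂ) →L[ℝ] (Fin k → ℂ)}
    (hA : ∀ (c : ℂ) v, A (c • v) = c • A v) : 0 ≤ A.det := by
  let B : (Fin k → ℂ) →ₗ[ℂ] (Fin k → ℂ) := { toFun := A, map_add' := A.map_add, map_smul' := hA }
  have h : (A : (Fin k → ℂ) →ₗ[ℝ] (Fin k → ℂ)) = (B.restrictScalars ℝ) := by ext; rfl
  have h2 : A.det = LinearMap.det (B.restrictScalars ℝ) := by rw [ContinuousLinearMap.det, h]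
  rw [h2, LinearMap.det_restrictScalars, Algebra.norm_complex_apply]
  exact Complex.normSq_nonneg _

theorem det_pos_of_complexLinear {A : (Fin k → ℂ) →L[ℝ] (Fin k → ℂ)}
    (hA : ∀ (c : ℂ) v, A (c • v) = c • A v) (hi : Function.Injective A) : 0 < A.det := by
  refine (det_nonneg_of_complexLinear hA).lt_of_ne' ?_
  have h := LinearMap.bot_lt_ker_of_det_eq_zero (f := (A : (Fin k → ℂ) →ₗ[ℝ] (Fin k → ℂ)))
  intro h0
  have h1 := h h0
  rw [LinearMap.ker_eq_bot.2 hi] at h1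
  exact lt_irrefl _ h1

theorem frame_zero (k m : ℕ) : frame (k + 1) (m + 1 + 1) 0 = Fin.cons 1 0 := by
  funext i
  refine Fin.cases ?_ (fun i => ?_) i <;> simp [frame]

theorem frame_one (k m : ℕ) : frame (k + 1) (m + 1 + 1) 1 = Fin.cons Complex.I 0 := by
  funext i
  refine Fin.cases ?_ (fun i => ?_) i <;> simp [frame]

theorem frame_succ_succ (k m : ℕ) (j : Fin m) :
    frame (k + 1) (m + 1 + 1) j.succ.succ = Fin.cons 0 (frame k m j) := by
  funext i
  refine Fin.cases ?_ (fun i => ?_) i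
  · have : ¬ (0 : ℕ) = (j + 1 + 1) / 2 := by omega
    simp [frame, this]
  · have h1 : ((j : ℕ) + 1 + 1) / 2 = j / 2 + 1 := by omega
    have h2 : ((j : ℕ) + 1 + 1) % 2 = j % 2 := by omega
    simp [frame, h1, h2]

theorem removeNth_zero_frame (k m : ℕ) :
    ((0 : Fin (m + 1)).removeNth <| (0 : Fin (m + 1 + 1)).removeNth (frame (k + 1) (m + 1 + 1))) =
      fun j => (Fin.cons 0 (frame k m j) : V k) := by
  funext j
  simp only [Fin.removeNth, Fin.zero_succAbove]
  exact frame_succ_succ k m j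

/-- The wedge of a multiple of `dx₀ ∧ dȳ₀` with a form, on the standard frame. -/
theorem wedge_frame {b : V k →L[ℝ] V k →L[ℝ] ℝ} {r : ℝ}
    (hb : ∀ z w : V k, b z w - b w z = r * ((z 0).re * (w 0).im - (z 0).im * (w 0).re))
    (τ : V k [⋀^Fin m]→L[ℝ] ℝ) :
    wedge b τ (frame (k + 1) (m + 1 + 1)) = r * τ fun j => (Fin.cons 0 (frame k m j) : V k) := by
  -- Only the pair `i = j = 0` survives: for `j ≠ 0` the vector in position `j.succ` has first
  -- coordinate zero, so the right side of `hb` vanishes, and `i ≠ 0` forces `j ≠ 0`.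
  rw [wedge_apply, Finset.sum_eq_single 0, Finset.sum_eq_single 0]
  · rw [hb]
    have h1 : frame (k + 1) (m + 1 + 1) (Fin.castSucc (0 : Fin (m + 1))) = Fin.cons 1 0 :=
      frame_zero k m
    have h2 : frame (k + 1) (m + 1 + 1) (Fin.succ (0 : Fin (m + 1))) = Fin.cons Complex.I 0 :=
      frame_one k m
    rw [h1, h2, Fin.castSucc_zero, removeNth_zero_frame]
    simp
  · intro j _ hj
    obtain ⟨j, rfl⟩ := Fin.exists_succ_eq.2 hj
    rw [hb, frame_succ_succ]
    simp
  · simp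
  · intro i _ hi
    refine Finset.sum_eq_zero fun j hj => ?_
    have hij : i ≤ j := by simpa using hj
    have hj0 : j ≠ 0 := by
      rintro rfl
      exact hi (Fin.le_zero_iff.1 hij)
    obtain ⟨j, rfl⟩ := Fin.exists_succ_eq.2 hj0
    rw [hb, frame_succ_succ]
    simp
  · simp

end TopDegree

/-! ### Positivity of wedge products on complex frames -/

section Positivity

/-- Linear coordinates in which a nonzero linear form is the first coordinate. -/
theorem exists_coordinate_change {q : ℕ} (l : V q →ₗ[ℂ] ℂ) (hl : l ≠ 0) :
    ∃ A : V q →ₗ[ℂ] V q, Function.Injective A ∧ ∀ z, l (A z) = z 0 := by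
  have hr := Module.Dual.finrank_ker_add_one_of_ne_zero hl
  have h : Module.finrank ℂ (Fin q → ℂ) = Module.finrank ℂ (LinearMap.ker l) := by
    simp only [Module.finrank_fin_fun] at hr ⊢
    omega
  let e := LinearEquiv.ofFinrankEq (Fin q → ℂ) (LinearMap.ker l) h
  obtain ⟨a0, ha0⟩ : ∃ a, l a ≠ 0 := by
    by_contra hc
    push Not at hc
    exact hl (LinearMap.ext hc)
  let A : V q →ₗ[ℂ] V q := (LinearMap.proj (R := ℂ) (φ := fun _ : Fin (q + 1) => ℂ) 0).smulRight
      ((l a0)⁻¹ • a0) + (LinearMap.ker l).subtype ∘ₗ e.toLinearMap ∘ₗ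
        LinearMap.funLeft ℂ ℂ (Fin.succ : Fin q → Fin (q + 1))
  have hA : ∀ z, l (A z) = z 0 := by
    intro z
    have : l (e (LinearMap.funLeft ℂ ℂ (Fin.succ : Fin q → Fin (q + 1)) z)) = 0 :=
      (e (LinearMap.funLeft ℂ ℂ (Fin.succ : Fin q → Fin (q + 1)) z)).2
    simp [A, this, ha0]
  refine ⟨A, ?_, hA⟩
  refine (injective_iff_map_eq_zero A).2 fun z hz => ?_
  have h0 : z 0 = 0 := by rw [← hA z, hz, map_zero]
  have h1 : e (LinearMap.funLeft ℂ ℂ (Fin.succ : Fin q → Fin (q + 1)) z) = 0 := by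
    apply Subtype.ext
    simpa [A, h0] using hz
  have h2 := (LinearEquiv.map_eq_zero_iff e).1 h1
  funext i
  refine Fin.cases h0 (fun i => congrFun h2 i) i

/-- The real frame `w₀, i w₀, w₁, i w₁, …`. -/
def complexFrame {N : ℕ} (m : ℕ) (w : ℕ → V N) (j : Fin m) : V N :=
  if (j : ℕ) % 2 = 0 then w ((j : ℕ) / 2) else Complex.I • w ((j : ℕ) / 2)

/-- Nonnegativity on all frames `w₀, i w₀, w₁, i w₁, …`. -/
def NonnegOnFrames {N m : ℕ} (τ : V N [⋀^Fin m]→L[ℝ] ℝ) : Prop :=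
  ∀ w : ℕ → V N, 0 ≤ τ (complexFrame m w)

/-- The real and imaginary parts of a complex linear form `ℓ`, tensored. -/
def reTensorIm {N : ℕ} (l : V N →L[ℂ] ℂ) : V N →L[ℝ] V N →L[ℝ] ℝ :=
  (Complex.reCLM.comp (l.restrictScalars ℝ)).smulRight
    (Complex.imCLM.comp (l.restrictScalars ℝ))

theorem reTensorIm_apply {N : ℕ} (l : V N →L[ℂ] ℂ) (v w : V N) :
    reTensorIm l v w = (l v).re * (l w).im := rfl

theorem map_frame_eq_complexFrame {N k m : ℕ} (hm : m ≤ 2 * k) (b : (Fin k → ℂ) →ₗ[ℂ] V N) :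
    (fun j => b (frame k m j)) =
      complexFrame m fun i => if h : i < k then b (Pi.single ⟨i, h⟩ 1) else 0 := by
  funext j
  have hj : (j : ℕ) / 2 < k := by have := j.2; omega
  have h1 : frame k m j = (if (j : ℕ) % 2 = 0 then (1 : ℂ) else Complex.I) •
      (Pi.single ⟨(j : ℕ) / 2, hj⟩ 1 : Fin k → ℂ) := by
    funext i
    by_cases h : i = ⟨(j : ℕ) / 2, hj⟩
    · subst h; simp [frame]
    · have : ¬ (i : ℕ) = (j : ℕ) / 2 := fun h' => h (Fin.ext h')
      simp [frame, this, h]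
  rw [h1, map_smul, complexFrame, dif_pos hj]
  split_ifs <;> simp

/-- The antisymmetrization of `Re ℓ ⊗ Im ℓ` is `(i/2) ℓ ∧ ℓ̄`. Pull back to the `ℂ^{q+1}`
parametrized by the frame vectors. If `ℓ` vanishes there, so does the product. Otherwise choose
coordinates with `ℓ = z₀`; then `wedge_frame` leaves the value of `τ` on a complex frame, and the
change of coordinates contributes a positive determinant. -/
theorem NonnegOnFrames.wedge_reTensorIm {N m q : ℕ} (hm : m = 2 * q)
    {τ : V N [⋀^Fin m]→L[ℝ] ℝ} (hτ : NonnegOnFrames τ) (l : V N →L[ℂ] ℂ) :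
    NonnegOnFrames (wedge (reTensorIm l) τ) := by
  intro w
  let b : V q →ₗ[ℂ] V N := Fintype.linearCombination ℂ fun i : Fin (q + 1) => w i
  let B : V q →L[ℝ] V N := (LinearMap.toContinuousLinearMap b).restrictScalars ℝ
  have hb : complexFrame (m + 1 + 1) w = B ∘ frame (q + 1) (m + 1 + 1) := by
    have h1 := map_frame_eq_complexFrame (m := m + 1 + 1) (by omega) b
    rw [show (B ∘ frame (q + 1) (m + 1 + 1)) = fun j => b (frame (q + 1) (m + 1 + 1) j) from rfl,
      h1]
    funext j
    have hj : (j : ℕ) / 2 < q + 1 := by have := j.2; omega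
    simp only [complexFrame, dif_pos hj]
    simp [b, Fintype.linearCombination_apply_single]
  rw [hb]
  by_cases hl : l.toLinearMap ∘ₗ b = 0
  · have h0 : ∀ z, l (B z) = 0 := fun z => congrArg (fun f => f z) hl
    rw [wedge_apply]
    refine (Finset.sum_eq_zero fun i _ => Finset.sum_eq_zero fun j _ => ?_).ge
    simp only [reTensorIm_apply, Function.comp_apply, h0]
    simp
  · obtain ⟨A, hA, hA0⟩ := exists_coordinate_change _ hl
    let A' : V q →L[ℝ] V q := (LinearMap.toContinuousLinearMap A).restrictScalars ℝ
    have hdet : 0 < A'.det := det_pos_of_complexLinear (fun c v => A.map_smul c v) hA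
    let σ := (wedge (reTensorIm l) τ).compContinuousLinearMap B
    have h1 := topForm_comp (k := q + 1) (by omega) σ A' (frame (q + 1) (m + 1 + 1))
    have h2 : σ (A' ∘ frame (q + 1) (m + 1 + 1)) =
        wedge (reTensorIm l) τ ((B.comp A') ∘ frame (q + 1) (m + 1 + 1)) := rfl
    rw [wedge_pullback, wedge_frame (r := 1)] at h2
    · have h3 : 0 ≤ σ (A' ∘ frame (q + 1) (m + 1 + 1)) := by
        rw [h2, one_mul]
        let c : (Fin q → ℂ) →ₗ[ℂ] V q :=
          { toFun := fun z => Fin.cons 0 z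
            map_add' := fun x y => by
              funext i; refine Fin.cases ?_ (fun i => ?_) i <;> simp
            map_smul' := fun x y => by
              funext i; refine Fin.cases ?_ (fun i => ?_) i <;> simp }
        have h4 := map_frame_eq_complexFrame (m := m) (by omega) (b ∘ₗ A ∘ₗ c)
        change 0 ≤ τ (fun j => (b ∘ₗ A ∘ₗ c) (frame q m j))
        rw [h4]
        exact hτ _
      rw [h1] at h3
      exact nonneg_of_mul_nonneg_right h3 hdet
    · intro z w
      have e : ∀ z, l (B (A' z)) = z 0 := hA0
      change (l (B (A' z))).re * (l (B (A' w))).im - (l (B (A' w))).re * (l (B (A' z))).im = _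
      rw [e, e]
      ring

end Positivity

open MeasureTheory

/-! ### Differentiation under the integral over the first coordinate -/

section ParametricIntegral

/-- Integration by parts against the constant function 1. -/
theorem integral_fderiv_eq_zero {E : Type*} [NormedAddCommGroup E] [NormedSpace ℝ E]
    [FiniteDimensional ℝ E] [MeasurableSpace E] [BorelSpace E] (μ : Measure E)
    [μ.IsAddHaarMeasure] {f : E → ℝ} (hf : ContDiff ℝ 1 f) (hc : HasCompactSupport f) (v : E) :
    ∫ x, fderiv ℝ f x v ∂μ = 0 := by
  have h1 : Integrable (fun x => fderiv ℝ f x v) μ :=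
    ((hf.continuous_fderiv one_ne_zero).clm_apply continuous_const).integrable_of_hasCompactSupport
      (hc.fderiv_apply ℝ v)
  have h2 : Integrable f μ := hf.continuous.integrable_of_hasCompactSupport hc
  have := integral_mul_fderiv_eq_neg_fderiv_mul_of_integrable (μ := μ) (f := fun _ => (1 : ℝ))
    (g := f) (v := v) (by simp) (by simpa using h1) (by simpa using h2)
    (fun x _ => differentiableAt_const _) (fun x _ => hf.differentiable one_ne_zero x)
  simpa using this

variable {N : ℕ}

/-- The inclusion of `ℂ^N` into `ℂ^{N+1}` as the hyperplane `x₀ = 0`. -/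
def incl (N : ℕ) : (Fin N → ℂ) →L[ℂ] V N :=
  LinearMap.toContinuousLinearMap
    { toFun := fun z => Fin.cons 0 z
      map_add' := fun x y => by
        funext i; refine Fin.cases ?_ (fun i => ?_) i <;> simp
      map_smul' := fun x y => by
        funext i; refine Fin.cases ?_ (fun i => ?_) i <;> simp }

theorem incl_apply (z : Fin N → ℂ) : incl N z = Fin.cons 0 z := rfl

theorem cons_eq_add (t : ℂ) (z : Fin N → ℂ) : (Fin.cons t z : V N) = Fin.cons t 0 + incl N z := by
  funext i; refine Fin.cases ?_ (fun i => ?_) i <;> simp [incl_apply]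

theorem hasFDerivAt_cons_right (t : ℂ) (z : Fin N → ℂ) :
    HasFDerivAt (fun z : Fin N → ℂ => (Fin.cons t z : V N)) ((incl N).restrictScalars ℝ) z := by
  have : (fun z : Fin N → ℂ => (Fin.cons t z : V N)) = fun z => Fin.cons t 0 +
      (incl N).restrictScalars ℝ z := by
    funext z; exact cons_eq_add t z
  rw [this]
  exact ((incl N).restrictScalars ℝ).hasFDerivAt.const_add _

/-- The inclusion of `ℂ` into `ℂ^{N+1}` as the first coordinate axis. -/
def inclZero (N : ℕ) : ℂ →L[ℂ] V N :=
  (ContinuousLinearMap.id ℂ ℂ).smulRight (Fin.cons 1 0 : V N)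

theorem inclZero_apply (t : ℂ) : inclZero N t = Fin.cons t 0 := by
  funext i; refine Fin.cases ?_ (fun i => ?_) i <;> simp [inclZero]

theorem hasFDerivAt_cons_left (t : ℂ) (z : Fin N → ℂ) :
    HasFDerivAt (fun t : ℂ => (Fin.cons t z : V N)) ((inclZero N).restrictScalars ℝ) t := by
  have : (fun t : ℂ => (Fin.cons t z : V N)) = fun t => (inclZero N).restrictScalars ℝ t +
      incl N z := by
    funext t; rw [cons_eq_add]; congr 1; exact (inclZero_apply t).symm
  rw [this]
  exact ((inclZero N).restrictScalars ℝ).hasFDerivAt.add_const _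

theorem continuous_cons : Continuous fun p : ℂ × (Fin N → ℂ) => (Fin.cons p.1 p.2 : V N) :=
  continuous_pi fun i => by
    refine Fin.cases ?_ (fun i => ?_) i
    · simpa using continuous_fst
    · simp only [Fin.cons_succ]
      fun_prop

theorem hasCompactSupport_cons {F : Type*} [Zero F] {g : V N → F} {R : ℝ}
    (hR : ∀ x : V N, R < ‖x 0‖ → g x = 0) (z : Fin N → ℂ) :
    HasCompactSupport fun t : ℂ => g (Fin.cons t z) :=
  HasCompactSupport.intro (isCompact_closedBall 0 R) fun t ht => hR _ (by simpa using ht)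

theorem fderiv_eq_zero_of_fst {F : Type*} [NormedAddCommGroup F] [NormedSpace ℝ F]
    {g : V N → F} {R : ℝ} (hR : ∀ x : V N, R < ‖x 0‖ → g x = 0) (x : V N) (hx : R < ‖x 0‖) :
    fderiv ℝ g x = 0 := by
  have : g =ᶠ[nhds x] fun _ => 0 := by
    have ho : IsOpen {y : V N | R < ‖y 0‖} := isOpen_lt continuous_const (by fun_prop)
    filter_upwards [ho.mem_nhds hx] with y hy
    exact hR y hy
  rw [this.fderiv_eq, fderiv_fun_const]; rfl

/-- Differentiation under the integral over the first coordinate. -/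
theorem hasFDerivAt_integral_cons {g : V N → ℝ} (hg : ContDiff ℝ 1 g) {R : ℝ}
    (hR : ∀ x : V N, R < ‖x 0‖ → g x = 0) (z : Fin N → ℂ) :
    HasFDerivAt (fun z : Fin N → ℂ => ∫ t : ℂ, g (Fin.cons t z))
      (∫ t : ℂ, (fderiv ℝ g (Fin.cons t z)).comp ((incl N).restrictScalars ℝ)) z := by
  have hc1 : Continuous fun p : ℂ × (Fin N → ℂ) =>
      (fderiv ℝ g (Fin.cons p.1 p.2)).comp ((incl N).restrictScalars ℝ) :=
    ((hg.continuous_fderiv one_ne_zero).comp continuous_cons).clm_comp continuous_const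
  obtain ⟨M, hM⟩ := ((isCompact_closedBall (0 : ℂ) R).prod
    (isCompact_closedBall z 1)).exists_bound_of_continuousOn hc1.continuousOn
  have hcont : ∀ y, Continuous fun t : ℂ => g (Fin.cons t y) := fun y =>
    hg.continuous.comp (continuous_cons.comp (by fun_prop : Continuous fun t : ℂ => (t, y)))
  refine hasFDerivAt_integral_of_dominated_of_fderiv_le (s := Metric.closedBall z 1)
    (bound := (Metric.closedBall (0 : ℂ) R).indicator fun _ => M)
    (F' := fun y t => (fderiv ℝ g (Fin.cons t y)).comp ((incl N).restrictScalars ℝ))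
    (Metric.closedBall_mem_nhds z one_pos)
    (Filter.Eventually.of_forall fun y => (hcont y).aestronglyMeasurable)
    ((hcont z).integrable_of_hasCompactSupport (hasCompactSupport_cons hR z))
    (hc1.comp (by fun_prop : Continuous fun t : ℂ => (t, z))).aestronglyMeasurable
    (Filter.Eventually.of_forall fun t y hy => ?_) ?_
    (Filter.Eventually.of_forall fun t y _ => ?_)
  · by_cases ht : t ∈ Metric.closedBall (0 : ℂ) R
    · rw [Set.indicator_of_mem ht]
      exact hM (t, y) ⟨ht, hy⟩
    · rw [Set.indicator_of_notMem ht, fderiv_eq_zero_of_fst hR _ (by simpa using ht)]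
      simp
  · exact (integrable_indicator_iff measurableSet_closedBall).2
      (integrableOn_const (measure_closedBall_lt_top).ne)
  · exact ((hg.differentiable one_ne_zero _).hasFDerivAt).comp y (hasFDerivAt_cons_right t y)

theorem fderiv_integral_cons {g : V N → ℝ} (hg : ContDiff ℝ 1 g) {R : ℝ}
    (hR : ∀ x : V N, R < ‖x 0‖ → g x = 0) (z w : Fin N → ℂ) :
    fderiv ℝ (fun z : Fin N → ℂ => ∫ t : ℂ, g (Fin.cons t z)) z w =
      ∫ t : ℂ, fderiv ℝ g (Fin.cons t z) (Fin.cons 0 w) := by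
  rw [(hasFDerivAt_integral_cons hg hR z).fderiv, ContinuousLinearMap.integral_apply]
  · rfl
  · have hc1 : Continuous fun t : ℂ =>
        (fderiv ℝ g (Fin.cons t z)).comp ((incl N).restrictScalars ℝ) :=
      ((hg.continuous_fderiv one_ne_zero).comp (continuous_cons.comp
        (by fun_prop : Continuous fun t : ℂ => (t, z)))).clm_comp continuous_const
    refine hc1.integrable_of_hasCompactSupport (HasCompactSupport.intro
      (isCompact_closedBall 0 R) fun t ht => ?_)
    rw [fderiv_eq_zero_of_fst hR _ (by simpa using ht)]
    simp

/-- For fixed `z` the integrand is the derivative of a compactly supported function of `t`. This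
removes the derivatives along the fibre when `d` is compared with fibre integration. -/
theorem integral_fderiv_cons_zero {g : V N → ℝ} (hg : ContDiff ℝ 1 g) {R : ℝ}
    (hR : ∀ x : V N, R < ‖x 0‖ → g x = 0) (z : Fin N → ℂ) (c : ℂ) :
    ∫ t : ℂ, fderiv ℝ g (Fin.cons t z) (Fin.cons c 0) = 0 := by
  have hd : ∀ t : ℂ, HasFDerivAt (fun t : ℂ => g (Fin.cons t z))
      ((fderiv ℝ g (Fin.cons t z)).comp ((inclZero N).restrictScalars ℝ)) t := fun t =>
    ((hg.differentiable one_ne_zero _).hasFDerivAt).comp t (hasFDerivAt_cons_left t z)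
  have hs : ContDiff ℝ 1 (fun t : ℂ => g (Fin.cons t z)) := by
    refine hg.comp (contDiff_pi.2 fun i => ?_)
    refine Fin.cases ?_ (fun i => ?_) i
    · simp only [Fin.cons_zero]
      fun_prop
    · simpa using contDiff_const
  rw [← integral_fderiv_eq_zero volume hs (hasCompactSupport_cons hR z) c]
  refine integral_congr_ae (Filter.Eventually.of_forall fun t => ?_)
  simp only [(hd t).fderiv]
  change _ = fderiv ℝ g (Fin.cons t z) (inclZero N c)
  rw [inclZero_apply]

end ParametricIntegral

/-! ### Fibre integration on a product commutes with `d`, `d^c` and `dd^c` -/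

section FibreIntegration

open ContinuousAlternatingMap

variable {N m : ℕ}

/-- The frame of the fibre of the first projection, followed by vectors of the base. -/
def fibreFrame (w : Fin m → Fin N → ℂ) : Fin (m + 1 + 1) → V N :=
  Fin.cons (Fin.cons 1 0) (Fin.cons (Fin.cons Complex.I 0) fun j => Fin.cons 0 (w j) :
    Fin (m + 1) → V N)

/-- `ω` is the integral of `η` over the fibres of `ℂ × ℂ^N → ℂ^N`. -/
def IsProductFibreIntegral (η : V N → V N [⋀^Fin (m + 1 + 1)]→L[ℝ] ℝ)
    (ω : (Fin N → ℂ) → (Fin N → ℂ) [⋀^Fin m]→L[ℝ] ℝ) : Prop :=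
  ∀ z w, ω z w = ∫ t : ℂ, η (Fin.cons t z) (fibreFrame w)

theorem fibreFrame_frame (N m : ℕ) : fibreFrame (frame N m) = frame (N + 1) (m + 1 + 1) := by
  funext j
  refine Fin.cases ?_ (fun j => Fin.cases ?_ (fun j => ?_) j) j
  · exact (frame_zero N m).symm
  · exact (frame_one N m).symm
  · exact (frame_succ_succ N m j).symm

theorem contDiff_apply_form {E : Type*} [NormedAddCommGroup E] [NormedSpace ℝ E]
    {n : WithTop ℕ∞} {η : E → E [⋀^Fin m]→L[ℝ] ℝ} (h : ContDiff ℝ n η) (v : Fin m → E) :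
    ContDiff ℝ n fun x => η x v :=
  (ContinuousAlternatingMap.apply ℝ E ℝ v).contDiff.comp h

/-- Integration over the fibres of a product commutes with the exterior derivative. -/
theorem IsProductFibreIntegral.extDeriv {η : V N → V N [⋀^Fin (m + 1 + 1)]→L[ℝ] ℝ}
    {ω : (Fin N → ℂ) → (Fin N → ℂ) [⋀^Fin m]→L[ℝ] ℝ} (h : IsProductFibreIntegral η ω)
    (hω : Differentiable ℝ ω) (hη : ContDiff ℝ 1 η) {R : ℝ}
    (hR : ∀ x : V N, R < ‖x 0‖ → η x = 0) :
    IsProductFibreIntegral (extDeriv η) (extDeriv ω) := by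
  intro z w
  have hR' : ∀ v : Fin (m + 1 + 1) → V N, ∀ x : V N, R < ‖x 0‖ → η x v = 0 := fun v x hx => by
    rw [hR x hx]; rfl
  have hint : ∀ (v : Fin (m + 1 + 1) → V N) (u : V N),
      Integrable fun t : ℂ => fderiv ℝ (fun x => η x v) (Fin.cons t z) u := by
    intro v u
    refine Continuous.integrable_of_hasCompactSupport ?_ (HasCompactSupport.intro
      (isCompact_closedBall 0 R) fun t ht => ?_)
    · exact (((contDiff_apply_form hη v).continuous_fderiv one_ne_zero).comp (continuous_cons.comp
        (by fun_prop : Continuous fun t : ℂ => (t, z)))).clm_apply continuous_const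
    · rw [fderiv_eq_zero_of_fst (hR' v) _ (by simpa using ht)]
      rfl
  have e1 : ∀ t : ℂ, _root_.extDeriv η (Fin.cons t z) (fibreFrame w) = _ := fun t =>
    extDeriv_apply (hη.differentiable one_ne_zero _) _
  simp only [e1, zsmul_eq_mul]
  rw [integral_finsetSum _ fun i _ => (hint _ _).const_mul _, Fin.sum_univ_succ,
    Fin.sum_univ_succ, extDeriv_apply (hω z)]
  simp only [integral_const_mul]
  -- The first two terms of the exterior derivative differentiate in the fibre directions `1` and
  -- `i` and integrate to zero. In the others the base vector `w i` sits in position `i + 2`, so its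
  -- sign agrees with that in the exterior derivative of `ω`.
  have z0 : ∫ t : ℂ, fderiv ℝ (fun x => η x ((0 : Fin (m + 1 + 1 + 1)).removeNth (fibreFrame w)))
      (Fin.cons t z) (fibreFrame w 0) = 0 :=
    integral_fderiv_cons_zero (contDiff_apply_form hη _) (hR' _) z 1
  have z1 : ∫ t : ℂ, fderiv ℝ (fun x => η x
      ((Fin.succ 0 : Fin (m + 1 + 1 + 1)).removeNth (fibreFrame w)))
      (Fin.cons t z) (fibreFrame w (Fin.succ 0)) = 0 :=
    integral_fderiv_cons_zero (contDiff_apply_form hη _) (hR' _) z Complex.I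
  rw [z0, z1, mul_zero, mul_zero, zero_add, zero_add]
  refine Finset.sum_congr rfl fun i _ => ?_
  have e2 : (fun y => ω y (i.removeNth w)) =
      fun y => ∫ t : ℂ, η (Fin.cons t y) (fibreFrame (i.removeNth w)) := by
    funext y; exact h y _
  have e3 : i.succ.succ.removeNth (fibreFrame w) = fibreFrame (i.removeNth w) := by
    funext j
    refine Fin.cases ?_ (fun j => Fin.cases ?_ (fun j => ?_) j) j
    · rfl
    · simp only [Fin.removeNth, Fin.succ_succAbove_succ, fibreFrame, Fin.succ_succAbove_zero,
        Fin.cons_succ, Fin.cons_zero]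
    · simp only [Fin.removeNth, Fin.succ_succAbove_succ, fibreFrame, Fin.cons_succ]
  rw [e2, zsmul_eq_mul, e3,
    fderiv_integral_cons (g := fun x => η x (fibreFrame (i.removeNth w)))
      (contDiff_apply_form hη _) (hR' _)]
  congr 1
  push_cast [Fin.val_succ]
  ring

/-- In its first two arguments the form is alternating and bilinear, so it scales by the determinant
`a² + b²` of the substitution. With `y = i x` and `c = a + i b` the substitution is multiplication
by `c` of the frame `x, i x` of a complex line. -/
theorem form_rotate {E : Type*} [NormedAddCommGroup E] [NormedSpace ℝ E]
    (τ : E [⋀^Fin (m + 1 + 1)]→L[ℝ] ℝ) (a b : ℝ) (x y : E) (u : Fin m → E) :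
    τ (Fin.cons (a • x + b • y) (Fin.cons (a • y - b • x) u : Fin (m + 1) → E)) =
      (a ^ 2 + b ^ 2) * τ (Fin.cons x (Fin.cons y u : Fin (m + 1) → E)) := by
  have hxx : ∀ x : E, τ (Fin.cons x (Fin.cons x u : Fin (m + 1) → E)) = 0 := fun x =>
    τ.map_eq_zero_of_eq _ (i := 0) (j := 1) (by rfl) (by simp)
  let B : E → E → ℝ := fun p q => τ.curryLeft p (Fin.cons q u)
  have hB : ∀ p q, τ (Fin.cons p (Fin.cons q u : Fin (m + 1) → E)) = B p q := fun p q => rfl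
  have h1 : ∀ p p' q, B (p + p') q = B p q + B p' q := fun p p' q => by
    simp only [B, map_add]; rfl
  have h2 : ∀ (c : ℝ) p q, B (c • p) q = c * B p q := fun c p q => by
    simp only [B, map_smul]; rfl
  have h3 : ∀ p q q', B p (q + q') = B p q + B p q' := fun p q q' =>
    ((τ.curryLeft p).curryLeft.map_add q q' ▸ rfl :
      (τ.curryLeft p).curryLeft (q + q') u = _)
  have h4 : ∀ (c : ℝ) p q, B p (c • q) = c * B p q := fun c p q =>
    ((τ.curryLeft p).curryLeft.map_smul c q ▸ rfl : (τ.curryLeft p).curryLeft (c • q) u = _)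
  have h5 : ∀ p, B p p = 0 := hxx
  have h6 : B y x = -B x y := by
    have := h5 (x + y)
    rw [h1, h3, h3, h5, h5] at this
    linarith
  rw [hB, hB, sub_eq_add_neg, ← neg_smul, h1, h2, h2, h3, h3, h4, h4, h4, h4, h5, h5, h6]
  ring

/-- On the two fibre vectors the rotation has determinant `|c|² = 1`, so only its effect on the base
vectors remains. The cases `c = ± i` make fibre integration compatible with `d^c`. -/
theorem fibreFrame_rotate {c : ℂ} (hc : ‖c‖ = 1) (τ : V N [⋀^Fin (m + 1 + 1)]→L[ℝ] ℝ)
    (w : Fin m → Fin N → ℂ) :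
    τ (fun j => c • fibreFrame w j) = τ (fibreFrame fun j => c • w j) := by
  have hn : c.re ^ 2 + c.im ^ 2 = 1 := by
    have := Complex.sq_norm c
    rw [hc, Complex.normSq_apply] at this
    nlinarith
  have h := form_rotate τ c.re c.im (Fin.cons 1 0 : V N) (Fin.cons Complex.I 0)
    (fun j => Fin.cons 0 (c • w j))
  rw [hn, one_mul] at h
  refine Eq.trans ?_ h
  congr 1
  funext j
  refine Fin.cases ?_ (fun j => Fin.cases ?_ (fun j => ?_) j) j
  · funext i
    refine Fin.cases ?_ (fun i => ?_) i
    · simp [fibreFrame]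
    · simp [fibreFrame]
  · funext i
    refine Fin.cases ?_ (fun i => ?_) i
    · simp only [fibreFrame, Fin.cons_succ, Fin.cons_zero, Pi.smul_apply, Pi.sub_apply,
        smul_eq_mul, Complex.real_smul, mul_one]
      nth_rewrite 1 [← Complex.re_add_im c]
      linear_combination (c.im : ℂ) * Complex.I_mul_I
    · simp [fibreFrame]
  · funext i
    refine Fin.cases ?_ (fun i => ?_) i
    · simp [fibreFrame]
    · simp [fibreFrame]

theorem IsProductFibreIntegral.comp_mulBy {n : ℕ}
    {η : V (n + 1) → V (n + 1) [⋀^Fin (m + 1 + 1)]→L[ℝ] ℝ}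
    {ω : V n → V n [⋀^Fin m]→L[ℝ] ℝ} (h : IsProductFibreIntegral η ω) {c : ℂ} (hc : ‖c‖ = 1) :
    IsProductFibreIntegral (fun x => (η x).compContinuousLinearMap (mulBy (n + 1) c))
      (fun z => (ω z).compContinuousLinearMap (mulBy n c)) := by
  intro z w
  have e : ∀ t : ℂ, (η (Fin.cons t z)).compContinuousLinearMap (mulBy (n + 1) c) (fibreFrame w) =
      η (Fin.cons t z) (fibreFrame fun j => c • w j) := by
    intro t
    rw [← fibreFrame_rotate hc]
    rfl
  simp only [e]
  exact h z _

theorem contDiff_comp_mulBy {n : WithTop ℕ∞} {η : V N → V N [⋀^Fin m]→L[ℝ] ℝ}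
    (h : ContDiff ℝ n η) (c : ℂ) :
    ContDiff ℝ n fun x => (η x).compContinuousLinearMap (mulBy N c) :=
  (compContinuousLinearMapCLM (𝕜 := ℝ) (F := ℝ) (ι := Fin m) (mulBy N c)).contDiff.comp h

theorem contDiff_extDeriv {E : Type*} [NormedAddCommGroup E] [NormedSpace ℝ E]
    {n n' : WithTop ℕ∞} {η : E → E [⋀^Fin m]→L[ℝ] ℝ} (h : ContDiff ℝ n η) (hn : n' + 1 ≤ n) :
    ContDiff ℝ n' (_root_.extDeriv η) :=
  contDiff_iff_contDiffAt.2 fun _ => contDiffAt_alternatize (h.fderiv_right hn).contDiffAt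

theorem contDiff_dc {n n' : WithTop ℕ∞} {η : V N → V N [⋀^Fin m]→L[ℝ] ℝ} (h : ContDiff ℝ n η)
    (hn : n' + 1 ≤ n) : ContDiff ℝ n' (dc η) :=
  (contDiff_comp_mulBy (contDiff_extDeriv (contDiff_comp_mulBy h _) hn) _).const_smul
    (1 / (4 * Real.pi))

theorem extDeriv_eq_zero_of_fst {η : V N → V N [⋀^Fin m]→L[ℝ] ℝ} {R : ℝ}
    (hR : ∀ x : V N, R < ‖x 0‖ → η x = 0) (x : V N) (hx : R < ‖x 0‖) :
    _root_.extDeriv η x = 0 := by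
  rw [_root_.extDeriv, fderiv_eq_zero_of_fst hR x hx]
  exact map_zero (alternatizeUncurryFinCLM ℝ (V N) ℝ)

theorem dc_eq_zero_of_fst {η : V N → V N [⋀^Fin m]→L[ℝ] ℝ} {R : ℝ}
    (hR : ∀ x : V N, R < ‖x 0‖ → η x = 0) (x : V N) (hx : R < ‖x 0‖) : dc η x = 0 := by
  rw [dc, extDeriv_eq_zero_of_fst (R := R) _ x hx]
  · ext v
    exact mul_zero _
  · intro y hy
    rw [hR y hy]
    rfl

theorem IsProductFibreIntegral.dc {n : ℕ}
    {η : V (n + 1) → V (n + 1) [⋀^Fin (m + 1 + 1)]→L[ℝ] ℝ}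
    {ω : V n → V n [⋀^Fin m]→L[ℝ] ℝ} (h : IsProductFibreIntegral η ω)
    (hω : Differentiable ℝ ω) (hη : ContDiff ℝ 1 η) {R : ℝ}
    (hR : ∀ x : V (n + 1), R < ‖x 0‖ → η x = 0) :
    IsProductFibreIntegral (dc η) (dc ω) := by
  have h1 := (h.comp_mulBy (c := Complex.I) (by simp)).extDeriv (R := R)
    ((compContinuousLinearMapCLM (𝕜 := ℝ) (F := ℝ) (ι := Fin m)
      (mulBy n Complex.I)).differentiable.comp hω) (contDiff_comp_mulBy hη _)
    (fun x hx => by rw [hR x hx]; rfl)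
  have h2 := h1.comp_mulBy (m := m + 1) (c := -Complex.I) (by simp)
  intro z w
  have h3 := h2 z w
  change (1 / (4 * Real.pi)) * _ = ∫ t : ℂ, (1 / (4 * Real.pi)) * _
  rw [integral_const_mul]
  exact congrArg _ h3

/-- Integration over the fibres of a product commutes with `dd^c`. -/
theorem IsProductFibreIntegral.ddc {n : ℕ}
    {η : V (n + 1) → V (n + 1) [⋀^Fin (m + 1 + 1)]→L[ℝ] ℝ}
    {ω : V n → V n [⋀^Fin m]→L[ℝ] ℝ} (h : IsProductFibreIntegral η ω)
    (hω : ContDiff ℝ 2 ω) (hη : ContDiff ℝ 2 η) {R : ℝ}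
    (hR : ∀ x : V (n + 1), R < ‖x 0‖ → η x = 0) :
    IsProductFibreIntegral (ddc η) (ddc ω) :=
  (h.dc (hω.differentiable two_ne_zero) (hη.of_le (by norm_cast)) hR).extDeriv (R := R)
    ((contDiff_dc (n' := 1) hω le_rfl).differentiable one_ne_zero)
    (contDiff_dc (n' := 1) hη le_rfl) (dc_eq_zero_of_fst hR)

end FibreIntegration

/-! ### Smoothness of form-valued functions -/

section SmoothForms

variable {E X : Type*} [NormedAddCommGroup E] [NormedSpace ℝ E]
  [NormedAddCommGroup X] [NormedSpace ℝ X] {m : ℕ} {n : WithTop ℕ∞}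

theorem contDiff_form_apply {f : X → E [⋀^Fin m]→L[ℝ] ℝ} (hf : ContDiff ℝ n f)
    {v : Fin m → X → E} (hv : ∀ j, ContDiff ℝ n (v j)) :
    ContDiff ℝ n fun x => f x fun j => v j x := by
  have h := (ContinuousLinearMap.analyticOnNhd_uncurry_of_multilinear
    (ContinuousAlternatingMap.toContinuousMultilinearMapCLM ℝ :
      E [⋀^Fin m]→L[ℝ] ℝ →L[ℝ] ContinuousMultilinearMap ℝ (fun _ : Fin m => E) ℝ)
    (s := Set.univ)).contDiff (n := n)
  exact h.comp (hf.prodMk (contDiff_pi.2 hv))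

/-- A form-valued function is smooth if its values on all constant vectors are. -/
theorem contDiff_form_of_apply [FiniteDimensional ℝ E] {f : X → E [⋀^Fin m]→L[ℝ] ℝ}
    (hf : ∀ v, ContDiff ℝ n fun x => f x v) : ContDiff ℝ n f := by
  let b := Module.finBasis ℝ E
  let ev : (E [⋀^Fin m]→L[ℝ] ℝ) →ₗ[ℝ] ((Fin m → Fin (Module.finrank ℝ E)) → ℝ) :=
    { toFun := fun τ s => τ fun j => b (s j)
      map_add' := fun _ _ => rfl
      map_smul' := fun _ _ => rfl }
  have hinj : Function.Injective ev := by
    intro τ τ' h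
    have h1 : τ.toAlternatingMap.toMultilinearMap = τ'.toAlternatingMap.toMultilinearMap :=
      Module.Basis.ext_multilinear (fun _ => b) fun s => congrFun h s
    ext v
    exact congrArg (fun g => g v) h1
  -- Evaluation on tuples of basis vectors is an injective linear map, so a linear left inverse
  -- recovers the form from finitely many smooth functions.
  obtain ⟨g, hg⟩ := LinearMap.exists_leftInverse_of_injective ev (LinearMap.ker_eq_bot.2 hinj)
  have h2 : f = fun x => LinearMap.toContinuousLinearMap g (ev (f x)) := by
    funext x
    exact (congrArg (fun l => l (f x)) hg).symm
  rw [h2]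
  exact (LinearMap.toContinuousLinearMap g).contDiff.comp (contDiff_pi.2 fun s => hf _)

end SmoothForms

/-! ### Trivializing the cone over the affine chart -/

section Blowup

variable {N m : ℕ}

/-- The map `(t, z) ↦ (t, t z)`. -/
def blowup (N : ℕ) (x : V N) : V N := Fin.cons (x 0) fun i => x 0 * x i.succ

theorem blowup_cons (t : ℂ) (z : Fin N → ℂ) :
    blowup N (Fin.cons t z) = t • (Fin.cons 1 z : V N) := by
  funext i; refine Fin.cases ?_ (fun i => ?_) i <;> simp [blowup]

theorem contDiff_blowup {n : WithTop ℕ∞} : ContDiff ℝ n (blowup N) := by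
  refine contDiff_pi.2 fun i => ?_
  refine Fin.cases ?_ (fun i => ?_) i
  · simp only [blowup, Fin.cons_zero]; fun_prop
  · simp only [blowup, Fin.cons_succ]; fun_prop

theorem fderiv_blowup (x v : V N) :
    fderiv ℝ (blowup N) x v = Fin.cons (v 0) fun i => v 0 * x i.succ + x 0 * v i.succ := by
  have hd : DifferentiableAt ℝ (blowup N) x :=
    (contDiff_blowup (n := 1)).differentiable one_ne_zero x
  have hp : ∀ j : Fin (N + 1), HasFDerivAt (fun y : V N => y j)
      (ContinuousLinearMap.proj (R := ℝ) j : V N →L[ℝ] ℂ) x := fun j =>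
    (ContinuousLinearMap.proj (R := ℝ) (φ := fun _ : Fin (N + 1) => ℂ) j).hasFDerivAt
  funext i
  have hi := (hasFDerivAt_pi'.1 hd.hasFDerivAt i).fderiv
  have hi' : fderiv ℝ (blowup N) x v i = fderiv ℝ (fun y => blowup N y i) x v := by rw [hi]; rfl
  rw [hi']
  clear hi hi'
  revert i
  refine Fin.cases ?_ (fun i => ?_)
  · simp only [blowup, Fin.cons_zero]
    rw [(hp 0).fderiv]; rfl
  · simp only [blowup, Fin.cons_succ]
    have := ((hp 0).mul (hp i.succ)).fderiv
    refine (congrArg (fun l => l v) this).trans ?_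
    simp [ContinuousLinearMap.proj_apply]
    ring

theorem fderiv_blowup_smul (x : V N) (c : ℂ) (v : V N) :
    fderiv ℝ (blowup N) x (c • v) = c • fderiv ℝ (blowup N) x v := by
  rw [fderiv_blowup, fderiv_blowup]
  funext i; refine Fin.cases ?_ (fun i => ?_) i
  · simp
  · simp; ring

/-- The pullback of a form by `(t, z) ↦ (t, t z)`. -/
def blowupPullback (τ : V N → V N [⋀^Fin m]→L[ℝ] ℝ) (x : V N) : V N [⋀^Fin m]→L[ℝ] ℝ :=
  (τ (blowup N x)).compContinuousLinearMap (fderiv ℝ (blowup N) x)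

/-- The restriction of a form to the affine chart `z ↦ (1, z)`. -/
def chartPullback (ω : V N → V N [⋀^Fin m]→L[ℝ] ℝ) (z : Fin N → ℂ) :
    (Fin N → ℂ) [⋀^Fin m]→L[ℝ] ℝ :=
  (ω (Fin.cons 1 z)).compContinuousLinearMap ((incl N).restrictScalars ℝ)

theorem chartPullback_eq (ω : V N → V N [⋀^Fin m]→L[ℝ] ℝ) :
    chartPullback ω = fun z => (ω (Fin.cons 1 z)).compContinuousLinearMap
      (fderiv ℝ (fun z : Fin N → ℂ => (Fin.cons 1 z : V N)) z) := by
  funext z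
  rw [(hasFDerivAt_cons_right 1 z).fderiv]
  rfl

theorem chartPullback_frame (ω : V N → V N [⋀^Fin m]→L[ℝ] ℝ) (z : Fin N → ℂ) :
    chartPullback ω z (frame N m) = chartCoeff LinearMap.id ω z := rfl

theorem contDiff_cons_right {n : WithTop ℕ∞} (t : ℂ) :
    ContDiff ℝ n fun z : Fin N → ℂ => (Fin.cons t z : V N) := by
  refine contDiff_pi.2 fun i => ?_
  refine Fin.cases ?_ (fun i => ?_) i
  · simp only [Fin.cons_zero]; fun_prop
  · simp only [Fin.cons_succ]; fun_prop

theorem contDiffAt_of_mem_projForm {ω : ProjForm N m} {n : ℕ} {x : V N} (hx : x ≠ 0) :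
    ContDiffAt ℝ n ω.1 x :=
  ((ω.2.2.1).contDiffAt (isOpen_compl_singleton.mem_nhds hx)).of_le (by exact_mod_cast le_top)

theorem contDiff_chartPullback (ω : ProjForm N m) {n : ℕ} :
    ContDiff ℝ n (chartPullback ω.1) := by
  refine contDiff_iff_contDiffAt.2 fun z => ?_
  have h := (contDiffAt_of_mem_projForm (ω := ω) (n := n) (cons_one_ne_zero z)).comp z
    (contDiff_cons_right 1).contDiffAt
  exact (ContinuousAlternatingMap.compContinuousLinearMapCLM (𝕜 := ℝ) (F := ℝ) (ι := Fin m)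
    ((incl N).restrictScalars ℝ)).contDiff.contDiffAt.comp z h

theorem extDeriv_chartPullback (ω : ProjForm N m) :
    extDeriv (chartPullback ω.1) = chartPullback (extDeriv ω.1) := by
  funext z
  rw [chartPullback_eq, chartPullback_eq]
  exact extDeriv_pullback_of_contDiff (contDiff_cons_right 1)
    ((contDiffAt_of_mem_projForm (n := 1) (cons_one_ne_zero z)).differentiableAt (by simp))

theorem ddc_chartPullback {n : ℕ} (ω : ProjForm (n + 1) m) :
    ddc (chartPullback ω.1) = chartPullback (ddc ω.1) := by
  funext z
  rw [chartPullback_eq, chartPullback_eq]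
  refine ddc_pullback (f := fun z : V n => (Fin.cons 1 z : V (n + 1))) (contDiff_cons_right 1)
    (fun x c v => ?_) (contDiffAt_of_mem_projForm (n := 2) (cons_one_ne_zero z))
  rw [(hasFDerivAt_cons_right (N := n + 1) 1 x).fderiv]
  exact (incl (n + 1)).map_smul c v

/-- With `x = (1, z)`, the derivative of `blowup` at `(t, z)` maps the fibre frame to `x, i x` and
the base vectors `w` to `t (0, w)`. These are the arguments that `IsFibreIntegral` prescribes at `t
x`. -/
theorem isProductFibreIntegral_blowup {η : V N → V N [⋀^Fin (m + 1 + 1)]→L[ℝ] ℝ}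
    {ω : ProjForm N m} (h : IsFibreIntegral η ω) :
    IsProductFibreIntegral (blowupPullback η) (chartPullback ω.1) := by
  intro z w
  have h1 := h (Fin.cons 1 z) (fun j => incl N (w j)) (cons_one_ne_zero z)
  refine h1.trans (integral_congr_ae (Filter.Eventually.of_forall fun t => ?_))
  change η _ _ = η (blowup N (Fin.cons t z)) (fun j => fderiv ℝ (blowup N) (Fin.cons t z)
    (fibreFrame w j))
  rw [blowup_cons]
  congr 1
  funext j
  rw [fderiv_blowup]
  refine Fin.cases ?_ (fun j => Fin.cases ?_ (fun j => ?_) j) j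
  · funext i; refine Fin.cases ?_ (fun i => ?_) i <;> simp [fibreFrame]
  · funext i; refine Fin.cases ?_ (fun i => ?_) i <;> simp [fibreFrame]
  · funext i; refine Fin.cases ?_ (fun i => ?_) i <;> simp [fibreFrame, incl_apply]

theorem IsTestForm.exists_bound {η : V N → V N [⋀^Fin m]→L[ℝ] ℝ} (h : IsTestForm η) :
    ∃ R, ∀ x, R < ‖x‖ → η x = 0 := by
  obtain ⟨R, hR⟩ := h.2.1.isCompact.isBounded.exists_norm_le
  refine ⟨R, fun x hx => ?_⟩
  by_contra h0
  exact absurd (hR x (subset_tsupport _ h0)) (not_le.2 hx)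

/-- The pullback need not have compact support, because `z` may tend to infinity while `t z` stays
bounded. A bound on `t` alone is enough, since integration is over `t` for fixed `z`. -/
theorem blowupPullback_eq_zero {η : V N → V N [⋀^Fin m]→L[ℝ] ℝ} {R : ℝ}
    (hR : ∀ x, R < ‖x‖ → η x = 0) (x : V N) (hx : R < ‖x 0‖) : blowupPullback η x = 0 := by
  have h1 : R < ‖blowup N x‖ := hx.trans_le (norm_le_pi_norm (blowup N x) 0)
  rw [blowupPullback, hR _ h1]
  rfl

theorem contDiff_blowupPullback {η : V N → V N [⋀^Fin m]→L[ℝ] ℝ} {n : ℕ}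
    (h : ContDiff ℝ n η) : ContDiff ℝ n (blowupPullback η) := by
  refine contDiff_form_of_apply fun v => ?_
  refine contDiff_form_apply (h.comp contDiff_blowup) fun j => ?_
  exact (contDiff_blowup.fderiv_right (m := n) (n := n + 1) le_rfl).clm_apply contDiff_const

theorem isProductFibreIntegral_extDeriv {η : V N → V N [⋀^Fin (m + 1 + 1)]→L[ℝ] ℝ}
    {ω : ProjForm N m} (hη : IsTestForm η) (h : IsFibreIntegral η ω) :
    IsProductFibreIntegral (blowupPullback (extDeriv η)) (chartPullback (extDeriv ω.1)) := by
  obtain ⟨R, hR⟩ := hη.exists_bound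
  have h1 := (isProductFibreIntegral_blowup h).extDeriv
    ((contDiff_chartPullback (n := 1) ω).differentiable (by simp))
    (contDiff_blowupPullback (n := 1) (hη.1.of_le (by exact_mod_cast le_top)))
    (blowupPullback_eq_zero hR)
  rw [extDeriv_chartPullback] at h1
  convert h1 using 1
  funext x
  exact (extDeriv_pullback_of_contDiff contDiff_blowup (hη.1.differentiable (by simp) _)).symm

/-- Both `blowup` and the affine chart are holomorphic, so `dd^c` commutes with the two pullbacks
and the product case applies. -/
theorem isProductFibreIntegral_ddc {n : ℕ}
    {η : V (n + 1) → V (n + 1) [⋀^Fin (m + 1 + 1)]→L[ℝ] ℝ}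
    {ω : ProjForm (n + 1) m} (hη : IsTestForm η) (h : IsFibreIntegral η ω) :
    IsProductFibreIntegral (blowupPullback (ddc η)) (chartPullback (ddc ω.1)) := by
  obtain ⟨R, hR⟩ := hη.exists_bound
  have hη2 : ContDiff ℝ (2 : ℕ) η := contDiff_infty.1 hη.1 2
  have h1 := (isProductFibreIntegral_blowup h).ddc (contDiff_chartPullback (n := 2) ω)
    (contDiff_blowupPullback (n := 2) hη2) (blowupPullback_eq_zero hR)
  rw [ddc_chartPullback] at h1
  convert h1 using 1
  funext x
  exact (ddc_pullback contDiff_blowup fderiv_blowup_smul hη2.contDiffAt).symm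

end Blowup

/-! ### From integrals over the cone to integrals over the affine chart -/

section ChangeOfVariables

variable {N m : ℕ}

theorem volume_linearForm_eq_zero (l : V N →ₗ[ℂ] ℂ) (hl : l ≠ 0) :
    volume {x : V N | l x = 0} = 0 := by
  have h := Measure.addHaar_submodule (volume : Measure (V N)) (LinearMap.ker (l.restrictScalars ℝ))
    (fun h => hl (LinearMap.ext fun x => by
      have : x ∈ LinearMap.ker (l.restrictScalars ℝ) := h ▸ Submodule.mem_top
      simpa using this))
  exact h

theorem volume_coord_eq_zero (N : ℕ) : volume {x : V N | x 0 = 0} = 0 :=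
  volume_linearForm_eq_zero (LinearMap.proj 0) fun h => by
    simpa using congrArg (fun l => l (Pi.single 0 1)) h

theorem blowup_injOn : Set.InjOn (blowup N) {x | x 0 ≠ 0} := by
  intro x hx y _ h
  have h0 : x 0 = y 0 := congrFun h 0
  funext i
  refine Fin.cases h0 (fun i => ?_) i
  have h1 : x 0 * x i.succ = y 0 * y i.succ := congrFun h i.succ
  rw [← h0] at h1
  exact mul_left_cancel₀ hx h1

theorem blowup_image : blowup N '' {x | x 0 ≠ 0} = {x | x 0 ≠ 0} := by
  ext y
  constructor
  · rintro ⟨x, hx, rfl⟩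
    exact hx
  · intro hy
    refine ⟨Fin.cons (y 0) fun i => (y 0)⁻¹ * y i.succ, hy, ?_⟩
    funext i
    refine Fin.cases rfl (fun i => ?_) i
    have : y 0 ≠ 0 := hy
    simp [blowup, this]

theorem measurableSet_coord_ne_zero : MeasurableSet {x : V N | x 0 ≠ 0} :=
  (isOpen_ne_fun (continuous_apply 0) continuous_const).measurableSet

theorem restrict_coord_ne_zero (N : ℕ) :
    (volume : Measure (V N)).restrict {x | x 0 ≠ 0} = volume := by
  rw [Measure.restrict_eq_self_of_ae_mem]
  exact measure_eq_zero_iff_ae_notMem.1 (volume_coord_eq_zero N)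

/-- As `blowup` is holomorphic, its Jacobian determinant is nonnegative, and it is exactly the
factor by which the coefficient of a top form changes under pullback. -/
theorem abs_det_smul_topForm (hm : m = 2 * (N + 1)) (u : V N → ℝ)
    (τ : V N → V N [⋀^Fin m]→L[ℝ] ℝ) (x : V N) :
    |(fderiv ℝ (blowup N) x).det| • (u (blowup N x) * τ (blowup N x) (frame (N + 1) m)) =
      u (blowup N x) * blowupPullback τ x (frame (N + 1) m) := by
  rw [abs_of_nonneg (det_nonneg_of_complexLinear (fderiv_blowup_smul x)), smul_eq_mul]
  have := topForm_comp hm (τ (blowup N x)) (fderiv ℝ (blowup N) x) (frame (N + 1) m)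
  change _ = u (blowup N x) * τ (blowup N x) (fderiv ℝ (blowup N) x ∘ frame (N + 1) m)
  rw [this]
  ring

theorem integrable_blowup (hm : m = 2 * (N + 1)) {u : V N → ℝ}
    {τ : V N → V N [⋀^Fin m]→L[ℝ] ℝ}
    (h : Integrable fun x => u x * τ x (frame (N + 1) m)) :
    Integrable fun x => u (blowup N x) * blowupPullback τ x (frame (N + 1) m) := by
  have h1 := (integrableOn_image_iff_integrableOn_abs_det_fderiv_smul volume
    measurableSet_coord_ne_zero (fun x _ => ((contDiff_blowup (n := 1)).differentiable one_ne_zero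
      x).hasFDerivAt.hasFDerivWithinAt) blowup_injOn
      (fun x : V N => u x * τ x (frame (N + 1) m))).1 h.integrableOn
  rw [IntegrableOn, restrict_coord_ne_zero] at h1
  simpa only [abs_det_smul_topForm hm] using h1

theorem integral_blowup (hm : m = 2 * (N + 1)) (u : V N → ℝ)
    (τ : V N → V N [⋀^Fin m]→L[ℝ] ℝ) :
    ∫ x, u x * τ x (frame (N + 1) m) =
      ∫ x, u (blowup N x) * blowupPullback τ x (frame (N + 1) m) := by
  have h1 := integral_image_eq_integral_abs_det_fderiv_smul volume
    measurableSet_coord_ne_zero (fun x _ => ((contDiff_blowup (n := 1)).differentiable one_ne_zero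
      x).hasFDerivAt.hasFDerivWithinAt) blowup_injOn
      (fun x : V N => u x * τ x (frame (N + 1) m))
  rw [blowup_image, restrict_coord_ne_zero] at h1
  simpa only [abs_det_smul_topForm hm] using h1

theorem measurePreserving_cons (N : ℕ) :
    MeasurePreserving (fun p : ℂ × (Fin N → ℂ) => (Fin.cons p.1 p.2 : V N)) := by
  have h := (volume_preserving_piFinSuccAbove (fun _ : Fin (N + 1) => ℂ) 0).symm
  convert h using 1
  funext p
  exact (Fin.insertNth_zero' p.1 p.2).symm

theorem measurableEmbedding_cons (N : ℕ) :
    MeasurableEmbedding (fun p : ℂ × (Fin N → ℂ) => (Fin.cons p.1 p.2 : V N)) := by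
  have h := (MeasurableEquiv.piFinSuccAbove (fun _ : Fin (N + 1) => ℂ) 0).symm.measurableEmbedding
  convert h using 1
  funext p
  exact (Fin.insertNth_zero' p.1 p.2).symm

theorem integrable_cons_iff {g : V N → ℝ} :
    Integrable (fun p : ℂ × (Fin N → ℂ) => g (Fin.cons p.1 p.2)) ↔ Integrable g :=
  (measurePreserving_cons N).integrable_comp_emb (measurableEmbedding_cons N)

theorem integral_cons_prod (g : V N → ℝ) :
    ∫ p : ℂ × (Fin N → ℂ), g (Fin.cons p.1 p.2) = ∫ x, g x :=
  (measurePreserving_cons N).integral_comp (measurableEmbedding_cons N) g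

theorem integrable_integral_cons {g : V N → ℝ} (h : Integrable g) :
    Integrable fun z : Fin N → ℂ => ∫ t : ℂ, g (Fin.cons t z) :=
  (integrable_cons_iff.2 h).integral_prod_right

theorem integral_integral_cons {g : V N → ℝ} (h : Integrable g) :
    ∫ z : Fin N → ℂ, ∫ t : ℂ, g (Fin.cons t z) = ∫ x, g x := by
  rw [← integral_cons_prod]
  exact (integral_prod_symm _ (integrable_cons_iff.2 h)).symm

/-- Integration over `ℂ^{N+1}` in terms of the integral over the fibres of `ℂ^{N+1} → ℙ^N`. -/
theorem integral_fibre_aux {u : V N → ℝ}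
    (hu : ∀ (c : ℂ) x, c ≠ 0 → x ≠ 0 → u (c • x) = u x)
    {τ : V N → V N [⋀^Fin (m + 1 + 1)]→L[ℝ] ℝ} {σ : V N → V N [⋀^Fin m]→L[ℝ] ℝ}
    (hs : IsProductFibreIntegral (blowupPullback τ) (chartPullback σ)) (z : Fin N → ℂ) :
    ∫ t : ℂ, u (blowup N (Fin.cons t z)) *
        blowupPullback τ (Fin.cons t z) (frame (N + 1) (m + 1 + 1)) =
      u (Fin.cons 1 z) * chartCoeff LinearMap.id σ z := by
  rw [← chartPullback_frame, hs z, fibreFrame_frame, ← integral_const_mul]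
  refine integral_congr_ae ?_
  have h0 : ∀ᵐ t : ℂ, t ≠ 0 := by simp [ae_iff]
  filter_upwards [h0] with t ht
  rw [blowup_cons, hu t _ ht (cons_one_ne_zero z)]

theorem integrable_chart (hm : m + 1 + 1 = 2 * (N + 1)) {u : V N → ℝ}
    (hu : ∀ (c : ℂ) x, c ≠ 0 → x ≠ 0 → u (c • x) = u x)
    {τ : V N → V N [⋀^Fin (m + 1 + 1)]→L[ℝ] ℝ} {σ : V N → V N [⋀^Fin m]→L[ℝ] ℝ}
    (hs : IsProductFibreIntegral (blowupPullback τ) (chartPullback σ))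
    (hi : Integrable fun x => u x * τ x (frame (N + 1) (m + 1 + 1))) :
    Integrable fun z : Fin N → ℂ => u (Fin.cons 1 z) * chartCoeff LinearMap.id σ z := by
  have h := integrable_integral_cons (integrable_blowup hm hi)
  simpa only [integral_fibre_aux hu hs] using h

/-- This is the projection formula `∫ u π_* τ = ∫ (π^* u) τ`. In the coordinates `(t, z)` the
function `u` depends on `z` only when `t ≠ 0`, so it leaves the inner integral in Fubini's theorem.
-/
theorem integral_chart (hm : m + 1 + 1 = 2 * (N + 1)) {u : V N → ℝ}
    (hu : ∀ (c : ℂ) x, c ≠ 0 → x ≠ 0 → u (c • x) = u x)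
    {τ : V N → V N [⋀^Fin (m + 1 + 1)]→L[ℝ] ℝ} {σ : V N → V N [⋀^Fin m]→L[ℝ] ℝ}
    (hs : IsProductFibreIntegral (blowupPullback τ) (chartPullback σ))
    (hi : Integrable fun x => u x * τ x (frame (N + 1) (m + 1 + 1))) :
    ∫ z : Fin N → ℂ, u (Fin.cons 1 z) * chartCoeff LinearMap.id σ z =
      ∫ x, u x * τ x (frame (N + 1) (m + 1 + 1)) := by
  rw [integral_blowup hm, ← integral_integral_cons (integrable_blowup hm hi)]
  simp only [integral_fibre_aux hu hs]

end ChangeOfVariables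

/-! ### Moving `dd^c` from a test form to a smooth function -/

section IntegrationByParts

variable {N m : ℕ}

/-- Integrate by parts in the direction `a`, then `b`. The two signs cancel, and symmetry of the
second derivative restores the order of the directions. -/
theorem integral_mul_sndDeriv {u g : V N → ℝ} (hu : ContDiff ℝ 2 u) (hg : ContDiff ℝ 2 g)
    (hc : HasCompactSupport g) (a b : V N) :
    ∫ x, u x * fderiv ℝ (fderiv ℝ g) x a b = ∫ x, fderiv ℝ (fderiv ℝ u) x a b * g x := by
  have hdir : ∀ {f : V N → ℝ}, ContDiff ℝ 2 f → ∀ c : V N, ContDiff ℝ 1 fun x => fderiv ℝ f x c :=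
    fun hf c => (hf.fderiv_right (m := 1) le_rfl).clm_apply contDiff_const
  have hsnd : ∀ {f : V N → ℝ}, ContDiff ℝ 2 f → ∀ (c d : V N) (x : V N),
      fderiv ℝ (fun y => fderiv ℝ f y c) x d = fderiv ℝ (fderiv ℝ f) x d c := by
    intro f hf c d x
    have h1 : DifferentiableAt ℝ (fderiv ℝ f) x :=
      (hf.fderiv_right (m := 1) le_rfl).differentiable one_ne_zero x
    rw [fderiv_clm_apply h1 (differentiableAt_const c)]
    simp
  have hcd : ∀ c : V N, HasCompactSupport fun x => fderiv ℝ g x c := fun c => hc.fderiv_apply ℝ c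
  have hint : ∀ {f h : V N → ℝ}, Continuous f → Continuous h → HasCompactSupport h →
      Integrable fun x => f x * h x := fun hf hh hch =>
    (hf.mul hh).integrable_of_hasCompactSupport hch.mul_left
  have hd1 : ∀ {f : V N → ℝ}, ContDiff ℝ 1 f → ∀ c : V N, Continuous fun x => fderiv ℝ f x c :=
    fun hf c => (hf.continuous_fderiv one_ne_zero).clm_apply continuous_const
  have hu1 : ContDiff ℝ 1 u := hu.of_le (by norm_cast)
  have hg1 : ContDiff ℝ 1 g := hg.of_le (by norm_cast)
  have e1 := integral_mul_fderiv_eq_neg_fderiv_mul_of_integrable (μ := volume) (f := u)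
    (g := fun x => fderiv ℝ g x b) (v := a) (hint (hd1 hu1 a) (hd1 hg1 b) (hcd b))
    (hint hu.continuous (hd1 (hdir hg b) a) ((hcd b).fderiv_apply ℝ a))
    (hint hu.continuous (hd1 hg1 b) (hcd b))
    (fun x _ => hu1.differentiable one_ne_zero x)
    (fun x _ => (hdir hg b).differentiable one_ne_zero x)
  have e2 := integral_mul_fderiv_eq_neg_fderiv_mul_of_integrable (μ := volume)
    (f := fun x => fderiv ℝ u x a) (g := g) (v := b)
    (hint (hd1 (hdir hu a) b) hg.continuous hc)
    (hint (hd1 hu1 a) (hd1 hg1 b) (hcd b))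
    (hint (hd1 hu1 a) hg.continuous hc)
    (fun x _ => (hdir hu a).differentiable one_ne_zero x)
    (fun x _ => hg1.differentiable one_ne_zero x)
  simp only [hsnd hg, hsnd hu] at e1 e2
  rw [e1, e2, neg_neg]
  refine integral_congr_ae (Filter.Eventually.of_forall fun x => ?_)
  have hs : IsSymmSndFDerivAt ℝ u x := hu.contDiffAt.isSymmSndFDerivAt (by simp)
  simp only [hs.eq]

/-- The second derivative of a function, the second argument being multiplied by `-i`. -/
def twistedHessFun (u : V N → ℝ) (x : V N) : V N →L[ℝ] V N →L[ℝ] ℝ :=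
  ((ContinuousLinearMap.compL ℝ (V N) (V N) ℝ).flip (mulBy N (-Complex.I))).comp
    (fderiv ℝ (fderiv ℝ u) x)

theorem twistedHessFun_apply (u : V N → ℝ) (x v w : V N) :
    twistedHessFun u x v w = fderiv ℝ (fderiv ℝ u) x v (-Complex.I • w) := by
  simp [twistedHessFun, mulBy_apply]

theorem sndDeriv_form_apply {η : V N → V N [⋀^Fin m]→L[ℝ] ℝ} (hη : ContDiff ℝ 2 η) (x a b : V N)
    (r : Fin m → V N) :
    fderiv ℝ (fderiv ℝ η) x a b r = fderiv ℝ (fderiv ℝ fun y => η y r) x a b := by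
  let L := ContinuousAlternatingMap.apply ℝ (V N) ℝ r
  have h1 : fderiv ℝ (fun y => η y r) =
      fun y => ContinuousLinearMap.compL ℝ (V N) _ _ L (fderiv ℝ η y) := by
    funext y
    exact (hasFDerivAt_clm_comp L (hη.differentiable two_ne_zero y).hasFDerivAt).fderiv
  have hd : DifferentiableAt ℝ (fderiv ℝ η) x :=
    (hη.fderiv_right (m := 1) le_rfl).differentiable one_ne_zero x
  have h2 := (hasFDerivAt_clm_comp (E := V N) (F := V N →L[ℝ] V N [⋀^Fin m]→L[ℝ] ℝ)
    (G := V N →L[ℝ] ℝ) (ContinuousLinearMap.compL ℝ (V N) _ _ L) hd.hasFDerivAt).fderiv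
  rw [h1, h2]
  rfl

/-- Transferring `dd^c` from a compactly supported form to a function. -/
theorem integral_mul_ddc {u : V N → ℝ} (hu : ContDiff ℝ 2 u)
    {η : V N → V N [⋀^Fin m]→L[ℝ] ℝ} (hη : ContDiff ℝ 2 η) (hc : HasCompactSupport η)
    (v : Fin (m + 1 + 1) → V N) :
    ∫ x, u x * ddc η x v =
      1 / (4 * Real.pi) * ∫ x, wedge (twistedHessFun u x) (η x) v := by
  have hg : ∀ r : Fin m → V N, ContDiff ℝ 2 fun y => η y r := contDiff_apply_form hη
  have hcg : ∀ r : Fin m → V N, HasCompactSupport fun y => η y r := fun r =>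
    hc.comp_left (g := fun τ : V N [⋀^Fin m]→L[ℝ] ℝ => τ r) rfl
  have hcf : ∀ {f : V N → ℝ}, ContDiff ℝ 2 f → ∀ a b : V N,
      Continuous fun x => fderiv ℝ (fderiv ℝ f) x a b := fun hf a b =>
    ((((hf.fderiv_right (m := 1) le_rfl).continuous_fderiv one_ne_zero).clm_apply
      continuous_const).clm_apply continuous_const)
  have hcs : ∀ (r : Fin m → V N) (a b : V N),
      HasCompactSupport fun x => fderiv ℝ (fderiv ℝ fun y => η y r) x a b := by
    intro r a b
    have h1 : HasCompactSupport (fderiv ℝ (fderiv ℝ fun y => η y r)) := ((hcg r).fderiv ℝ).fderiv ℝ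
    exact h1.comp_left (g := fun D : V N →L[ℝ] V N →L[ℝ] ℝ => D a b) rfl
  have hi1 : ∀ (r : Fin m → V N) (a b : V N),
      Integrable fun x => u x * fderiv ℝ (fderiv ℝ fun y => η y r) x a b := fun r a b =>
    (hu.continuous.mul (hcf (hg r) a b)).integrable_of_hasCompactSupport (hcs r a b).mul_left
  have hi2 : ∀ (r : Fin m → V N) (a b : V N),
      Integrable fun x => fderiv ℝ (fderiv ℝ u) x a b * η x r := fun r a b =>
    ((hcf hu a b).mul (hg r).continuous).integrable_of_hasCompactSupport (hcg r).mul_left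
  have e1 : ∀ x, u x * ddc η x v = ∑ i : Fin (m + 1), ∑ j ≥ i,
      1 / (4 * Real.pi) * (-1 : ℝ) ^ (i + j : ℕ) *
      (u x * fderiv ℝ (fderiv ℝ fun y => η y (j.removeNth <| i.castSucc.removeNth v)) x
          (v i.castSucc) (-Complex.I • v j.succ) -
        u x * fderiv ℝ (fderiv ℝ fun y => η y (j.removeNth <| i.castSucc.removeNth v)) x
          (v j.succ) (-Complex.I • v i.castSucc)) := by
    intro x
    rw [ddc_eq hη.contDiffAt]
    change u x * (1 / (4 * Real.pi) * antisymm₂ _ v) = _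
    rw [antisymm₂_apply, Finset.mul_sum, Finset.mul_sum]
    refine Finset.sum_congr rfl fun i _ => ?_
    rw [Finset.mul_sum, Finset.mul_sum]
    refine Finset.sum_congr rfl fun j _ => ?_
    rw [twistedHess_apply, twistedHess_apply, sndDeriv_form_apply hη, sndDeriv_form_apply hη]
    ring
  have e2 : ∀ x, 1 / (4 * Real.pi) * wedge (twistedHessFun u x) (η x) v =
      ∑ i : Fin (m + 1), ∑ j ≥ i, 1 / (4 * Real.pi) * (-1 : ℝ) ^ (i + j : ℕ) *
      (fderiv ℝ (fderiv ℝ u) x (v i.castSucc) (-Complex.I • v j.succ) *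
          η x (j.removeNth <| i.castSucc.removeNth v) -
        fderiv ℝ (fderiv ℝ u) x (v j.succ) (-Complex.I • v i.castSucc) *
          η x (j.removeNth <| i.castSucc.removeNth v)) := by
    intro x
    rw [wedge_apply, Finset.mul_sum]
    refine Finset.sum_congr rfl fun i _ => ?_
    rw [Finset.mul_sum]
    refine Finset.sum_congr rfl fun j _ => ?_
    rw [twistedHessFun_apply, twistedHessFun_apply]
    ring
  rw [← integral_const_mul]
  simp only [e1, e2]
  have I1 : ∀ (c : ℝ) (r r' : Fin m → V N) (a b a' b' : V N), Integrable fun x =>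
      c * (u x * fderiv ℝ (fderiv ℝ fun y => η y r) x a b -
        u x * fderiv ℝ (fderiv ℝ fun y => η y r') x a' b') := fun c r r' a b a' b' =>
    ((hi1 r a b).sub (hi1 r' a' b')).const_mul c
  have I2 : ∀ (c : ℝ) (r r' : Fin m → V N) (a b a' b' : V N), Integrable fun x =>
      c * (fderiv ℝ (fderiv ℝ u) x a b * η x r - fderiv ℝ (fderiv ℝ u) x a' b' * η x r') :=
    fun c r r' a b a' b' => ((hi2 r a b).sub (hi2 r' a' b')).const_mul c
  rw [integral_finsetSum _ fun i _ => integrable_finsetSum _ fun j _ => I1 _ _ _ _ _ _ _,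
    integral_finsetSum _ fun i _ => integrable_finsetSum _ fun j _ => I2 _ _ _ _ _ _ _]
  refine Finset.sum_congr rfl fun i _ => ?_
  rw [integral_finsetSum _ fun j _ => I1 _ _ _ _ _ _ _,
    integral_finsetSum _ fun j _ => I2 _ _ _ _ _ _ _]
  refine Finset.sum_congr rfl fun j _ => ?_
  rw [integral_const_mul, integral_const_mul, integral_sub (hi1 _ _ _) (hi1 _ _ _),
    integral_sub (hi2 _ _ _) (hi2 _ _ _), integral_mul_sndDeriv hu (hg _) (hcg _),
    integral_mul_sndDeriv hu (hg _) (hcg _)]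

end IntegrationByParts

/-! ### The Levi form of `log ∑ |F_k|²` -/

section LeviForm

open ComplexConjugate

variable {N M m : ℕ}

/-- Lagrange's identity. -/
theorem lagrange_identity {ι : Type*} [Fintype ι] (F p q : ι → ℂ) :
    ∑ k, ∑ j, conj (F k * p j - F j * p k) * (F k * q j - F j * q k) =
      2 * ((∑ k, conj (F k) * F k) * (∑ k, conj (p k) * q k) -
        (∑ k, F k * conj (p k)) * (∑ k, conj (F k) * q k)) := by
  have e1 : ∑ k, ∑ j, conj (F k * p j - F j * p k) * (F k * q j - F j * q k) =
      ∑ k, ∑ j, ((conj (F k) * F k) * (conj (p j) * q j) + (conj (p k) * q k) * (conj (F j) * F j)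
        - (conj (F k) * q k) * (F j * conj (p j)) - (F k * conj (p k)) * (conj (F j) * q j)) := by
    refine Finset.sum_congr rfl fun k _ => Finset.sum_congr rfl fun j _ => ?_
    simp only [map_sub, map_mul]
    ring
  rw [e1]
  simp only [Finset.sum_sub_distrib, Finset.sum_add_distrib, ← Finset.mul_sum, ← Finset.sum_mul]
  ring

/-- The linear forms whose sum of squares is the Levi form of `log ∑ |F_k|²`, up to a factor. -/
def wronskianForm (F : Fin M → V N → ℂ) (x : V N) (k j : Fin M) : V N →L[ℂ] ℂ :=
  F k x • fderiv ℂ (F j) x - F j x • fderiv ℂ (F k) x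

/-- For `P = ∑ |F_k|²` the second derivative of `log P` is `P''/P - P' P'/P²`; the derivatives of
`|F_k|²` come from the complex derivatives of `F_k` regarded as real linear maps. -/
theorem sndDeriv_log_sum {F : Fin M → V N → ℂ} (hF : ∀ k, ContDiff ℂ 2 (F k))
    (h0 : ∀ x, ∑ k, ‖F k x‖ ^ 2 ≠ 0) (x v w : V N) :
    fderiv ℝ (fderiv ℝ fun y => Real.log (∑ k, ‖F k y‖ ^ 2)) x v w =
      (∑ k, 2 * (inner ℝ (fderiv ℂ (F k) x v) (fderiv ℂ (F k) x w) +
        inner ℝ (F k x) (fderiv ℂ (fderiv ℂ (F k)) x v w))) / (∑ k, ‖F k x‖ ^ 2) -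
      (∑ k, 2 * inner ℝ (F k x) (fderiv ℂ (F k) x v)) *
        (∑ k, 2 * inner ℝ (F k x) (fderiv ℂ (F k) x w)) / (∑ k, ‖F k x‖ ^ 2) ^ 2 := by
  have hFd : ∀ k y, HasFDerivAt (F k) ((fderiv ℂ (F k) y).restrictScalars ℝ) y := fun k y =>
    ((hF k).differentiable two_ne_zero y).hasFDerivAt.restrictScalars ℝ
  have hP : ∀ y, HasFDerivAt (fun y => ∑ k, ‖F k y‖ ^ 2)
      (∑ k, 2 • (innerSL ℝ (F k y)).comp ((fderiv ℂ (F k) y).restrictScalars ℝ)) y := fun y =>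
    HasFDerivAt.fun_sum fun k _ => (hFd k y).norm_sq
  have hu : ContDiff ℝ 2 fun y => Real.log (∑ k, ‖F k y‖ ^ 2) := by
    refine ContDiff.log (ContDiff.sum fun k _ => ?_) h0
    exact ((hF k).restrict_scalars ℝ).norm_sq ℝ
  have h1 : ∀ y, fderiv ℝ (fun y => Real.log (∑ k, ‖F k y‖ ^ 2)) y w =
      (∑ k, ‖F k y‖ ^ 2)⁻¹ * ∑ k, 2 * inner ℝ (F k y) (fderiv ℂ (F k) y w) := by
    intro y
    rw [((hP y).log (h0 y)).fderiv]
    simp only [_root_.smul_apply, sum_apply, smul_eq_mul]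
    congr 1
    refine Finset.sum_congr rfl fun k _ => ?_
    rw [nsmul_eq_mul]
    rfl
  have hd : DifferentiableAt ℝ (fderiv ℝ fun y => Real.log (∑ k, ‖F k y‖ ^ 2)) x :=
    (hu.fderiv_right (m := 1) le_rfl).differentiable one_ne_zero x
  have h2 : fderiv ℝ (fderiv ℝ fun y => Real.log (∑ k, ‖F k y‖ ^ 2)) x v w =
      fderiv ℝ (fun y => fderiv ℝ (fun y => Real.log (∑ k, ‖F k y‖ ^ 2)) y w) x v := by
    rw [fderiv_clm_apply hd (differentiableAt_const w)]
    simp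
  have h3 : ∀ k, HasFDerivAt (fun y => fderiv ℂ (F k) y w)
      (((ContinuousLinearMap.apply ℂ ℂ w).comp (fderiv ℂ (fderiv ℂ (F k)) x)).restrictScalars ℝ)
      x := by
    intro k
    have hd' : DifferentiableAt ℂ (fderiv ℂ (F k)) x :=
      ((hF k).fderiv_right (m := 1) le_rfl).differentiable one_ne_zero x
    exact ((ContinuousLinearMap.apply ℂ ℂ w).hasFDerivAt.comp x hd'.hasFDerivAt).restrictScalars ℝ
  have h4 := ((hasDerivAt_inv (h0 x)).comp_hasFDerivAt x (hP x)).mul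
    (HasFDerivAt.fun_sum (u := Finset.univ) fun k _ => ((hFd k x).inner ℝ (h3 k)).const_mul 2)
  rw [h2, funext h1]
  refine (congrArg (fun l => l v) h4.fderiv).trans ?_
  have e1 : (∑ k, 2 • (innerSL ℝ (F k x)).comp ((fderiv ℂ (F k) x).restrictScalars ℝ)) v =
      ∑ k, 2 * inner ℝ (F k x) (fderiv ℂ (F k) x v) := by
    rw [sum_apply]
    refine Finset.sum_congr rfl fun k _ => ?_
    rw [_root_.smul_apply, nsmul_eq_mul]
    rfl
  simp only [_root_.add_apply, _root_.smul_apply, smul_eq_mul, e1]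
  rw [sum_apply]
  have e2 : ∀ k, ((2 : ℝ) • ((fderivInnerCLM ℝ (F k x, fderiv ℂ (F k) x w)).comp
      (((fderiv ℂ (F k) x).restrictScalars ℝ).prod
        (((ContinuousLinearMap.apply ℂ ℂ w).comp
          (fderiv ℂ (fderiv ℂ (F k)) x)).restrictScalars ℝ)))) v =
      2 * (inner ℝ (fderiv ℂ (F k) x v) (fderiv ℂ (F k) x w) +
        inner ℝ (F k x) (fderiv ℂ (fderiv ℂ (F k)) x v w)) := by
    intro k
    rw [add_comm (inner ℝ _ _)]
    rfl
  simp only [e2, Function.comp_apply]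
  field_simp
  ring

theorem inner_complex_eq (a b : ℂ) : inner ℝ a b = (conj a * b).re := by
  rw [Complex.inner, mul_comm]

/-- The Levi form of `log ∑ |F_k|²`. -/
theorem leviForm_log_sum {F : Fin M → V N → ℂ} (hF : ∀ k, ContDiff ℂ 2 (F k))
    (h0 : ∀ x, ∑ k, ‖F k x‖ ^ 2 ≠ 0) (x v w : V N) :
    twistedHessFun (fun y => Real.log (∑ k, ‖F k y‖ ^ 2)) x v w -
      twistedHessFun (fun y => Real.log (∑ k, ‖F k y‖ ^ 2)) x w v =
    2 / (∑ k, ‖F k x‖ ^ 2) ^ 2 * ∑ k, ∑ j, (reTensorIm (wronskianForm F x k j) v w -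
      reTensorIm (wronskianForm F x k j) w v) := by
  have hs : ∀ k, fderiv ℂ (fderiv ℂ (F k)) x w v = fderiv ℂ (fderiv ℂ (F k)) x v w := fun k =>
    ((hF k).contDiffAt.isSymmSndFDerivAt (by simp)).eq w v
  rw [twistedHessFun_apply, twistedHessFun_apply, sndDeriv_log_sum hF h0, sndDeriv_log_sum hF h0]
  have hL := congrArg Complex.im (lagrange_identity (fun k => F k x)
    (fun k => fderiv ℂ (F k) x v) (fun k => fderiv ℂ (F k) x w))
  set P := ∑ k, ‖F k x‖ ^ 2 with hPdef
  have hP0 : P ≠ 0 := h0 x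
  have hPc : ∑ k, conj (F k x) * F k x = (P : ℂ) := by
    rw [hPdef]
    push_cast
    refine Finset.sum_congr rfl fun k _ => ?_
    rw [mul_comm, Complex.mul_conj, Complex.normSq_eq_norm_sq]
    push_cast; rfl
  set S := ∑ k, conj (fderiv ℂ (F k) x v) * fderiv ℂ (F k) x w with hS
  set a := ∑ k, conj (F k x) * fderiv ℂ (F k) x v with ha
  set b := ∑ k, conj (F k x) * fderiv ℂ (F k) x w with hb
  have hac : ∑ k, F k x * conj (fderiv ℂ (F k) x v) = conj a := by
    rw [ha, map_sum]
    refine Finset.sum_congr rfl fun k _ => ?_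
    simp
  rw [hPc, hac] at hL
  have e0 : ∑ k, ∑ j, (reTensorIm (wronskianForm F x k j) v w -
      reTensorIm (wronskianForm F x k j) w v) = 2 * (P * S.im - (conj a * b).im) := by
    rw [Complex.im_sum] at hL
    simp only [Complex.im_sum] at hL
    have e : (2 * ((P : ℂ) * S - conj a * b)).im = 2 * (P * S.im - (conj a * b).im) := by
      rw [show (2 : ℂ) = ((2 : ℝ) : ℂ) by norm_cast, Complex.im_ofReal_mul, Complex.sub_im,
        Complex.im_ofReal_mul]
    rw [← e, ← hL]
    refine Finset.sum_congr rfl fun k _ => Finset.sum_congr rfl fun j _ => ?_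
    have hw : ∀ y, wronskianForm F x k j y =
        F k x * fderiv ℂ (F j) x y - F j x * fderiv ℂ (F k) x y := fun y => rfl
    rw [reTensorIm_apply, reTensorIm_apply, hw, hw, Complex.mul_im, Complex.conj_re,
      Complex.conj_im]
    ring
  have e1 : ∑ k, 2 * inner ℝ (F k x) (fderiv ℂ (F k) x v) = 2 * a.re := by
    rw [ha, Complex.re_sum, Finset.mul_sum]
    exact Finset.sum_congr rfl fun k _ => by rw [inner_complex_eq]
  have e2 : ∑ k, 2 * inner ℝ (F k x) (fderiv ℂ (F k) x w) = 2 * b.re := by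
    rw [hb, Complex.re_sum, Finset.mul_sum]
    exact Finset.sum_congr rfl fun k _ => by rw [inner_complex_eq]
  have e3 : ∑ k, 2 * inner ℝ (F k x) (fderiv ℂ (F k) x (-Complex.I • v)) = 2 * a.im := by
    rw [ha, Complex.im_sum, Finset.mul_sum]
    refine Finset.sum_congr rfl fun k _ => ?_
    rw [inner_complex_eq, map_smul]
    simp
    ring
  have e4 : ∑ k, 2 * inner ℝ (F k x) (fderiv ℂ (F k) x (-Complex.I • w)) = 2 * b.im := by
    rw [hb, Complex.im_sum, Finset.mul_sum]
    refine Finset.sum_congr rfl fun k _ => ?_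
    rw [inner_complex_eq, map_smul]
    simp
    ring
  -- The second complex derivatives drop out of the antisymmetrization: they are symmetric and
  -- complex linear in each argument, so `-i` may sit on either one.
  have e5 : (∑ k, 2 * (inner ℝ (fderiv ℂ (F k) x v) (fderiv ℂ (F k) x (-Complex.I • w)) +
        inner ℝ (F k x) (fderiv ℂ (fderiv ℂ (F k)) x v (-Complex.I • w)))) -
      (∑ k, 2 * (inner ℝ (fderiv ℂ (F k) x w) (fderiv ℂ (F k) x (-Complex.I • v)) +
        inner ℝ (F k x) (fderiv ℂ (fderiv ℂ (F k)) x w (-Complex.I • v)))) = 4 * S.im := by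
    rw [hS, Complex.im_sum, Finset.mul_sum, ← Finset.sum_sub_distrib]
    refine Finset.sum_congr rfl fun k _ => ?_
    simp only [inner_complex_eq, map_smul, hs]
    simp
    ring
  rw [e0, e1, e2, e3, e4]
  have e6 : (conj a * b).im = a.re * b.im - a.im * b.re := by
    rw [Complex.mul_im, Complex.conj_re, Complex.conj_im]; ring
  rw [e6]
  field_simp
  linear_combination P * e5

/-- The integral of `log ∑ |F_k|²` against `dd^c η`. -/
theorem integral_log_sum_mul_ddc {F : Fin M → V N → ℂ} (hF : ∀ k, ContDiff ℂ 2 (F k))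
    (h0 : ∀ x, ∑ k, ‖F k x‖ ^ 2 ≠ 0)
    {η : V N → V N [⋀^Fin m]→L[ℝ] ℝ} (hη : ContDiff ℝ 2 η) (hc : HasCompactSupport η)
    (v : Fin (m + 1 + 1) → V N) :
    ∫ x, Real.log (∑ k, ‖F k x‖ ^ 2) * ddc η x v =
      1 / (2 * Real.pi) * ∫ x, ((∑ k, ‖F k x‖ ^ 2) ^ 2)⁻¹ *
        ∑ k, ∑ j, wedge (reTensorIm (wronskianForm F x k j)) (η x) v := by
  have hu : ContDiff ℝ 2 fun y => Real.log (∑ k, ‖F k y‖ ^ 2) := by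
    refine ContDiff.log (ContDiff.sum fun k _ => ?_) h0
    exact ((hF k).restrict_scalars ℝ).norm_sq ℝ
  rw [integral_mul_ddc hu hη hc, ← integral_const_mul, ← integral_const_mul]
  refine integral_congr_ae (Filter.Eventually.of_forall fun x => ?_)
  have e1 : wedge (twistedHessFun (fun y => Real.log (∑ k, ‖F k y‖ ^ 2)) x) (η x) =
      wedge ((2 / (∑ k, ‖F k x‖ ^ 2) ^ 2) • ∑ k, ∑ j, reTensorIm (wronskianForm F x k j))
        (η x) := by
    refine wedge_congr (fun v w => ?_) _
    rw [leviForm_log_sum hF h0]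
    simp only [_root_.smul_apply, sum_apply, smul_eq_mul, ← mul_sub,
      ← Finset.sum_sub_distrib]
  have e2 : wedge (∑ k, ∑ j, reTensorIm (wronskianForm F x k j)) (η x) =
      ∑ k, ∑ j, wedge (reTensorIm (wronskianForm F x k j)) (η x) := by
    simp only [← wedgeL_apply, map_sum, sum_apply]
  have e3 : (∑ k, ∑ j, wedge (reTensorIm (wronskianForm F x k j)) (η x)) v =
      ∑ k, ∑ j, wedge (reTensorIm (wronskianForm F x k j)) (η x) v := by
    simp only [ContinuousAlternatingMap.sum_apply]
  simp only [e1]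
  rw [wedge_smul_left, e2, ← e3]
  change 1 / (4 * Real.pi) * (2 / (∑ k, ‖F k x‖ ^ 2) ^ 2 *
    (∑ k, ∑ j, wedge (reTensorIm (wronskianForm F x k j)) (η x)) v) = _
  have := Real.pi_ne_zero
  have := h0 x
  field_simp
  ring

end LeviForm

/-! ### Radial integrals over the complex plane -/

section PlanarIntegrals

theorem integrable_norm_iff_complex {f : ℝ → ℝ} :
    Integrable (fun t : ℂ => f ‖t‖) ↔ IntegrableOn (fun y => y * f y) (Set.Ioi 0) := by
  have h := integrable_fun_norm_addHaar (volume : Measure ℂ) (f := f)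
  simpa [Complex.finrank_real_complex] using h

theorem integral_norm_complex (f : ℝ → ℝ) :
    ∫ t : ℂ, f ‖t‖ = 2 * Real.pi * ∫ y in Set.Ioi 0, y * f y := by
  have h := integral_fun_norm_addHaar (volume : Measure ℂ) f
  rw [h, Complex.finrank_real_complex, measureReal_def, Complex.volume_ball]
  simp
  ring

theorem hasDerivAt_poisson_primitive (y : ℝ) :
    HasDerivAt (fun y : ℝ => -(1 / 2) * (y ^ 2 + 1)⁻¹) (y * ((y ^ 2 + 1) ^ 2)⁻¹) y := by
  have h0 : y ^ 2 + 1 ≠ 0 := by positivity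
  have h1 : HasDerivAt (fun y : ℝ => y ^ 2 + 1) (2 * y) y := by
    simpa using (hasDerivAt_pow 2 y).add_const 1
  have h2 := (h1.inv h0).const_mul (-(1 / 2) : ℝ)
  have e : -(1 / 2) * (-(2 * y) / (y ^ 2 + 1) ^ 2) = y * ((y ^ 2 + 1) ^ 2)⁻¹ := by
    field_simp
  exact e ▸ h2

theorem tendsto_poisson_primitive :
    Tendsto (fun y : ℝ => -(1 / 2) * (y ^ 2 + 1)⁻¹) atTop (nhds 0) := by
  have h : Tendsto (fun y : ℝ => y ^ 2 + 1) atTop atTop :=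
    tendsto_atTop_add_const_right _ _ (tendsto_pow_atTop two_ne_zero)
  simpa using (tendsto_inv_atTop_zero.comp h).const_mul (-(1 / 2) : ℝ)

theorem integrable_poisson : Integrable fun t : ℂ => ((‖t‖ ^ 2 + 1) ^ 2)⁻¹ := by
  refine (integrable_norm_iff_complex (f := fun y => ((y ^ 2 + 1) ^ 2)⁻¹)).2 ?_
  exact integrableOn_Ioi_deriv_of_nonneg
    (hasDerivAt_poisson_primitive 0).continuousAt.continuousWithinAt
    (fun y _ => hasDerivAt_poisson_primitive y)
    (fun y hy => mul_nonneg (le_of_lt hy) (by positivity)) tendsto_poisson_primitive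

theorem integral_poisson : ∫ t : ℂ, ((‖t‖ ^ 2 + 1) ^ 2)⁻¹ = Real.pi := by
  rw [integral_norm_complex fun y => ((y ^ 2 + 1) ^ 2)⁻¹,
    integral_Ioi_of_hasDerivAt_of_nonneg
      (hasDerivAt_poisson_primitive 0).continuousAt.continuousWithinAt
      (fun y _ => hasDerivAt_poisson_primitive y)
      (fun y hy => mul_nonneg (le_of_lt hy) (by positivity)) tendsto_poisson_primitive]
  norm_num
  ring

/-- The functions `δ² / (π (|t|² + δ²)²)` are an approximate identity. -/
theorem tendsto_integral_poisson {H : ℂ → ℝ} (hH : Continuous H) {M : ℝ} (hM : ∀ t, |H t| ≤ M)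
    {δ : ℕ → ℝ} (hδ : ∀ k, 0 < δ k) (hδ0 : Tendsto δ atTop (nhds 0)) :
    Tendsto (fun k => ∫ t : ℂ, ((‖t‖ ^ 2 + δ k ^ 2) ^ 2)⁻¹ * δ k ^ 2 * H t) atTop
      (nhds (Real.pi * H 0)) := by
  -- The substitution `t ↦ δ t`, with Jacobian `δ²`, moves `δ` from the kernel into the argument of
  -- `H`.
  have e1 : ∀ k, ∫ t : ℂ, ((‖t‖ ^ 2 + δ k ^ 2) ^ 2)⁻¹ * δ k ^ 2 * H t =
      ∫ t : ℂ, ((‖t‖ ^ 2 + 1) ^ 2)⁻¹ * H (δ k • t) := by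
    intro k
    have h := Measure.integral_comp_smul (volume : Measure ℂ)
      (fun t : ℂ => ((‖t‖ ^ 2 + δ k ^ 2) ^ 2)⁻¹ * δ k ^ 2 * H t) (δ k)
    have hk := hδ k
    rw [Complex.finrank_real_complex, abs_of_pos (by positivity), smul_eq_mul,
      eq_comm, inv_mul_eq_iff_eq_mul₀ (by positivity), ← integral_const_mul] at h
    rw [h]
    refine integral_congr_ae (Filter.Eventually.of_forall fun t => ?_)
    simp only [norm_smul, Real.norm_eq_abs, mul_pow, sq_abs]
    have : (δ k ^ 2 * ‖t‖ ^ 2 + δ k ^ 2) = δ k ^ 2 * (‖t‖ ^ 2 + 1) := by ring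
    rw [this]
    field_simp
  simp only [e1]
  rw [← integral_poisson, ← integral_mul_const]
  refine tendsto_integral_of_dominated_convergence (fun t => ((‖t‖ ^ 2 + 1) ^ 2)⁻¹ * M)
    (fun k => ?_) (integrable_poisson.mul_const M) (fun k => ?_) ?_
  · refine Continuous.aestronglyMeasurable (Continuous.mul (Continuous.inv₀ (by fun_prop)
      fun t => by positivity) (hH.comp (by fun_prop)))
  · refine Filter.Eventually.of_forall fun t => ?_
    rw [norm_mul, Real.norm_of_nonneg (by positivity)]
    exact mul_le_mul_of_nonneg_left (hM _) (by positivity)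
  · refine Filter.Eventually.of_forall fun t => ?_
    refine Tendsto.const_mul _ ?_
    have h1 : Tendsto (fun k => δ k • t) atTop (nhds 0) := by
      simpa using hδ0.smul_const t
    exact (hH.tendsto 0).comp h1

/-- The Jacobian factor of polar coordinates absorbs the singularity: `y log y` is continuous at 0.
-/
theorem integrable_log_norm_sq_indicator (R : ℝ) :
    Integrable fun t : ℂ => (Set.Iic R).indicator (fun y => |Real.log (y ^ 2)|) ‖t‖ := by
  refine integrable_norm_iff_complex.2 ?_
  have h1 : IntegrableOn (fun y => |2 * (y * Real.log y)|) (Set.Icc 0 R) :=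
    (Continuous.continuousOn (by
      exact (continuous_const.mul Real.continuous_mul_log).abs)).integrableOn_Icc
  have h2 : IntegrableOn ((Set.Icc 0 R).indicator fun y => |2 * (y * Real.log y)|)
      (Set.Ioi 0) := by
    exact ((integrable_indicator_iff measurableSet_Icc).2 h1).integrableOn
  refine h2.congr_fun (fun y hy => ?_) measurableSet_Ioi
  have hy' : 0 < y := hy
  by_cases hR : y ≤ R
  · rw [Set.indicator_of_mem (show y ∈ Set.Icc 0 R from ⟨hy'.le, hR⟩),
      Set.indicator_of_mem (show y ∈ Set.Iic R from hR), Real.log_pow, abs_mul, abs_mul,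
      abs_mul, abs_of_pos hy']
    push_cast
    ring
  · rw [Set.indicator_of_notMem (fun h => hR h.2),
      Set.indicator_of_notMem (show y ∉ Set.Iic R from hR), mul_zero]

end PlanarIntegrals

/-! ### The Poincaré–Lelong formula for a coordinate hyperplane -/

section PoincareLelong

variable {N m : ℕ}

theorem norm_fst_le (t : ℂ) (y : Fin N → ℂ) : ‖t‖ ≤ ‖(Fin.cons t y : V N)‖ :=
  norm_le_pi_norm (Fin.cons t y : V N) 0

theorem norm_snd_le (t : ℂ) (y : Fin N → ℂ) : ‖y‖ ≤ ‖(Fin.cons t y : V N)‖ :=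
  (pi_norm_le_iff_of_nonneg (norm_nonneg _)).2 fun i =>
    norm_le_pi_norm (Fin.cons t y : V N) i.succ

theorem exists_bound_of_compactSupport {E : Type*} [NormedAddCommGroup E] {g : E → ℝ}
    (hg : Continuous g) (hc : HasCompactSupport g) :
    ∃ R M : ℝ, 0 ≤ M ∧ (∀ x, |g x| ≤ M) ∧ ∀ x, R < ‖x‖ → g x = 0 := by
  obtain ⟨M, hM⟩ := hg.bounded_above_of_compact_support hc
  obtain ⟨R, hR⟩ := hc.isCompact.isBounded.exists_norm_le
  refine ⟨R, M, (norm_nonneg _).trans (hM 0), hM, fun x hx => ?_⟩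
  by_contra h0
  exact absurd (hR x (subset_tsupport _ h0)) (not_le.2 hx)

theorem measurable_log_coord : Measurable fun x : V N => Real.log (‖x 0‖ ^ 2) :=
  Real.measurable_log.comp (((measurable_pi_apply 0).norm).pow_const 2)

/-- The integrand is dominated by a product of a locally integrable logarithm in `x₀`, cut off at
radius `R`, and a constant on a ball in the other coordinates. -/
theorem integrable_log_coord_mul {g : V N → ℝ} (hg : Continuous g) (hc : HasCompactSupport g) :
    Integrable fun x : V N => Real.log (‖x 0‖ ^ 2) * g x := by
  obtain ⟨R, M, hM0, hM, hR⟩ := exists_bound_of_compactSupport hg hc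
  have h1 : Integrable fun y : Fin N → ℂ => (Metric.closedBall (0 : Fin N → ℂ) R).indicator
      (fun _ => M) y :=
    (integrable_indicator_iff measurableSet_closedBall).2
      (integrableOn_const (measure_closedBall_lt_top).ne)
  have h2 := (integrable_log_norm_sq_indicator R).mul_prod h1
  refine integrable_cons_iff.1 (h2.mono' ?_ (Filter.Eventually.of_forall fun p => ?_))
  · exact ((measurable_log_coord.mul hg.measurable).comp
      continuous_cons.measurable).aestronglyMeasurable
  · rw [norm_mul, Real.norm_eq_abs, Real.norm_eq_abs, Fin.cons_zero]
    by_cases hp : R < ‖(Fin.cons p.1 p.2 : V N)‖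
    · rw [hR _ hp, abs_zero, mul_zero]
      exact mul_nonneg (Set.indicator_nonneg (fun _ _ => abs_nonneg _) _)
        (Set.indicator_nonneg (fun _ _ => hM0) _)
    · push Not at hp
      rw [Set.indicator_of_mem (show ‖p.1‖ ∈ Set.Iic R from (norm_fst_le _ _).trans hp),
        Set.indicator_of_mem (by simpa using (norm_snd_le _ _).trans hp)]
      exact mul_le_mul_of_nonneg_left (hM _) (abs_nonneg _)

theorem continuous_integral_cons {h : V N → ℝ} (hh : Continuous h) {R : ℝ}
    (hR : ∀ x, R < ‖x‖ → h x = 0) :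
    Continuous fun t : ℂ => ∫ y : Fin N → ℂ, h (Fin.cons t y) := by
  have e : ∀ t : ℂ, ∫ y : Fin N → ℂ, h (Fin.cons t y) =
      ∫ y in Metric.closedBall (0 : Fin N → ℂ) R, h (Fin.cons t y) := by
    intro t
    rw [setIntegral_eq_integral_of_forall_compl_eq_zero]
    intro y hy
    exact hR _ ((by simpa using hy : R < ‖y‖).trans_le (norm_snd_le t y))
  simp only [e]
  exact continuous_parametric_integral_of_continuous (f := fun (t : ℂ) (y : Fin N → ℂ) =>
    h (Fin.cons t y)) (hh.comp continuous_cons) (isCompact_closedBall 0 R)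

theorem integral_poisson_mul {h : V N → ℝ} (hh : Continuous h) (hc : HasCompactSupport h)
    {δ : ℝ} (hδ : 0 < δ) :
    ∫ x : V N, ((‖x 0‖ ^ 2 + δ ^ 2) ^ 2)⁻¹ * δ ^ 2 * h x =
      ∫ t : ℂ, ((‖t‖ ^ 2 + δ ^ 2) ^ 2)⁻¹ * δ ^ 2 * ∫ y : Fin N → ℂ, h (Fin.cons t y) := by
  have hcont : Continuous fun x : V N => ((‖x 0‖ ^ 2 + δ ^ 2) ^ 2)⁻¹ * δ ^ 2 * h x := by
    refine Continuous.mul (Continuous.mul (Continuous.inv₀ (by fun_prop) fun x => by positivity)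
      continuous_const) hh
  have hi : Integrable fun x : V N => ((‖x 0‖ ^ 2 + δ ^ 2) ^ 2)⁻¹ * δ ^ 2 * h x :=
    hcont.integrable_of_hasCompactSupport hc.mul_left
  rw [← integral_cons_prod]
  refine (integral_prod _ (integrable_cons_iff.2 hi)).trans ?_
  simp only [Fin.cons_zero, integral_const_mul]

theorem continuous_ddc_apply {η : V N → V N [⋀^Fin m]→L[ℝ] ℝ} (hη : ContDiff ℝ 2 η)
    (v : Fin (m + 1 + 1) → V N) : Continuous fun x => ddc η x v := by
  have h1 : ContDiff ℝ 1 (dc η) := contDiff_dc hη le_rfl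
  exact (contDiff_apply_form (contDiff_extDeriv (n' := 0) h1 le_rfl) v).continuous

theorem tsupport_ddc_subset {η : V N → V N [⋀^Fin m]→L[ℝ] ℝ} :
    tsupport (ddc η) ⊆ tsupport η := by
  refine closure_minimal (fun x hx => ?_) (isClosed_tsupport η)
  by_contra h
  apply hx
  have h0 : η =ᶠ[nhds x] 0 := notMem_tsupport_iff_eventuallyEq.1 h
  have h1 : ∀ {k : ℕ} {σ : V N → V N [⋀^Fin k]→L[ℝ] ℝ}, σ =ᶠ[nhds x] 0 →
      extDeriv σ =ᶠ[nhds x] 0 := by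
    intro k σ hσ
    refine hσ.extDeriv.trans (Filter.Eventually.of_forall fun y => ?_)
    rw [extDeriv, fderiv_zero]
    exact map_zero (ContinuousAlternatingMap.alternatizeUncurryFinCLM ℝ (V N) ℝ)
  have h2 : dc η =ᶠ[nhds x] 0 := by
    have h3 : (fun y => (η y).compContinuousLinearMap (mulBy N Complex.I)) =ᶠ[nhds x] 0 := by
      filter_upwards [h0] with y hy
      rw [hy]; rfl
    filter_upwards [h1 h3] with y hy
    rw [dc, hy]
    ext v
    exact mul_zero _
  exact (h1 h2).self_of_nhds

theorem hasCompactSupport_ddc {η : V N → V N [⋀^Fin m]→L[ℝ] ℝ} (hc : HasCompactSupport η) :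
    HasCompactSupport (ddc η) :=
  hc.isCompact.of_isClosed_subset (isClosed_tsupport _) tsupport_ddc_subset

/-- The pair of functions `x₀, δ`. -/
def coordPair (N : ℕ) (δ : ℝ) : Fin 2 → V N → ℂ := ![fun x => x 0, fun _ => (δ : ℂ)]

theorem sum_coordPair (δ : ℝ) (x : V N) :
    ∑ k, ‖coordPair N δ k x‖ ^ 2 = ‖x 0‖ ^ 2 + δ ^ 2 := by
  rw [Fin.sum_univ_two]
  simp [coordPair]

theorem contDiff_coordPair (δ : ℝ) (k : Fin 2) : ContDiff ℂ 2 (coordPair N δ k) := by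
  fin_cases k
  · exact contDiff_apply ℂ ℂ (0 : Fin (N + 1))
  · exact contDiff_const

/-- The forms `F_k dF_j - F_j dF_k` are `∓ δ dx₀` for the two off-diagonal pairs and `0` on the
diagonal. Each off-diagonal pair contributes `δ²`. -/
theorem sum_wedge_coordPair (δ : ℝ) (x : V N) (τ : V N [⋀^Fin m]→L[ℝ] ℝ) :
    ∑ k, ∑ j, wedge (reTensorIm (wronskianForm (coordPair N δ) x k j)) τ
      (frame (N + 1) (m + 1 + 1)) = 2 * δ ^ 2 * τ fun j => (Fin.cons 0 (frame N m j) : V N) := by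
  have hd0 : ∀ v, fderiv ℂ (coordPair N δ 0) x v = v 0 := by
    intro v
    have : HasFDerivAt (coordPair N δ 0) (ContinuousLinearMap.proj (R := ℂ) 0 : V N →L[ℂ] ℂ) x :=
      (ContinuousLinearMap.proj (R := ℂ) (φ := fun _ : Fin (N + 1) => ℂ) 0).hasFDerivAt
    rw [this.fderiv]
    rfl
  have hd1 : ∀ v, fderiv ℂ (coordPair N δ 1) x v = 0 := by
    intro v
    have : HasFDerivAt (coordPair N δ 1) (0 : V N →L[ℂ] ℂ) x := hasFDerivAt_const _ _
    rw [this.fderiv]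
    rfl
  have e : ∀ k j v, wronskianForm (coordPair N δ) x k j v =
      coordPair N δ k x * fderiv ℂ (coordPair N δ j) x v -
        coordPair N δ j x * fderiv ℂ (coordPair N δ k) x v := fun k j v => rfl
  have c1 : coordPair N δ 1 x = δ := rfl
  simp only [Fin.sum_univ_two]
  rw [wedge_frame (r := 0) (b := reTensorIm (wronskianForm (coordPair N δ) x 0 0)),
    wedge_frame (r := δ ^ 2) (b := reTensorIm (wronskianForm (coordPair N δ) x 0 1)),
    wedge_frame (r := δ ^ 2) (b := reTensorIm (wronskianForm (coordPair N δ) x 1 0)),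
    wedge_frame (r := 0) (b := reTensorIm (wronskianForm (coordPair N δ) x 1 1))]
  · ring
  all_goals
    intro z w
    simp only [reTensorIm_apply, e, hd0, hd1, c1]
    simp
  all_goals ring

/-- The Poincaré–Lelong formula for a coordinate hyperplane. -/
theorem integral_log_coord_mul_ddc {η : V N → V N [⋀^Fin m]→L[ℝ] ℝ} (hη : ContDiff ℝ 2 η)
    (hc : HasCompactSupport η) :
    ∫ x : V N, Real.log (‖x 0‖ ^ 2) * ddc η x (frame (N + 1) (m + 1 + 1)) =
      ∫ y : Fin N → ℂ, η (Fin.cons 0 y) fun j => (Fin.cons 0 (frame N m j) : V N) := by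
  set g : V N → ℝ := fun x => ddc η x (frame (N + 1) (m + 1 + 1)) with hg
  set h : V N → ℝ := fun x => η x fun j => (Fin.cons 0 (frame N m j) : V N) with hh
  have hgc : Continuous g := continuous_ddc_apply hη _
  have hgs : HasCompactSupport g := (hasCompactSupport_ddc hc).comp_left
    (g := fun τ : V N [⋀^Fin (m + 1 + 1)]→L[ℝ] ℝ => τ (frame (N + 1) (m + 1 + 1))) rfl
  have hhc : Continuous h := (contDiff_apply_form hη _).continuous
  have hhs : HasCompactSupport h := hc.comp_left
    (g := fun τ : V N [⋀^Fin m]→L[ℝ] ℝ => τ fun j => (Fin.cons 0 (frame N m j) : V N)) rfl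
  obtain ⟨R, M, hM0, hM, hR⟩ := exists_bound_of_compactSupport hhc hhs
  -- Regularize `log |x₀|²` by the smooth functions `log (|x₀|² + δ²)`. Because `δ ≤ 1`, these lie
  -- between `log |x₀|²` and `log (|x₀|² + 1)`, which supplies the majorant for dominated
  -- convergence.
  set δ : ℕ → ℝ := fun k => 1 / ((k : ℝ) + 1) with hδdef
  have hδ : ∀ k, 0 < δ k := fun k => by positivity
  have hδ1 : ∀ k, δ k ≤ 1 := fun k => by
    rw [hδdef]
    exact (div_le_one (by positivity)).2 (by linarith [(Nat.cast_nonneg k : (0 : ℝ) ≤ k)])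
  have hδ0 : Tendsto δ atTop (nhds 0) := tendsto_one_div_add_atTop_nhds_zero_nat
  -- The Levi form of the regularized logarithm is the kernel `δ² / (π (|x₀|² + δ²)²)`, which
  -- concentrates on the hyperplane `x₀ = 0`.
  have key : ∀ k, ∫ x, Real.log (‖x 0‖ ^ 2 + δ k ^ 2) * g x =
      1 / Real.pi * ∫ t : ℂ, ((‖t‖ ^ 2 + δ k ^ 2) ^ 2)⁻¹ * δ k ^ 2 *
        ∫ y : Fin N → ℂ, h (Fin.cons t y) := by
    intro k
    have h1 := integral_log_sum_mul_ddc (F := coordPair N (δ k)) (contDiff_coordPair (δ k))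
      (fun x => by
        rw [sum_coordPair]
        have := hδ k
        positivity) hη hc (frame (N + 1) (m + 1 + 1))
    simp only [sum_coordPair, sum_wedge_coordPair] at h1
    rw [h1, ← integral_poisson_mul hhc hhs (hδ k), ← integral_const_mul, ← integral_const_mul]
    refine integral_congr_ae (Filter.Eventually.of_forall fun x => ?_)
    simp only [hh]
    have := Real.pi_ne_zero
    field_simp
  have lim1 : Tendsto (fun k => ∫ x, Real.log (‖x 0‖ ^ 2 + δ k ^ 2) * g x) atTop
      (nhds (∫ x, Real.log (‖x 0‖ ^ 2) * g x)) := by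
    have i1 : Integrable fun x : V N => |Real.log (‖x 0‖ ^ 2)| * |g x| := by
      simpa only [norm_mul, Real.norm_eq_abs] using (integrable_log_coord_mul hgc hgs).norm
    have i2 : Integrable fun x : V N => Real.log (‖x 0‖ ^ 2 + 1) * |g x| := by
      refine Continuous.integrable_of_hasCompactSupport (Continuous.mul (Continuous.log
        (by fun_prop) fun x => by positivity) hgc.abs) ?_
      exact (hgs.comp_left (g := fun r : ℝ => |r|) abs_zero).mul_left
    refine tendsto_integral_of_dominated_convergence
      (fun x => |Real.log (‖x 0‖ ^ 2)| * |g x| + Real.log (‖x 0‖ ^ 2 + 1) * |g x|)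
      (fun k => ?_) (i1.add i2) (fun k => ?_) ?_
    · refine Continuous.aestronglyMeasurable (Continuous.mul (Continuous.log (by fun_prop)
        fun x => ?_) hgc)
      have := hδ k
      positivity
    · filter_upwards [measure_eq_zero_iff_ae_notMem.1 (volume_coord_eq_zero N)] with x hx
      have hx0 : 0 < ‖x 0‖ ^ 2 := by
        have : 0 < ‖x 0‖ := norm_pos_iff.2 hx
        positivity
      rw [norm_mul, Real.norm_eq_abs, Real.norm_eq_abs, ← add_mul]
      refine mul_le_mul_of_nonneg_right ?_ (abs_nonneg _)
      have a1 : Real.log (‖x 0‖ ^ 2) ≤ Real.log (‖x 0‖ ^ 2 + δ k ^ 2) :=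
        Real.log_le_log hx0 (by have := hδ k; nlinarith)
      have a2 : Real.log (‖x 0‖ ^ 2 + δ k ^ 2) ≤ Real.log (‖x 0‖ ^ 2 + 1) :=
        Real.log_le_log (by positivity) (by nlinarith [hδ k, hδ1 k])
      have a3 : 0 ≤ Real.log (‖x 0‖ ^ 2 + 1) := Real.log_nonneg (by linarith)
      rw [abs_le]
      constructor
      · linarith [neg_abs_le (Real.log (‖x 0‖ ^ 2))]
      · linarith [abs_nonneg (Real.log (‖x 0‖ ^ 2))]
    · filter_upwards [measure_eq_zero_iff_ae_notMem.1 (volume_coord_eq_zero N)] with x hx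
      have hx0 : ‖x 0‖ ^ 2 ≠ 0 := by
        have : 0 < ‖x 0‖ := norm_pos_iff.2 hx
        positivity
      refine Tendsto.mul_const _ ((Real.continuousAt_log hx0).tendsto.comp ?_)
      simpa using (hδ0.pow 2).const_add (‖x 0‖ ^ 2)
  have hHc : Continuous fun t : ℂ => ∫ y : Fin N → ℂ, h (Fin.cons t y) :=
    continuous_integral_cons hhc hR
  have hHs : HasCompactSupport fun t : ℂ => ∫ y : Fin N → ℂ, h (Fin.cons t y) := by
    refine HasCompactSupport.intro (isCompact_closedBall 0 R) fun t ht => ?_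
    have : ∀ y : Fin N → ℂ, h (Fin.cons t y) = 0 := fun y =>
      hR _ ((by simpa using ht : R < ‖t‖).trans_le (norm_fst_le t y))
    simp [this]
  obtain ⟨_, M', _, hM', _⟩ := exists_bound_of_compactSupport hHc hHs
  have lim2 := (tendsto_integral_poisson hHc hM' hδ hδ0).const_mul (1 / Real.pi)
  simp only [← key] at lim2
  rw [tendsto_nhds_unique lim1 lim2, ← mul_assoc, one_div, inv_mul_cancel₀ Real.pi_ne_zero,
    one_mul]

end PoincareLelong

/-! ### Linear changes of variables and restriction to linear subspaces -/

section LinearChange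

variable {N m k : ℕ}

/-- The real-linear map underlying a complex linear map. -/
def realCLM (b : V k →ₗ[ℂ] V N) : V k →L[ℝ] V N :=
  (LinearMap.toContinuousLinearMap b).restrictScalars ℝ

@[simp] theorem realCLM_apply (b : V k →ₗ[ℂ] V N) (x : V k) : realCLM b x = b x := rfl

theorem realCLM_smul (b : V k →ₗ[ℂ] V N) (c : ℂ) (x : V k) :
    realCLM b (c • x) = c • realCLM b x := b.map_smul c x

theorem abs_det_smul_linear (hm : m = 2 * (N + 1)) (A : V N →ₗ[ℂ] V N) (u : V N → ℝ)
    (τ : V N → V N [⋀^Fin m]→L[ℝ] ℝ) (x : V N) :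
    |(realCLM A).det| • (u (realCLM A x) * τ (realCLM A x) (frame (N + 1) m)) =
      u (A x) * τ (A x) (fun j => A (frame (N + 1) m j)) := by
  rw [abs_of_nonneg (det_nonneg_of_complexLinear (realCLM_smul A)), smul_eq_mul]
  have := topForm_comp hm (τ (A x)) (realCLM A) (frame (N + 1) m)
  change _ = u (A x) * τ (A x) (realCLM A ∘ frame (N + 1) m)
  rw [this]
  simp only [realCLM_apply]
  ring

theorem image_linear_univ {A : V N →ₗ[ℂ] V N} (hA : Function.Injective A) :
    realCLM A '' Set.univ = Set.univ := by
  rw [Set.image_univ]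
  exact Set.range_eq_univ.2 (LinearMap.surjective_of_injective hA)

/-- Complex linear change of variables for the integral of a top degree form. -/
theorem integral_linear (hm : m = 2 * (N + 1)) {A : V N →ₗ[ℂ] V N} (hA : Function.Injective A)
    (u : V N → ℝ) (τ : V N → V N [⋀^Fin m]→L[ℝ] ℝ) :
    ∫ x, u x * τ x (frame (N + 1) m) =
      ∫ x, u (A x) * τ (A x) (fun j => A (frame (N + 1) m j)) := by
  have h1 := integral_image_eq_integral_abs_det_fderiv_smul volume MeasurableSet.univ
    (fun x _ => ((realCLM A).hasFDerivAt (x := x)).hasFDerivWithinAt) (hA.injOn)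
    (fun x : V N => u x * τ x (frame (N + 1) m))
  rw [image_linear_univ hA] at h1
  simpa only [abs_det_smul_linear hm, Measure.restrict_univ] using h1

theorem integrable_linear (hm : m = 2 * (N + 1)) {A : V N →ₗ[ℂ] V N} (hA : Function.Injective A)
    (u : V N → ℝ) (τ : V N → V N [⋀^Fin m]→L[ℝ] ℝ) :
    Integrable (fun x => u x * τ x (frame (N + 1) m)) ↔
      Integrable fun x => u (A x) * τ (A x) (fun j => A (frame (N + 1) m j)) := by
  have h1 := integrableOn_image_iff_integrableOn_abs_det_fderiv_smul volume MeasurableSet.univ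
    (fun x _ => ((realCLM A).hasFDerivAt (x := x)).hasFDerivWithinAt) (hA.injOn)
    (fun x : V N => u x * τ x (frame (N + 1) m))
  rw [image_linear_univ hA] at h1
  simpa only [abs_det_smul_linear hm, integrableOn_univ] using h1

/-- The pullback of a form by a complex linear map. -/
def linPullback (b : V k →ₗ[ℂ] V N) (η : V N → V N [⋀^Fin m]→L[ℝ] ℝ) (y : V k) :
    V k [⋀^Fin m]→L[ℝ] ℝ :=
  (η (b y)).compContinuousLinearMap (realCLM b)

theorem linPullback_apply (b : V k →ₗ[ℂ] V N) (η : V N → V N [⋀^Fin m]→L[ℝ] ℝ) (y : V k)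
    (v : Fin m → V k) : linPullback b η y v = η (b y) fun j => b (v j) := rfl

theorem linPullback_eq (b : V k →ₗ[ℂ] V N) (η : V N → V N [⋀^Fin m]→L[ℝ] ℝ) :
    linPullback b η =
      fun y => (η (realCLM b y)).compContinuousLinearMap (fderiv ℝ (realCLM b) y) := by
  funext y
  rw [(realCLM b).fderiv]
  rfl

theorem ContDiff.linPullback {n : WithTop ℕ∞} (b : V k →ₗ[ℂ] V N)
    {η : V N → V N [⋀^Fin m]→L[ℝ] ℝ} (h : ContDiff ℝ n η) : ContDiff ℝ n (linPullback b η) :=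
  (ContinuousAlternatingMap.compContinuousLinearMapCLM (𝕜 := ℝ) (F := ℝ) (ι := Fin m)
    (realCLM b)).contDiff.comp (h.comp (realCLM b).contDiff)

theorem isClosedEmbedding_linear {b : V k →ₗ[ℂ] V N} (hb : Function.Injective b) :
    Topology.IsClosedEmbedding b :=
  LinearMap.isClosedEmbedding_of_injective (LinearMap.ker_eq_bot.2 hb)

theorem tsupport_linPullback_subset (b : V k →ₗ[ℂ] V N) (η : V N → V N [⋀^Fin m]→L[ℝ] ℝ) :
    tsupport (linPullback b η) ⊆ b ⁻¹' tsupport η := by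
  refine closure_minimal (fun y hy => subset_tsupport _ fun h0 => hy ?_)
    ((isClosed_tsupport η).preimage (realCLM b).continuous)
  rw [linPullback, h0]
  rfl

theorem hasCompactSupport_linPullback {b : V k →ₗ[ℂ] V N} (hb : Function.Injective b)
    {η : V N → V N [⋀^Fin m]→L[ℝ] ℝ} (h : HasCompactSupport η) :
    HasCompactSupport (linPullback b η) :=
  ((isClosedEmbedding_linear hb).isCompact_preimage h.isCompact).of_isClosed_subset
    (isClosed_tsupport _) (tsupport_linPullback_subset b η)

theorem IsTestForm.linPullback {b : V k →ₗ[ℂ] V N} (hb : Function.Injective b)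
    {η : V N → V N [⋀^Fin m]→L[ℝ] ℝ} (h : IsTestForm η) : IsTestForm (linPullback b η) :=
  ⟨ContDiff.linPullback b h.1, hasCompactSupport_linPullback hb h.2.1, fun h0 => h.2.2 (by
    simpa using tsupport_linPullback_subset b η h0)⟩

theorem ddc_linPullback (b : V k →ₗ[ℂ] V N) {η : V N → V N [⋀^Fin m]→L[ℝ] ℝ}
    (h : ContDiff ℝ 2 η) : ddc (linPullback b η) = linPullback b (ddc η) := by
  funext y
  rw [linPullback_eq, linPullback_eq]
  refine ddc_pullback (realCLM b).contDiff (fun x c v => ?_) h.contDiffAt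
  rw [(realCLM b).fderiv, realCLM_smul]

theorem extDeriv_linPullback (b : V k →ₗ[ℂ] V N) {η : V N → V N [⋀^Fin m]→L[ℝ] ℝ} {y : V k}
    (h : DifferentiableAt ℝ η (b y)) :
    extDeriv (linPullback b η) y = linPullback b (extDeriv η) y := by
  rw [linPullback_eq, linPullback_eq]
  exact extDeriv_pullback_of_contDiff (realCLM b).contDiff h

theorem ne_zero_of_injective {b : V k →ₗ[ℂ] V N} (hb : Function.Injective b) {x : V k}
    (hx : x ≠ 0) : b x ≠ 0 := fun h => hx (hb (h.trans b.map_zero.symm))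

/-- The restriction of a form on projective space to a linear subspace. -/
def projPullback {b : V k →ₗ[ℂ] V N} (hb : Function.Injective b) (ω : ProjForm N m) :
    ProjForm k m :=
  ⟨linPullback b ω.1, by
    refine ⟨?_, ?_, fun c x v hc hx => ?_, fun x v hx hv => ?_⟩
    · rw [linPullback, b.map_zero, ω.2.1]
      rfl
    · exact (ContinuousAlternatingMap.compContinuousLinearMapCLM (𝕜 := ℝ) (F := ℝ) (ι := Fin m)
        (realCLM b)).contDiff.comp_contDiffOn (ω.2.2.1.comp (realCLM b).contDiff.contDiffOn
          fun x hx => ne_zero_of_injective hb hx)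
    · simp only [linPullback_apply, map_smul]
      exact ω.2.2.2.1 c (b x) _ hc (ne_zero_of_injective hb hx)
    · obtain ⟨j, c, hj⟩ := hv
      refine ω.2.2.2.2 (b x) _ (ne_zero_of_injective hb hx) ⟨j, c, ?_⟩
      simp [hj]⟩

/-- Complex linearity of `b` makes it compatible with the parametrization `t ↦ t x` of the fibres
and with the frames along them. -/
theorem isFibreIntegral_projPullback {b : V k →ₗ[ℂ] V N} (hb : Function.Injective b)
    {η : V N → V N [⋀^Fin (m + 1 + 1)]→L[ℝ] ℝ} {ω : ProjForm N m} (h : IsFibreIntegral η ω) :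
    IsFibreIntegral (linPullback b η) (projPullback hb ω) := by
  intro x v hx
  refine (h (b x) (fun j => b (v j)) (ne_zero_of_injective hb hx)).trans
    (integral_congr_ae (Filter.Eventually.of_forall fun t => ?_))
  simp only [linPullback_apply, map_smul]
  congr 1
  funext j
  refine Fin.cases ?_ (fun j => Fin.cases ?_ (fun j => ?_) j) j <;> simp

end LinearChange

/-! ### Poincaré–Lelong for an arbitrary hyperplane -/

section Hyperplane

variable {n m : ℕ}

/-- The linear map `z ↦ z₀ a + b(z₁, …)`. -/
def hyperplaneMap (a : V (n + 1)) (b : V n →ₗ[ℂ] V (n + 1)) : V (n + 1) →ₗ[ℂ] V (n + 1) :=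
  (LinearMap.proj (0 : Fin (n + 2)) : V (n + 1) →ₗ[ℂ] ℂ).smulRight a +
    b ∘ₗ LinearMap.funLeft ℂ ℂ Fin.succ

theorem hyperplaneMap_cons (a : V (n + 1)) (b : V n →ₗ[ℂ] V (n + 1)) (t : ℂ) (y : V n) :
    hyperplaneMap a b (Fin.cons t y) = t • a + b y := rfl

/-- As `b` takes values in `ker s` and `s a = 1`, the map provides linear coordinates in which `s`
is the first coordinate. This reduces Poincaré–Lelong for `s` to the coordinate case. -/
theorem apply_hyperplaneMap {a : V (n + 1)} {b : V n →ₗ[ℂ] V (n + 1)}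
    {s : Module.Dual ℂ (V (n + 1))} (ha : s a = 1) (hb : LinearMap.range b = LinearMap.ker s)
    (z : V (n + 1)) : s (hyperplaneMap a b z) = z 0 := by
  have h1 : s (b fun i => z i.succ) = 0 :=
    LinearMap.mem_ker.1 (hb ▸ LinearMap.mem_range_self b _)
  change s (z 0 • a + b fun i => z i.succ) = z 0
  rw [map_add, map_smul, ha, h1, smul_eq_mul, mul_one, add_zero]

theorem hyperplaneMap_injective {a : V (n + 1)} {b : V n →ₗ[ℂ] V (n + 1)}
    {s : Module.Dual ℂ (V (n + 1))} (ha : s a = 1) (hb : LinearMap.range b = LinearMap.ker s)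
    (hi : Function.Injective b) : Function.Injective (hyperplaneMap a b) := by
  refine (injective_iff_map_eq_zero _).2 fun z hz => ?_
  have h0 : z 0 = 0 := by rw [← apply_hyperplaneMap ha hb z, hz, map_zero]
  have h1 : b (fun i => z i.succ) = 0 := by
    have h2 : z 0 • a + b (fun i => z i.succ) = 0 := hz
    rwa [h0, zero_smul, zero_add] at h2
  have h2 : (fun i => z i.succ) = (0 : V n) := hi (h1.trans b.map_zero.symm)
  funext i
  exact Fin.cases h0 (fun i => congrFun h2 i) i

theorem exists_apply_eq_one {s : Module.Dual ℂ (V (n + 1))} (hs : s ≠ 0) : ∃ a, s a = 1 :=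
  LinearMap.surjective hs 1

theorem integrable_log_linearForm_mul_ddc (hm : m + 1 + 1 = 2 * (n + 2))
    {s : Module.Dual ℂ (V (n + 1))} (hs : s ≠ 0)
    {η : V (n + 1) → V (n + 1) [⋀^Fin m]→L[ℝ] ℝ} (hη : ContDiff ℝ 2 η)
    (hc : HasCompactSupport η) :
    Integrable fun x => Real.log (‖s x‖ ^ 2) * ddc η x (frame (n + 2) (m + 1 + 1)) := by
  obtain ⟨a, ha⟩ := exists_apply_eq_one hs
  obtain ⟨b, hi, hb⟩ := exists_divisorParam s hs
  have hA := hyperplaneMap_injective ha hb hi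
  refine (integrable_linear hm hA (fun x => Real.log (‖s x‖ ^ 2)) (ddc η)).2 ?_
  have hη' := ContDiff.linPullback (hyperplaneMap a b) hη
  have h := integrable_log_coord_mul (continuous_ddc_apply hη' (frame (n + 2) (m + 1 + 1)))
    ((hasCompactSupport_ddc (hasCompactSupport_linPullback hA hc)).comp_left
      (g := fun τ : V (n + 1) [⋀^Fin (m + 1 + 1)]→L[ℝ] ℝ => τ (frame (n + 2) (m + 1 + 1))) rfl)
  rw [ddc_linPullback _ hη] at h
  simpa only [apply_hyperplaneMap ha hb, linPullback_apply] using h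

/-- The Poincaré–Lelong formula for a hyperplane. -/
theorem integral_log_linearForm_mul_ddc (hm : m + 1 + 1 = 2 * (n + 2))
    {s : Module.Dual ℂ (V (n + 1))} (hs : s ≠ 0) {b : V n →ₗ[ℂ] V (n + 1)}
    (hi : Function.Injective b) (hb : LinearMap.range b = LinearMap.ker s)
    {η : V (n + 1) → V (n + 1) [⋀^Fin m]→L[ℝ] ℝ} (hη : ContDiff ℝ 2 η)
    (hc : HasCompactSupport η) :
    ∫ x, Real.log (‖s x‖ ^ 2) * ddc η x (frame (n + 2) (m + 1 + 1)) =
      ∫ y, linPullback b η y (frame (n + 1) m) := by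
  obtain ⟨a, ha⟩ := exists_apply_eq_one hs
  have hA := hyperplaneMap_injective ha hb hi
  rw [integral_linear hm hA (fun x => Real.log (‖s x‖ ^ 2)) (ddc η)]
  have h := integral_log_coord_mul_ddc (ContDiff.linPullback (hyperplaneMap a b) hη)
    (hasCompactSupport_linPullback hA hc)
  rw [ddc_linPullback _ hη] at h
  simpa only [apply_hyperplaneMap ha hb, linPullback_apply, hyperplaneMap_cons, zero_smul,
    zero_add] using h

theorem divisorParam_injective (s : Module.Dual ℂ (V (n + 1))) (hs : s ≠ 0) :
    Function.Injective (divisorParam s hs) := (exists_divisorParam s hs).choose_spec.1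

theorem range_divisorParam (s : Module.Dual ℂ (V (n + 1))) (hs : s ≠ 0) :
    LinearMap.range (divisorParam s hs) = LinearMap.ker s :=
  (exists_divisorParam s hs).choose_spec.2

theorem integrable_form_frame {N : ℕ} {η : V N → V N [⋀^Fin m]→L[ℝ] ℝ} (h : IsTestForm η)
    (v : Fin m → V N) : Integrable fun x => η x v :=
  (contDiff_apply_form h.1 v).continuous.integrable_of_hasCompactSupport
    (h.2.1.comp_left (g := fun τ : V N [⋀^Fin m]→L[ℝ] ℝ => τ v) rfl)

theorem integrable_chartCoeff {N : ℕ} (hm : m + 1 + 1 = 2 * (N + 1))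
    {τ : V N → V N [⋀^Fin (m + 1 + 1)]→L[ℝ] ℝ} {σ : V N → V N [⋀^Fin m]→L[ℝ] ℝ}
    (hs : IsProductFibreIntegral (blowupPullback τ) (chartPullback σ))
    (hi : Integrable fun x => τ x (frame (N + 1) (m + 1 + 1))) :
    Integrable fun z : Fin N → ℂ => chartCoeff LinearMap.id σ z := by
  simpa using integrable_chart hm (u := fun _ => 1) (fun _ _ _ _ => rfl) hs (by simpa using hi)

theorem integral_chartCoeff {N : ℕ} (hm : m + 1 + 1 = 2 * (N + 1))
    {τ : V N → V N [⋀^Fin (m + 1 + 1)]→L[ℝ] ℝ} {σ : V N → V N [⋀^Fin m]→L[ℝ] ℝ}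
    (hs : IsProductFibreIntegral (blowupPullback τ) (chartPullback σ))
    (hi : Integrable fun x => τ x (frame (N + 1) (m + 1 + 1))) :
    ∫ z : Fin N → ℂ, chartCoeff LinearMap.id σ z =
      ∫ x, τ x (frame (N + 1) (m + 1 + 1)) := by
  simpa using integral_chart hm (u := fun _ => 1) (fun _ _ _ _ => rfl) hs (by simpa using hi)

variable {η : V (n + 1) → V (n + 1) [⋀^Fin (m + 1 + 1)]→L[ℝ] ℝ} {ω : ProjForm (n + 1) m}

theorem integrable_chartCoeff_divisorParam (hm : m = 2 * n) (s : Module.Dual ℂ (V (n + 1)))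
    (hs : s ≠ 0) (hη : IsTestForm η) (h : IsFibreIntegral η ω) :
    Integrable (chartCoeff (divisorParam s hs) ω.1) := by
  have hi := divisorParam_injective s hs
  exact integrable_chartCoeff (by omega)
    (isProductFibreIntegral_blowup (isFibreIntegral_projPullback hi h))
    (integrable_form_frame (hη.linPullback hi) _)

/-- By Poincaré–Lelong the right side is the integral of `η` over `ker s`; fibre integration inside
`ker s` turns this into the integral of `ω` over `div(s)`. -/
theorem integral_chartCoeff_divisorParam (hm : m = 2 * n) (s : Module.Dual ℂ (V (n + 1)))
    (hs : s ≠ 0) (hη : IsTestForm η) (h : IsFibreIntegral η ω) :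
    ∫ z, chartCoeff (divisorParam s hs) ω.1 z =
      ∫ x, Real.log (‖s x‖ ^ 2) * ddc η x (frame (n + 2) (m + 1 + 1 + 1 + 1)) := by
  have hi := divisorParam_injective s hs
  rw [integral_log_linearForm_mul_ddc (by omega) hs hi (range_divisorParam s hs)
    (contDiff_infty.1 hη.1 2) hη.2.1]
  exact integral_chartCoeff (by omega)
    (isProductFibreIntegral_blowup (isFibreIntegral_projPullback hi h))
    (integrable_form_frame (hη.linPullback hi) _)

end Hyperplane

/-! ### The Green function and the admissible metrics -/

section Dynamics

variable {N : ℕ}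

theorem euclNorm_sq (x : V N) : euclNorm x ^ 2 = ∑ i, ‖x i‖ ^ 2 :=
  Real.sq_sqrt (Finset.sum_nonneg fun _ _ => by positivity)

theorem euclNorm_smul (c : ℂ) (x : V N) : euclNorm (c • x) = ‖c‖ * euclNorm x := by
  rw [euclNorm, euclNorm]
  simp only [Pi.smul_apply, smul_eq_mul, norm_mul, mul_pow]
  rw [← Finset.mul_sum, Real.sqrt_mul (sq_nonneg _), Real.sqrt_sq (norm_nonneg _)]

theorem continuous_euclNorm : Continuous (euclNorm : V N → ℝ) := by
  unfold euclNorm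
  fun_prop

theorem BundleMetric.norm_zero (h : BundleMetric N) (p : PN N) : h.norm p 0 = 0 := by
  simpa using h.norm_smul p 0 0

theorem exists_smul_eq_of_ne_zero {p : PN N} {y : p.submodule} (hy : y ≠ 0) (w : p.submodule) :
    ∃ c : ℂ, w = c • y := by
  obtain ⟨a, ha⟩ := exists_smul_repVec p y
  obtain ⟨b, hb⟩ := exists_smul_repVec p w
  have ha0 : a ≠ 0 := by
    rintro rfl
    exact hy (by rw [← ha, zero_smul])
  exact ⟨b * a⁻¹, by rw [← ha, smul_smul, mul_assoc, inv_mul_cancel₀ ha0, mul_one, hb]⟩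

theorem fibre_apply_ne_zero {p : PN N} {v : Fibre p} (hv : v ≠ 0) {y : p.submodule} (hy : y ≠ 0) :
    v y ≠ 0 := by
  intro h
  refine hv (LinearMap.ext fun w => ?_)
  obtain ⟨c, rfl⟩ := exists_smul_eq_of_ne_zero hy w
  simp [h]

theorem repVec_ne_zero (p : PN N) : repVec p ≠ 0 := fun h =>
  p.rep_nonzero (congrArg Subtype.val h)

theorem fubiniStudy_norm {p : PN N} (v : Fibre p) {y : p.submodule} (hy : y ≠ 0) :
    (fubiniStudy N).norm p v = ‖v y‖ / euclNorm (y : V N) := by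
  obtain ⟨c, rfl⟩ := exists_smul_repVec p y
  have hc : ‖c‖ ≠ 0 := fun h => hy (by rw [norm_eq_zero.1 h, zero_smul])
  change ‖v (repVec p)‖ / euclNorm p.rep = ‖v (c • repVec p)‖ / euclNorm (c • p.rep)
  rw [map_smul, smul_eq_mul, norm_mul, euclNorm_smul, mul_div_mul_left _ _ hc]

theorem PolarizedMap.fibreMap_ne_zero (f : PolarizedMap N) {p : PN N} {v : Fibre p}
    (hv : v ≠ 0) : f.fibreMap p v ≠ 0 := by
  intro h
  have h1 := f.fibreMap_apply p v (repVec p)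
  rw [h] at h1
  exact pow_ne_zero f.deg (fibre_apply_ne_zero hv (repVec_ne_zero p)) h1.symm

/-- The vector `x` as an element of the line it spans. -/
def spanVec (x : V N) (hx : x ≠ 0) : (Projectivization.mk ℂ x hx).submodule :=
  ⟨x, Submodule.mem_span_singleton_self x⟩

theorem spanVec_ne_zero {x : V N} (hx : x ≠ 0) : spanVec x hx ≠ 0 := fun h =>
  hx (congrArg Subtype.val h)

theorem PolarizedMap.continuous_lift (f : PolarizedMap N) : Continuous f.lift :=
  continuous_pi fun k => MvPolynomial.continuous_eval (f.poly k)

theorem PolarizedMap.deg_pos (f : PolarizedMap N) : (0 : ℝ) < f.deg := by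
  exact_mod_cast (two_pos.trans_le f.two_le_deg)

/-- Evaluate the supremum defining `c̄` at the linear form with value 1 at `x`: its norm is `1/|x|`,
and that of its image under `fibreMap` is `1/|F(x)|`. -/
theorem abs_log_lift_sub_le (f : PolarizedMap N) {x : V N} (hx : x ≠ 0) (hc : cBar f < ⊤) :
    |1 / (f.deg : ℝ) * Real.log (euclNorm (f.lift x)) - Real.log (euclNorm x)| ≤
      (cBar f).toReal := by
  set p : PN N := Projectivization.mk ℂ x hx
  set v : Fibre p := (LinearEquiv.coord ℂ (V N) x hx).toLinearMap
  have hvx : v (spanVec x hx) = 1 := LinearEquiv.coord_self ℂ (V N) x hx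
  have hv : v ≠ 0 := by
    rintro h
    rw [h] at hvx
    exact zero_ne_one hvx
  have h1 : ENNReal.ofReal _ ≤ cBar f :=
    le_iSup_of_le p (le_iSup_of_le v (le_iSup_of_le hv le_rfl))
  rw [ENNReal.ofReal_le_iff_le_toReal hc.ne] at h1
  have hy : (⟨f.lift (spanVec x hx), f.lift_mem p (spanVec x hx)⟩ : (f.map p).submodule) ≠ 0 :=
    fun h => f.lift_ne_zero hx (congrArg Subtype.val h)
  rw [fubiniStudy_norm v (spanVec_ne_zero hx), fubiniStudy_norm _ hy, f.fibreMap_apply, hvx] at h1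
  have e : Real.log ((‖(1 : ℂ) ^ f.deg‖ / euclNorm (f.lift x)) ^ (1 / (f.deg : ℝ)) /
      (‖(1 : ℂ)‖ / euclNorm x)) =
      -(1 / (f.deg : ℝ) * Real.log (euclNorm (f.lift x)) - Real.log (euclNorm x)) := by
    have a1 := euclNorm_pos hx
    have a2 := euclNorm_pos (f.lift_ne_zero hx)
    rw [one_pow, norm_one, Real.log_div (by positivity) (by positivity),
      Real.log_rpow (by positivity), Real.log_div one_ne_zero a2.ne',
      Real.log_div one_ne_zero a1.ne', Real.log_one]
    ring
  have h2 : |Real.log ((‖(1 : ℂ) ^ f.deg‖ / euclNorm (f.lift x)) ^ (1 / (f.deg : ℝ)) /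
      (‖(1 : ℂ)‖ / euclNorm x))| ≤ (cBar f).toReal := h1
  rwa [e, abs_neg] at h2

theorem iterLift_ne_zero (f : ℕ → PolarizedMap N) {x : V N} (hx : x ≠ 0) :
    ∀ l, iterLift f l x ≠ 0
  | 0 => hx
  | l + 1 => (f l).lift_ne_zero (iterLift_ne_zero f hx l)

theorem continuous_iterLift (f : ℕ → PolarizedMap N) : ∀ l, Continuous (iterLift f l)
  | 0 => continuous_id
  | l + 1 => (f l).continuous_lift.comp (continuous_iterLift f l)

/-- The degree `d_1 ⋯ d_l` of `F^l ∘ ⋯ ∘ F^1`. -/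
def iterDeg (f : ℕ → PolarizedMap N) (l : ℕ) : ℕ := ∏ i ∈ Finset.range l, (f i).deg

theorem iterDeg_succ (f : ℕ → PolarizedMap N) (l : ℕ) :
    iterDeg f (l + 1) = iterDeg f l * (f l).deg := Finset.prod_range_succ _ _

theorem two_pow_le_iterDeg (f : ℕ → PolarizedMap N) (l : ℕ) : 2 ^ l ≤ iterDeg f l := by
  induction l with
  | zero => simp [iterDeg]
  | succ l ih =>
    rw [iterDeg_succ, pow_succ]
    exact Nat.mul_le_mul ih (f l).two_le_deg

theorem iterDeg_pos (f : ℕ → PolarizedMap N) (l : ℕ) : (0 : ℝ) < iterDeg f l := by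
  exact_mod_cast (Nat.two_pow_pos l).trans_le (two_pow_le_iterDeg f l)

theorem greenApprox_eq (f : ℕ → PolarizedMap N) (l : ℕ) (x : V N) :
    greenApprox f l x = 1 / (iterDeg f l : ℝ) * Real.log (euclNorm (iterLift f l x) ^ 2) := rfl

theorem iterLift_smul (f : ℕ → PolarizedMap N) (c : ℂ) (x : V N) (l : ℕ) :
    iterLift f l (c • x) = c ^ iterDeg f l • iterLift f l x := by
  induction l with
  | zero => simp [iterLift, iterDeg]
  | succ l ih => rw [iterLift, ih, PolarizedMap.lift_smul, ← pow_mul, iterDeg_succ]; rfl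

theorem greenApprox_smul (f : ℕ → PolarizedMap N) {c : ℂ} (hc : c ≠ 0) {x : V N} (hx : x ≠ 0)
    (l : ℕ) : greenApprox f l (c • x) = greenApprox f l x + Real.log (‖c‖ ^ 2) := by
  have h1 := euclNorm_pos (iterLift_ne_zero f hx l)
  have h2 : 0 < ‖c‖ := norm_pos_iff.2 hc
  have h3 := iterDeg_pos f l
  rw [greenApprox_eq, greenApprox_eq, iterLift_smul, euclNorm_smul, norm_pow, mul_pow,
    Real.log_mul (by positivity) (by positivity), ← pow_mul, mul_comm (iterDeg f l) 2, pow_mul,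
    Real.log_pow]
  field_simp
  ring

theorem iterLift_succ' (f : ℕ → PolarizedMap N) (l : ℕ) (x : V N) :
    iterLift f (l + 1) x = iterLift (fun i => f (i + 1)) l ((f 0).lift x) := by
  induction l with
  | zero => rfl
  | succ l ih => rw [iterLift, ih]; rfl

theorem greenApprox_succ' (f : ℕ → PolarizedMap N) (l : ℕ) (x : V N) :
    greenApprox f (l + 1) x =
      1 / ((f 0).deg : ℝ) * greenApprox (fun i => f (i + 1)) l ((f 0).lift x) := by
  have h : iterDeg f (l + 1) = iterDeg (fun i => f (i + 1)) l * (f 0).deg :=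
    Finset.prod_range_succ' _ _
  rw [greenApprox_eq, greenApprox_eq, iterLift_succ', h, Nat.cast_mul, ← mul_assoc,
    one_div_mul_one_div, mul_comm ((f 0).deg : ℝ)]

theorem continuousOn_greenApprox (f : ℕ → PolarizedMap N) (l : ℕ) :
    ContinuousOn (greenApprox f l) {0}ᶜ := by
  refine ContinuousOn.mul continuousOn_const (ContinuousOn.log ?_ fun x hx => ?_)
  · exact ((continuous_euclNorm.comp (continuous_iterLift f l)).pow 2).continuousOn
  · exact (pow_pos (euclNorm_pos (iterLift_ne_zero f hx l)) 2).ne'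

variable {f : ℕ → PolarizedMap N}

theorem cBar_le (f : ℕ → PolarizedMap N) (l : ℕ) : cBar (f l) ≤ cBarSeq f :=
  le_iSup (fun i => cBar (f i)) l

/-- The increment is `2 / (d_1 ⋯ d_l)` times the quantity of `abs_log_lift_sub_le` at `F^l ∘ ⋯ ∘ F^1
(x)`, and `d_1 ⋯ d_l ≥ 2^l`. The bound `2 c̄ / 2^l` is written as `4 c̄ / 2 / 2^l` to display the
sum `4 c̄` of the geometric series. -/
theorem dist_greenApprox_succ_le (hf : cBarSeq f < ⊤) {x : V N} (hx : x ≠ 0) (l : ℕ) :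
    dist (greenApprox f l x) (greenApprox f (l + 1) x) ≤ 4 * (cBarSeq f).toReal / 2 / 2 ^ l := by
  have hy := iterLift_ne_zero f hx l
  have h1 := abs_log_lift_sub_le (f l) hy ((cBar_le f l).trans_lt hf)
  have h2 : (cBar (f l)).toReal ≤ (cBarSeq f).toReal := ENNReal.toReal_mono hf.ne (cBar_le f l)
  have hd := (f l).deg_pos
  have hD := iterDeg_pos f l
  have hD2 : (2 : ℝ) ^ l ≤ iterDeg f l := by exact_mod_cast two_pow_le_iterDeg f l
  have e : greenApprox f (l + 1) x - greenApprox f l x = 2 / (iterDeg f l : ℝ) *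
      (1 / ((f l).deg : ℝ) * Real.log (euclNorm ((f l).lift (iterLift f l x))) -
        Real.log (euclNorm (iterLift f l x))) := by
    rw [greenApprox_eq, greenApprox_eq, iterDeg_succ, Nat.cast_mul, iterLift, Real.log_pow,
      Real.log_pow]
    push_cast
    field_simp
  rw [dist_comm, Real.dist_eq, e, abs_mul, abs_of_pos (by positivity)]
  calc 2 / (iterDeg f l : ℝ) * _ ≤ 2 / (iterDeg f l : ℝ) * (cBarSeq f).toReal :=
        mul_le_mul_of_nonneg_left (h1.trans h2) (by positivity)
    _ ≤ 2 / 2 ^ l * (cBarSeq f).toReal := by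
        refine mul_le_mul_of_nonneg_right ?_ ENNReal.toReal_nonneg
        gcongr
    _ = _ := by ring

theorem tendsto_greenApprox (hf : cBarSeq f < ⊤) {x : V N} (hx : x ≠ 0) :
    Tendsto (fun l => greenApprox f l x) atTop (nhds (greenFunction f x)) :=
  (cauchySeq_of_le_geometric_two (dist_greenApprox_succ_le hf hx)).tendsto_limUnder

theorem dist_greenApprox_le (hf : cBarSeq f < ⊤) {x : V N} (hx : x ≠ 0) (l : ℕ) :
    dist (greenApprox f l x) (greenFunction f x) ≤ 4 * (cBarSeq f).toReal / 2 ^ l :=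
  dist_le_of_le_geometric_two_of_tendsto (dist_greenApprox_succ_le hf hx)
    (tendsto_greenApprox hf hx) l

theorem tendsto_const_div_two_pow (c : ℝ) :
    Tendsto (fun l : ℕ => c / 2 ^ l) atTop (nhds 0) := by
  have h := (tendsto_pow_atTop_nhds_zero_of_lt_one (r := (1 / 2 : ℝ)) (by norm_num)
    (by norm_num)).const_mul c
  simpa [div_eq_mul_inv] using h

theorem tendstoUniformlyOn_greenApprox (hf : cBarSeq f < ⊤) :
    TendstoUniformlyOn (greenApprox f) (greenFunction f) atTop {0}ᶜ := by
  refine Metric.tendstoUniformlyOn_iff.2 fun ε hε => ?_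
  have h := tendsto_const_div_two_pow (4 * (cBarSeq f).toReal)
  filter_upwards [h.eventually_lt_const hε] with l hl x hx
  rw [dist_comm]
  exact (dist_greenApprox_le hf hx l).trans_lt hl

theorem continuousOn_greenFunction (hf : cBarSeq f < ⊤) :
    ContinuousOn (greenFunction f) {0}ᶜ :=
  (tendstoUniformlyOn_greenApprox hf).continuousOn
    (Filter.Eventually.of_forall (continuousOn_greenApprox f)).frequently

theorem greenFunction_smul (hf : cBarSeq f < ⊤) {c : ℂ} (hc : c ≠ 0) {x : V N} (hx : x ≠ 0) :
    greenFunction f (c • x) = greenFunction f x + Real.log (‖c‖ ^ 2) := by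
  refine tendsto_nhds_unique (tendsto_greenApprox hf (smul_ne_zero hc hx)) ?_
  simp only [greenApprox_smul f hc hx]
  exact (tendsto_greenApprox hf hx).add_const _

theorem cBarSeq_shift_le (f : ℕ → PolarizedMap N) : cBarSeq (fun i => f (i + 1)) ≤ cBarSeq f :=
  iSup_le fun i => cBar_le f (i + 1)

/-- Limit of `greenApprox_succ'`, where the first map of the sequence is split off. This equation
becomes the shift relation of the metrics. -/
theorem greenFunction_lift (hf : cBarSeq f < ⊤) {x : V N} (hx : x ≠ 0) :
    greenFunction (fun i => f (i + 1)) ((f 0).lift x) = (f 0).deg * greenFunction f x := by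
  have h1 := tendsto_greenApprox ((cBarSeq_shift_le f).trans_lt hf) ((f 0).lift_ne_zero hx)
  have h2 := ((tendsto_greenApprox hf hx).comp (tendsto_add_atTop_nat 1)).const_mul
    ((f 0).deg : ℝ)
  refine tendsto_nhds_unique h1 (h2.congr fun l => ?_)
  have := (f 0).deg_pos
  rw [Function.comp_apply, greenApprox_succ']
  field_simp

theorem abs_greenFunction_sub_le (hf : cBarSeq f < ⊤) {x : V N} (hx : x ≠ 0) :
    |greenFunction f x / 2 - Real.log (euclNorm x)| ≤ 2 * (cBarSeq f).toReal := by
  -- The approximation with index 0 is `log |x|²`; half of the total error `4 c̄` is the constant `2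
  -- c̄` required of admissible metrics.
  have h := dist_greenApprox_le hf hx 0
  have e : greenApprox f 0 x = 2 * Real.log (euclNorm x) := by
    simp [greenApprox, iterLift, Real.log_pow]
  rw [dist_comm, Real.dist_eq, e, pow_zero, div_one] at h
  have e2 : greenFunction f x / 2 - Real.log (euclNorm x) =
      (greenFunction f x - 2 * Real.log (euclNorm x)) / 2 := by ring
  rw [e2, abs_div, abs_of_pos (two_pos : (0 : ℝ) < 2)]
  linarith

/-- The metric on `O(1)` given by the Green function. -/
def greenMetric (f : ℕ → PolarizedMap N) : BundleMetric N where
  norm p v := ‖v (repVec p)‖ * Real.exp (-(greenFunction f p.rep / 2))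
  norm_smul p c v := by simp [mul_assoc]
  norm_pos p v hv := mul_pos (norm_pos_iff.2 (fibre_apply_ne_zero hv (repVec_ne_zero p)))
    (Real.exp_pos _)

/-- Replacing `y` by `c y` multiplies `|v(y)|` by `|c|` and adds `log |c|²` to the Green function;
the two effects cancel. -/
theorem greenMetric_norm (hf : cBarSeq f < ⊤) {p : PN N} (v : Fibre p) {y : p.submodule}
    (hy : y ≠ 0) :
    (greenMetric f).norm p v = ‖v y‖ * Real.exp (-(greenFunction f (y : V N) / 2)) := by
  obtain ⟨c, rfl⟩ := exists_smul_repVec p y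
  have hc : c ≠ 0 := fun h => hy (by rw [h, zero_smul])
  have hc' : 0 < ‖c‖ := norm_pos_iff.2 hc
  change _ = ‖v (c • repVec p)‖ * Real.exp (-(greenFunction f (c • p.rep) / 2))
  rw [map_smul, smul_eq_mul, norm_mul, greenFunction_smul hf hc p.rep_nonzero, Real.log_pow]
  have e : -((greenFunction f p.rep + (2 : ℕ) * Real.log ‖c‖) / 2) =
      -(greenFunction f p.rep / 2) - Real.log ‖c‖ := by push_cast; ring
  rw [e, Real.exp_sub, Real.exp_log hc']
  change ‖v (repVec p)‖ * _ = _
  field_simp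

theorem greenMetric_sectionAt (hf : cBarSeq f < ⊤) (s : Module.Dual ℂ (V N)) {x : V N}
    (hx : x ≠ 0) :
    (greenMetric f).norm (Projectivization.mk ℂ x hx) (sectionAt s (Projectivization.mk ℂ x hx)) =
      ‖s x‖ * Real.exp (-(greenFunction f x / 2)) :=
  greenMetric_norm hf _ (spanVec_ne_zero hx)

theorem isContinuous_greenMetric (hf : cBarSeq f < ⊤) : (greenMetric f).IsContinuous := by
  intro s
  have h : Continuous fun x : {x : V N // x ≠ 0} =>
      ‖s x‖ * Real.exp (-(greenFunction f x / 2)) := by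
    have h1 : Continuous fun x : {x : V N // x ≠ 0} => greenFunction f x :=
      continuousOn_iff_continuous_domRestrict.1 (continuousOn_greenFunction hf)
    have h2 : Continuous s := s.continuous_of_finiteDimensional
    exact (h2.comp continuous_subtype_val).norm.mul
      (Real.continuous_exp.comp (h1.div_const 2).neg)
  exact h.congr fun x => (greenMetric_sectionAt hf s x.2).symm

theorem isAdmissibleFamily_greenMetric :
    IsAdmissibleFamily fun f : BddSeq N => greenMetric f.1 := by
  intro f
  refine ⟨isContinuous_greenMetric f.2, fun p v hv => ?_, fun p v => ?_⟩
  · have hy := repVec_ne_zero p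
    have h0 : 0 < ‖v (repVec p)‖ := norm_pos_iff.2 (fibre_apply_ne_zero hv hy)
    have h1 := euclNorm_pos p.rep_nonzero
    have h2 := abs_greenFunction_sub_le f.2 p.rep_nonzero
    have e : Real.log ((greenMetric f.1).norm p v / (fubiniStudy N).norm p v) =
        -(greenFunction f.1 p.rep / 2 - Real.log (euclNorm p.rep)) := by
      change Real.log (‖v (repVec p)‖ * Real.exp (-(greenFunction f.1 p.rep / 2)) /
        (‖v (repVec p)‖ / euclNorm p.rep)) = _
      have e' : ‖v (repVec p)‖ * Real.exp (-(greenFunction f.1 p.rep / 2)) /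
          (‖v (repVec p)‖ / euclNorm p.rep) =
          Real.exp (-(greenFunction f.1 p.rep / 2)) * euclNorm p.rep := by
        field_simp
      rw [e', Real.log_mul (Real.exp_pos _).ne' h1.ne', Real.log_exp]
      ring
    rw [e, abs_neg]
    calc ENNReal.ofReal _ ≤ ENNReal.ofReal (2 * (cBarSeq f.1).toReal) :=
          ENNReal.ofReal_le_ofReal h2
      _ = 2 * cBarSeq f.1 := by
          rw [ENNReal.ofReal_mul two_pos.le, ENNReal.ofReal_toReal f.2.ne]
          simp
  · have hy : (⟨(f.1 0).lift (repVec p), (f.1 0).lift_mem p (repVec p)⟩ :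
        ((f.1 0).map p).submodule) ≠ 0 :=
      fun h => (f.1 0).lift_ne_zero p.rep_nonzero (congrArg Subtype.val h)
    change (greenMetric f.shift.1).norm _ _ = (greenMetric f.1).norm p v ^ (f.1 0).deg
    rw [greenMetric_norm f.shift.2 _ hy, PolarizedMap.fibreMap_apply,
      greenMetric_norm f.2 v (repVec_ne_zero p), mul_pow, norm_pow, ← Real.exp_nat_mul]
    congr 2
    have h := greenFunction_lift f.2 (p.rep_nonzero)
    change -(greenFunction (fun i => f.1 (i + 1)) ((f.1 0).lift p.rep) / 2) =
      (f.1 0).deg * -(greenFunction f.1 p.rep / 2)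
    rw [h]
    ring

/-- Both metrics are within `2 c̄` of the Fubini–Study metric, hence `4 c̄` at the start. The shift
relation expresses the logarithm of the quotient as `1/d` times that for the shifted sequence; since
`d ≥ 2` and `c̄` does not grow under the shift, the bound halves at each step. -/
theorem abs_log_norm_div_le {h h' : BddSeq N → BundleMetric N} (hh : IsAdmissibleFamily h)
    (hh' : IsAdmissibleFamily h') (l : ℕ) :
    ∀ (f : BddSeq N) (p : PN N) (v : Fibre p), v ≠ 0 →
      |Real.log ((h f).norm p v / (h' f).norm p v)| ≤ 4 * (cBarSeq f.1).toReal / 2 ^ l := by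
  induction l with
  | zero =>
    intro f p v hv
    have key : ∀ {g : BddSeq N → BundleMetric N}, IsAdmissibleFamily g →
        |Real.log ((g f).norm p v / (fubiniStudy N).norm p v)| ≤ 2 * (cBarSeq f.1).toReal := by
      intro g hg
      have h1 := (hg f).2.1 p v hv
      rw [ENNReal.ofReal_le_iff_le_toReal (ENNReal.mul_ne_top (by simp) f.2.ne),
        ENNReal.toReal_mul] at h1
      simpa using h1
    have h1 := abs_le.1 (key hh)
    have h2 := abs_le.1 (key hh')
    have p1 := (h f).norm_pos p v hv
    have p2 := (h' f).norm_pos p v hv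
    have p3 := (fubiniStudy N).norm_pos p v hv
    rw [Real.log_div p1.ne' p3.ne'] at h1
    rw [Real.log_div p2.ne' p3.ne'] at h2
    rw [Real.log_div p1.ne' p2.ne', pow_zero, div_one]
    exact abs_le.2 ⟨by linarith [h1.1, h2.2], by linarith [h1.2, h2.1]⟩
  | succ l ih =>
    intro f p v hv
    have h1 := ih f.shift ((f.1 0).map p) ((f.1 0).fibreMap p v) ((f.1 0).fibreMap_ne_zero hv)
    rw [(hh f).2.2, (hh' f).2.2, ← div_pow, Real.log_pow, abs_mul,
      abs_of_pos (f.1 0).deg_pos] at h1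
    have h2 : (2 : ℝ) ≤ (f.1 0).deg := by exact_mod_cast (f.1 0).two_le_deg
    have h3 : (cBarSeq f.shift.1).toReal ≤ (cBarSeq f.1).toReal :=
      ENNReal.toReal_mono f.2.ne (cBarSeq_shift_le f.1)
    have h4 : 2 * |Real.log ((h f).norm p v / (h' f).norm p v)| ≤
        4 * (cBarSeq f.1).toReal / 2 ^ l :=
      (mul_le_mul_of_nonneg_right h2 (abs_nonneg _)).trans (h1.trans (by gcongr))
    rw [pow_succ, ← div_div]
    linarith

theorem IsAdmissibleFamily.eq {h h' : BddSeq N → BundleMetric N} (hh : IsAdmissibleFamily h)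
    (hh' : IsAdmissibleFamily h') : h = h' := by
  funext f
  refine BundleMetric.ext (funext fun p => funext fun v => ?_)
  by_cases hv : v = 0
  · rw [hv, BundleMetric.norm_zero, BundleMetric.norm_zero]
  have p1 := (h f).norm_pos p v hv
  have p2 := (h' f).norm_pos p v hv
  have lim := tendsto_const_div_two_pow (4 * (cBarSeq f.1).toReal)
  have h1 : |Real.log ((h f).norm p v / (h' f).norm p v)| ≤ 0 :=
    ge_of_tendsto' lim fun l => abs_log_norm_div_le hh hh' l f p v hv
  have h2 : Real.log ((h f).norm p v / (h' f).norm p v) = 0 := abs_nonpos_iff.1 h1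
  rw [Real.log_div p1.ne' p2.ne'] at h2
  exact Real.log_injOn_pos p1 p2 (sub_eq_zero.1 h2)

end Dynamics

/-! ### The Green function integrated against `dd^c η`, and the Chern current -/

section ChernFormula

variable {n m : ℕ} {f : ℕ → PolarizedMap (n + 1)}
  {η : V (n + 1) → V (n + 1) [⋀^Fin (m + 1 + 1)]→L[ℝ] ℝ} {ω : ProjForm (n + 1) m}

/-- Green functions are controlled only away from the origin, where test forms are supported. -/
theorem continuous_mul_of_zero_notMem_tsupport {N : ℕ} {u g : V N → ℝ}
    (hu : ContinuousOn u {0}ᶜ) (hg : Continuous g) (h0 : (0 : V N) ∉ tsupport g) :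
    Continuous fun x => u x * g x := by
  refine (hu.mul hg.continuousOn).continuous_of_tsupport_subset isOpen_compl_singleton
    fun x hx h => h0 ?_
  have hx0 : x = 0 := h
  exact hx0 ▸ tsupport_mul_subset_right hx

theorem integrable_mul_of_zero_notMem_tsupport {N : ℕ} {u g : V N → ℝ}
    (hu : ContinuousOn u {0}ᶜ) (hg : Continuous g) (hc : HasCompactSupport g)
    (h0 : (0 : V N) ∉ tsupport g) : Integrable fun x => u x * g x :=
  (continuous_mul_of_zero_notMem_tsupport hu hg h0).integrable_of_hasCompactSupport hc.mul_left

theorem tsupport_form_apply_subset {N k : ℕ} (τ : V N → V N [⋀^Fin k]→L[ℝ] ℝ)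
    (v : Fin k → V N) : tsupport (fun x => τ x v) ⊆ tsupport τ :=
  closure_mono fun x hx h => hx (by simp [h])

theorem IsTestForm.tsupport_ddc {N k : ℕ} {η : V N → V N [⋀^Fin k]→L[ℝ] ℝ} (hη : IsTestForm η)
    (v : Fin (k + 1 + 1) → V N) : (0 : V N) ∉ tsupport fun x => ddc η x v := fun h =>
  hη.2.2 (tsupport_ddc_subset (tsupport_form_apply_subset _ v h))

theorem IsTestForm.hasCompactSupport_ddc {N k : ℕ} {η : V N → V N [⋀^Fin k]→L[ℝ] ℝ}
    (hη : IsTestForm η) (v : Fin (k + 1 + 1) → V N) :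
    HasCompactSupport fun x => ddc η x v :=
  (RandomDyn.hasCompactSupport_ddc hη.2.1).comp_left
    (g := fun τ : V N [⋀^Fin (k + 1 + 1)]→L[ℝ] ℝ => τ v) rfl

theorem IsTestForm.continuous_ddc {N k : ℕ} {η : V N → V N [⋀^Fin k]→L[ℝ] ℝ}
    (hη : IsTestForm η) (v : Fin (k + 1 + 1) → V N) : Continuous fun x => ddc η x v :=
  continuous_ddc_apply (contDiff_infty.1 hη.1 2) v

theorem IsTestForm.integrable_mul_ddc {N k : ℕ} {η : V N → V N [⋀^Fin k]→L[ℝ] ℝ}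
    (hη : IsTestForm η) {u : V N → ℝ} (hu : ContinuousOn u {0}ᶜ) (v : Fin (k + 1 + 1) → V N) :
    Integrable fun x => u x * ddc η x v :=
  integrable_mul_of_zero_notMem_tsupport hu (hη.continuous_ddc v) (hη.hasCompactSupport_ddc v)
    (hη.tsupport_ddc v)

/-- The function `-log ‖s‖²` on the cone, with value `0` on the divisor of `s`. -/
def negLogSection (f : ℕ → PolarizedMap (n + 1)) (s : Module.Dual ℂ (V (n + 1)))
    (x : V (n + 1)) : ℝ :=
  if s x = 0 then 0 else greenFunction f x - Real.log (‖s x‖ ^ 2)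

theorem negLogSection_smul (hf : cBarSeq f < ⊤) (s : Module.Dual ℂ (V (n + 1))) (c : ℂ)
    (x : V (n + 1)) (hc : c ≠ 0) (hx : x ≠ 0) :
    negLogSection f s (c • x) = negLogSection f s x := by
  simp only [negLogSection, map_smul, smul_eq_mul, mul_eq_zero, hc, false_or]
  split_ifs with h
  · rfl
  · have h1 : ‖c‖ ≠ 0 := norm_ne_zero_iff.2 hc
    have h2 : ‖s x‖ ≠ 0 := norm_ne_zero_iff.2 h
    rw [greenFunction_smul hf hc hx, norm_mul, mul_pow,
      Real.log_mul (pow_ne_zero _ h1) (pow_ne_zero _ h2)]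
    ring

theorem neg_log_greenMetric (hf : cBarSeq f < ⊤) (s : Module.Dual ℂ (V (n + 1)))
    {x : V (n + 1)} (hx : x ≠ 0) :
    -Real.log ((greenMetric f).norm (Projectivization.mk ℂ x hx)
      (sectionAt s (Projectivization.mk ℂ x hx)) ^ 2) = negLogSection f s x := by
  rw [greenMetric_sectionAt hf s hx, negLogSection]
  split_ifs with h
  -- On the divisor the left side is `-log 0`, which is `0` by the convention for `Real.log`; this
  -- fixes the value of `negLogSection` there.
  · simp [h]
  · have h2 : ‖s x‖ ≠ 0 := norm_ne_zero_iff.2 h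
    rw [mul_pow, Real.log_mul (pow_ne_zero _ h2) (by positivity), ← Real.exp_nat_mul,
      Real.log_exp]
    push_cast
    ring

theorem negLogSection_mul_ae_eq (f : ℕ → PolarizedMap (n + 1)) {s : Module.Dual ℂ (V (n + 1))}
    (hs : s ≠ 0) (g : V (n + 1) → ℝ) :
    (fun x => greenFunction f x * g x - Real.log (‖s x‖ ^ 2) * g x) =ᵐ[volume]
      fun x => negLogSection f s x * g x := by
  filter_upwards [measure_eq_zero_iff_ae_notMem.1 (volume_linearForm_eq_zero s hs)] with x hx
  have hx' : s x ≠ 0 := hx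
  rw [negLogSection, if_neg hx', sub_mul]

theorem integrable_negLogSection_mul_ddc (hm : m = 2 * n) (hf : cBarSeq f < ⊤)
    {s : Module.Dual ℂ (V (n + 1))} (hs : s ≠ 0) (hη : IsTestForm η) :
    Integrable fun x => negLogSection f s x * ddc η x (frame (n + 2) (m + 1 + 1 + 1 + 1)) :=
  ((hη.integrable_mul_ddc (continuousOn_greenFunction hf) _).sub
    (integrable_log_linearForm_mul_ddc (by omega) hs (contDiff_infty.1 hη.1 2) hη.2.1)).congr
      (negLogSection_mul_ae_eq f hs _)

theorem integrable_negLogSection_chart (hm : m = 2 * n) (hf : cBarSeq f < ⊤)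
    {s : Module.Dual ℂ (V (n + 1))} (hs : s ≠ 0) (hη : IsTestForm η)
    (h : IsFibreIntegral η ω) :
    Integrable fun z : Fin (n + 1) → ℂ =>
      negLogSection f s (Fin.cons 1 z) * chartCoeff LinearMap.id (ddc ω.1) z :=
  integrable_chart (by omega) (negLogSection_smul hf s) (isProductFibreIntegral_ddc hη h)
    (integrable_negLogSection_mul_ddc hm hf hs hη)

/-- The integral of `G dd^c η` depends only on the fibre integral of `η`. -/
theorem integral_greenFunction_mul_ddc (hm : m = 2 * n) (hf : cBarSeq f < ⊤)
    {s : Module.Dual ℂ (V (n + 1))} (hs : s ≠ 0) (hη : IsTestForm η)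
    (h : IsFibreIntegral η ω) :
    ∫ x, greenFunction f x * ddc η x (frame (n + 2) (m + 1 + 1 + 1 + 1)) =
      (∫ z : Fin (n + 1) → ℂ,
        negLogSection f s (Fin.cons 1 z) * chartCoeff LinearMap.id (ddc ω.1) z) +
      ∫ z, chartCoeff (divisorParam s hs) ω.1 z := by
  -- Almost everywhere `G = -log ‖s‖² + log |s|²`. The first summand is constant on fibres and
  -- descends to the chart; the second gives the divisor term.
  rw [integral_chart (by omega) (negLogSection_smul hf s) (isProductFibreIntegral_ddc hη h)
    (integrable_negLogSection_mul_ddc hm hf hs hη),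
    integral_chartCoeff_divisorParam hm s hs hη h,
    ← integral_congr_ae (negLogSection_mul_ae_eq f hs _),
    integral_sub (hη.integrable_mul_ddc (continuousOn_greenFunction hf) _)
      (integrable_log_linearForm_mul_ddc (by omega) hs (contDiff_infty.1 hη.1 2) hη.2.1),
    sub_add_cancel]

end ChernFormula

/-! ### Every form on projective space is a fibre integral -/

section HorizontalLift

open scoped ComplexConjugate

variable {N m : ℕ}

/-- The linear form `v ↦ ⟨x, v⟩`. -/
def hermForm (x : V N) : V N →L[ℂ] ℂ :=
  ∑ i, conj (x i) • ContinuousLinearMap.proj (R := ℂ) (φ := fun _ : Fin (N + 1) => ℂ) i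

theorem hermForm_apply (x v : V N) : hermForm x v = ∑ i, conj (x i) * v i := by
  simp [hermForm]

/-- The square of the Euclidean norm. -/
def sqNorm (x : V N) : ℝ := ∑ i, ‖x i‖ ^ 2

theorem sqNorm_smul (c : ℂ) (x : V N) : sqNorm (c • x) = ‖c‖ ^ 2 * sqNorm x := by
  simp [sqNorm, mul_pow, Finset.mul_sum]

theorem sqNorm_pos {x : V N} (hx : x ≠ 0) : 0 < sqNorm x := by
  have := euclNorm_pos hx
  rw [sqNorm, ← euclNorm_sq]
  positivity

theorem hermForm_smul_self (c d : ℂ) (x : V N) :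
    hermForm (c • x) (d • x) = conj c * d * (sqNorm x : ℝ) := by
  rw [hermForm_apply, sqNorm, Complex.ofReal_sum, Finset.mul_sum]
  refine Finset.sum_congr rfl fun i _ => ?_
  have : conj (x i) * x i = ((‖x i‖ ^ 2 : ℝ) : ℂ) := by
    rw [mul_comm, Complex.mul_conj, Complex.normSq_eq_norm_sq]
  simp only [Pi.smul_apply, smul_eq_mul, map_mul]
  rw [← this]
  ring

theorem contDiff_sqNorm {k : WithTop ℕ∞} : ContDiff ℝ k (sqNorm : V N → ℝ) :=
  ContDiff.sum fun i _ => (contDiff_apply ℝ ℂ i).norm_sq ℝ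

theorem contDiff_reTensorIm_hermForm {k : WithTop ℕ∞} :
    ContDiff ℝ k fun x : V N => reTensorIm (hermForm x) := by
  have h : ∀ v : V N, ContDiff ℝ k fun x : V N => hermForm x v := by
    intro v
    simp only [hermForm_apply]
    exact ContDiff.sum fun i _ =>
      (Complex.conjCLE.contDiff.comp (contDiff_apply ℝ ℂ i)).mul contDiff_const
  refine contDiff_clm_apply_iff.2 fun v => contDiff_clm_apply_iff.2 fun w => ?_
  exact (Complex.reCLM.contDiff.comp (h v)).mul (Complex.imCLM.contDiff.comp (h w))

/-- A bump function around `1`. -/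
def annulusBump : ContDiffBump (1 : ℝ) := ⟨1 / 4, 1 / 2, by norm_num, by norm_num⟩

theorem annulusBump_eq_zero {r : ℝ} (hr : r ∉ Set.Icc (1 / 2 : ℝ) 2) : annulusBump r = 0 := by
  refine annulusBump.zero_of_le_dist ?_
  change 1 / 2 ≤ dist r 1
  rw [Real.dist_eq]
  by_contra h
  push Not at h
  have := abs_lt.1 h
  exact hr ⟨by linarith [this.1], by linarith [this.2]⟩

/-- The total mass that normalizes the bump function. -/
def annulusMass : ℝ := ∫ t : ℂ, annulusBump (‖t‖ ^ 2) * ‖t‖ ^ 2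

theorem annulusMass_pos : 0 < annulusMass := by
  refine Continuous.integral_pos_of_hasCompactSupport_nonneg_nonzero (x := (1 : ℂ)) ?_ ?_ ?_ ?_
  · exact (annulusBump.continuous.comp (by fun_prop)).mul (by fun_prop)
  · refine HasCompactSupport.intro (isCompact_closedBall (0 : ℂ) 2) fun t ht => ?_
    have ht' : 2 < ‖t‖ := by simpa using ht
    rw [annulusBump_eq_zero fun h => ?_, zero_mul]
    nlinarith [h.2]
  · exact fun t => mul_nonneg annulusBump.nonneg (by positivity)
  · have : annulusBump (1 : ℝ) = 1 := annulusBump.one_of_mem_closedBall (by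
      simp [annulusBump])
    simp [this]

/-- The normalized `(1,1)`-form, compactly supported in the fibre direction, whose product with the
pullback of a form on projective space has that form as fibre integral. -/
def fibreForm (x : V N) : V N →L[ℝ] V N →L[ℝ] ℝ :=
  (annulusMass⁻¹ * annulusBump (sqNorm x)) • reTensorIm (hermForm x)

theorem contDiff_fibreForm {k : ℕ} : ContDiff ℝ k (fibreForm : V N → _) := by
  refine contDiff_clm_apply_iff.2 fun v => contDiff_clm_apply_iff.2 fun w => ?_
  exact (contDiff_const.mul (annulusBump.contDiff.comp contDiff_sqNorm)).mul
    (contDiff_clm_apply_iff.1 (contDiff_clm_apply_iff.1 contDiff_reTensorIm_hermForm v) w)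

theorem fibreForm_eq_zero {x : V N} (hx : sqNorm x ∉ Set.Icc (1 / 2 : ℝ) 2) :
    fibreForm x = 0 := by
  ext v w
  change annulusMass⁻¹ * annulusBump (sqNorm x) * _ = 0
  rw [annulusBump_eq_zero hx, mul_zero, zero_mul]

theorem isCompact_annulus : IsCompact {x : V N | sqNorm x ∈ Set.Icc (1 / 2 : ℝ) 2} := by
  refine Metric.isCompact_of_isClosed_isBounded
    (isClosed_Icc.preimage (contDiff_sqNorm (k := 0)).continuous) ?_
  refine (Metric.isBounded_closedBall (x := (0 : V N)) (r := 2)).subset fun x hx => ?_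
  rw [mem_closedBall_zero_iff, pi_norm_le_iff_of_nonneg two_pos.le]
  intro i
  have h1 : ‖x i‖ ^ 2 ≤ sqNorm x :=
    Finset.single_le_sum (f := fun i => ‖x i‖ ^ 2) (fun _ _ => by positivity) (Finset.mem_univ i)
  have h2 : sqNorm x ≤ 2 := hx.2
  nlinarith [norm_nonneg (x i)]

theorem tsupport_fibreForm_subset :
    tsupport (fibreForm : V N → _) ⊆ {x | sqNorm x ∈ Set.Icc (1 / 2 : ℝ) 2} :=
  closure_minimal (fun _ hx => by_contra fun h => hx (fibreForm_eq_zero h))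
    (isCompact_annulus).isClosed

theorem zero_notMem_annulus : (0 : V N) ∉ {x : V N | sqNorm x ∈ Set.Icc (1 / 2 : ℝ) 2} := by
  intro h
  have h1 : (1 / 2 : ℝ) ≤ sqNorm (0 : V N) := h.1
  simp [sqNorm] at h1
  linarith

/-- A form with compact support on the cone, with fibre integral `ω`. -/
def coneLift (ω : V N → V N [⋀^Fin m]→L[ℝ] ℝ) (x : V N) : V N [⋀^Fin (m + 1 + 1)]→L[ℝ] ℝ :=
  wedge (fibreForm x) (ω x)

theorem tsupport_coneLift_subset (ω : V N → V N [⋀^Fin m]→L[ℝ] ℝ) :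
    tsupport (coneLift ω) ⊆ tsupport (fibreForm : V N → _) := by
  refine closure_mono fun x hx h => hx ?_
  rw [coneLift, h, ← wedgeL_apply, map_zero]
  rfl

/-- Forms on projective space are smooth only away from the origin of the cone, but the bump
function confines the product to `1/2 ≤ |x|² ≤ 2`. -/
theorem isTestForm_coneLift (ω : ProjForm N m) : IsTestForm (coneLift ω.1) := by
  have hs := (tsupport_coneLift_subset ω.1).trans tsupport_fibreForm_subset
  refine ⟨contDiff_infty.2 fun k => contDiff_iff_contDiffAt.2 fun x => ?_,
    isCompact_annulus.of_isClosed_subset (isClosed_tsupport _) hs,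
    fun h => zero_notMem_annulus (hs h)⟩
  by_cases hx : x ∈ tsupport (coneLift ω.1)
  swap
  · exact contDiffAt_const.congr_of_eventuallyEq (notMem_tsupport_iff_eventuallyEq.1 hx)
  have hx0 : x ≠ 0 := fun h => zero_notMem_annulus (h ▸ hs hx)
  exact (contDiffAt_clm_comp (wedgeL (V N) m) contDiff_fibreForm.contDiffAt).clm_apply
    (contDiffAt_of_mem_projForm hx0)

/-- As `τ` vanishes once `x` or `y` is among its arguments, only the term in which `b` absorbs both
of them survives. -/
theorem wedge_horizontal (b : V N →L[ℝ] V N →L[ℝ] ℝ) (τ : V N [⋀^Fin m]→L[ℝ] ℝ) (x y : V N)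
    (u : Fin m → V N) (hx : ∀ v, (∃ j, v j = x) → τ v = 0) (hy : ∀ v, (∃ j, v j = y) → τ v = 0) :
    wedge b τ (Fin.cons x (Fin.cons y u : Fin (m + 1) → V N)) = (b x y - b y x) * τ u := by
  rw [wedge_apply, Finset.sum_eq_single 0, Finset.sum_eq_single 0]
  · have e : ((0 : Fin (m + 1)).removeNth <| (Fin.castSucc (0 : Fin (m + 1))).removeNth
        (Fin.cons x (Fin.cons y u : Fin (m + 1) → V N) : Fin (m + 1 + 1) → V N)) = u := by
      funext j
      simp [Fin.removeNth]
    rw [e]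
    simp
  · intro j _ hj
    obtain ⟨j, rfl⟩ := Fin.exists_succ_eq.2 hj
    rw [hy _ ?_, mul_zero, mul_zero]
    obtain _ | m := m
    · exact j.elim0
    · exact ⟨0, by simp [Fin.removeNth]⟩
  · simp
  · intro i _ hi
    refine Finset.sum_eq_zero fun j hj => ?_
    have hij : i ≤ j := by simpa using hj
    rw [hx _ ?_, mul_zero, mul_zero]
    obtain _ | m := m
    · exact absurd (Fin.fin_one_eq_zero i) hi
    · obtain ⟨i, rfl⟩ := Fin.exists_succ_eq.2 hi
      obtain ⟨j, rfl⟩ := Fin.exists_succ_eq.2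
        (Fin.pos_iff_ne_zero.1 ((Fin.succ_pos i).trans_le hij))
      exact ⟨0, by simp [Fin.removeNth]⟩
  · simp

/-- The vectors `x` and `i x` are multiples of `t x`, so the horizontal form `ω` kills them, while
its invariance removes `t` from the other arguments. The antisymmetrized Hermitian form on `x, i x`
equals `|t|² |x|⁴`. -/
theorem coneLift_apply (ω : ProjForm N m) {x : V N} (hx : x ≠ 0) (v : Fin m → V N) {t : ℂ}
    (ht : t ≠ 0) :
    coneLift ω.1 (t • x)
      (Fin.cons x (Fin.cons (Complex.I • x) (fun j => t • v j) : Fin (m + 1) → V N)) =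
      annulusMass⁻¹ * (annulusBump (‖t‖ ^ 2 * sqNorm x) * (‖t‖ ^ 2 * sqNorm x)) *
        sqNorm x * ω.1 x v := by
  have htx : t • x ≠ 0 := smul_ne_zero ht hx
  have h1 : ∀ c : ℂ, c • x = (c * t⁻¹) • (t • x) := fun c => by
    rw [smul_smul, inv_mul_cancel_right₀ ht]
  rw [coneLift, wedge_horizontal, ω.2.2.2.1 t x v ht hx]
  · rw [← mul_assoc]
    congr 1
    have e : ∀ a b, fibreForm (t • x) a b = annulusMass⁻¹ * annulusBump (‖t‖ ^ 2 * sqNorm x) *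
        ((hermForm (t • x) a).re * (hermForm (t • x) b).im) := by
      intro a b
      rw [← sqNorm_smul]
      rfl
    have e1 := hermForm_smul_self t 1 x
    have e2 := hermForm_smul_self t Complex.I x
    rw [one_smul] at e1
    rw [e, e, e1, e2, ← Complex.normSq_eq_norm_sq, Complex.normSq_apply]
    simp
    ring
  · rintro w ⟨j, hj⟩
    exact ω.2.2.2.2 _ w htx ⟨j, 1 * t⁻¹, by rw [hj, ← h1, one_smul]⟩
  · rintro w ⟨j, hj⟩
    exact ω.2.2.2.2 _ w htx ⟨j, Complex.I * t⁻¹, by rw [hj, ← h1]⟩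

/-- The substitution `t ↦ √r t` has Jacobian `r`. For `r = |x|²` the factor `r⁻¹` cancels the last
factor `|x|²` in `coneLift_apply`, so one normalization serves all fibres. -/
theorem integral_annulusBump {r : ℝ} (hr : 0 < r) :
    ∫ t : ℂ, annulusBump (‖t‖ ^ 2 * r) * (‖t‖ ^ 2 * r) = r⁻¹ * annulusMass := by
  have h := Measure.integral_comp_smul (volume : Measure ℂ)
    (fun t : ℂ => annulusBump (‖t‖ ^ 2) * ‖t‖ ^ 2) (Real.sqrt r)
  rw [Complex.finrank_real_complex, Real.sq_sqrt hr.le, abs_of_pos (by positivity),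
    smul_eq_mul] at h
  rw [annulusMass, ← h]
  refine integral_congr_ae (Filter.Eventually.of_forall fun t => ?_)
  simp only [norm_smul, Real.norm_eq_abs, mul_pow, sq_abs, Real.sq_sqrt hr.le]
  rw [mul_comm r]

theorem isFibreIntegral_coneLift (ω : ProjForm N m) : IsFibreIntegral (coneLift ω.1) ω := by
  intro x v hx
  have hr := sqNorm_pos hx
  have h0 : ∀ᵐ t : ℂ, t ≠ 0 := by simp [ae_iff]
  rw [integral_congr_ae (g := fun t : ℂ => annulusMass⁻¹ *
    (annulusBump (‖t‖ ^ 2 * sqNorm x) * (‖t‖ ^ 2 * sqNorm x)) * sqNorm x * ω.1 x v) (by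
      filter_upwards [h0] with t ht
      exact coneLift_apply ω hx v ht),
    integral_mul_const, integral_mul_const, integral_const_mul, integral_annulusBump hr]
  have := annulusMass_pos.ne'
  field_simp

end HorizontalLift

/-! ### Linearity of `dd^c` and of the lift to the cone -/

section Linearity

variable {N m : ℕ}

theorem dc_add {η η' : V N → V N [⋀^Fin m]→L[ℝ] ℝ} (h : Differentiable ℝ η)
    (h' : Differentiable ℝ η') : dc (η + η') = dc η + dc η' := by
  funext x
  have d : ∀ {σ : V N → V N [⋀^Fin m]→L[ℝ] ℝ}, Differentiable ℝ σ → DifferentiableAt ℝ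
      (fun y => (σ y).compContinuousLinearMap (mulBy N Complex.I)) x := fun hσ =>
    (hasFDerivAt_clm_comp (ContinuousAlternatingMap.compContinuousLinearMapCLM (𝕜 := ℝ) (F := ℝ)
      (ι := Fin m) (mulBy N Complex.I)) (hσ x).hasFDerivAt).differentiableAt
  have e := extDeriv_fun_add (d h) (d h')
  ext v
  change 1 / (4 * Real.pi) * extDeriv _ x _ = 1 / (4 * Real.pi) * extDeriv _ x _ +
    1 / (4 * Real.pi) * extDeriv _ x _
  rw [← mul_add]
  congr 1
  exact congrArg (fun τ : V N [⋀^Fin (m + 1)]→L[ℝ] ℝ => τ fun j => mulBy N (-Complex.I) (v j)) e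

theorem ddc_add {η η' : V N → V N [⋀^Fin m]→L[ℝ] ℝ} (h : ContDiff ℝ 2 η)
    (h' : ContDiff ℝ 2 η') (x : V N) : ddc (η + η') x = ddc η x + ddc η' x := by
  have h1 : ContDiff ℝ 1 (dc η) := contDiff_dc h le_rfl
  have h2 : ContDiff ℝ 1 (dc η') := contDiff_dc h' le_rfl
  rw [ddc, dc_add (h.differentiable two_ne_zero) (h'.differentiable two_ne_zero),
    extDeriv_add (h1.differentiable one_ne_zero x) (h2.differentiable one_ne_zero x)]
  rfl

theorem dc_smul (c : ℝ) (η : V N → V N [⋀^Fin m]→L[ℝ] ℝ) : dc (c • η) = c • dc η := by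
  funext x
  have e := extDeriv_smul (x := x) c fun y => (η y).compContinuousLinearMap (mulBy N Complex.I)
  ext v
  change 1 / (4 * Real.pi) * extDeriv _ x _ = c * (1 / (4 * Real.pi) * extDeriv _ x _)
  rw [mul_left_comm]
  congr 1
  exact congrArg (fun τ : V N [⋀^Fin (m + 1)]→L[ℝ] ℝ => τ fun j => mulBy N (-Complex.I) (v j)) e

theorem ddc_smul (c : ℝ) (η : V N → V N [⋀^Fin m]→L[ℝ] ℝ) (x : V N) :
    ddc (c • η) x = c • ddc η x := by
  rw [ddc, dc_smul, extDeriv_smul]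
  rfl

theorem coneLift_add (ω ω' : V N → V N [⋀^Fin m]→L[ℝ] ℝ) :
    coneLift (ω + ω') = coneLift ω + coneLift ω' := by
  funext x
  exact wedge_add_right _ _ _

theorem coneLift_smul (c : ℝ) (ω : V N → V N [⋀^Fin m]→L[ℝ] ℝ) :
    coneLift (c • ω) = c • coneLift ω := by
  funext x
  exact wedge_smul_right _ _ _

end Linearity

/-! ### Seminorm estimates for the lift to the cone -/

section SeminormEstimates

set_option maxSynthPendingDepth 5

variable {N m : ℕ}

theorem norm_antisymm₂_le {E : Type*} [NormedAddCommGroup E] [NormedSpace ℝ E]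
    (S : E →L[ℝ] E →L[ℝ] E [⋀^Fin m]→L[ℝ] ℝ) :
    ‖antisymm₂ S‖ ≤ ((m + 1 : ℕ) + 1) * (m + 1) * ‖S‖ := by
  rw [antisymm₂]
  refine (ContinuousAlternatingMap.norm_alternatizeUncurryFin_le _).trans ?_
  rw [mul_assoc]
  refine mul_le_mul_of_nonneg_left ?_ (by positivity)
  refine ContinuousLinearMap.opNorm_le_bound _ (by positivity) fun v => ?_
  refine (ContinuousAlternatingMap.norm_alternatizeUncurryFin_le _).trans ?_
  rw [mul_assoc]
  exact mul_le_mul_of_nonneg_left (S.le_opNorm v) (by positivity)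

theorem exists_norm_ddc_le (N m : ℕ) : ∃ C : ℝ, 0 ≤ C ∧
    ∀ (η : V N → V N [⋀^Fin m]→L[ℝ] ℝ) (x : V N), ContDiffAt ℝ 2 η x →
      ‖ddc η x‖ ≤ C * ‖iteratedFDeriv ℝ 2 η x‖ := by
  let K := (ContinuousLinearMap.compL ℝ (V N) (V N) (V N [⋀^Fin m]→L[ℝ] ℝ)).flip
    (mulBy N (-Complex.I))
  refine ⟨‖1 / (4 * Real.pi)‖ * (((m + 1 : ℕ) + 1) * (m + 1) * ‖K‖), by positivity,
    fun η x h => ?_⟩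
  have e : ‖fderiv ℝ (fderiv ℝ η) x‖ = ‖iteratedFDeriv ℝ 2 η x‖ := by
    rw [← norm_iteratedFDeriv_one, norm_iteratedFDeriv_fderiv]
  rw [ddc_eq h, norm_smul, mul_assoc]
  refine mul_le_mul_of_nonneg_left ((norm_antisymm₂_le _).trans ?_) (norm_nonneg _)
  rw [mul_assoc _ ‖K‖, ← e]
  exact mul_le_mul_of_nonneg_left (K.opNorm_comp_le _) (by positivity)

/-- Invariance under `r` and multilinearity combine to homogeneity of degree `-m`. The normalization
`ω 0 = 0` extends this to the origin, so that it is an identity of functions on the whole cone. -/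
theorem projForm_apply_smul (ω : ProjForm N m) {r : ℝ} (hr : r ≠ 0) (x : V N) :
    ω.1 (r • x) = (r⁻¹) ^ m • ω.1 x := by
  by_cases hx : x = 0
  · rw [hx, smul_zero, ω.2.1, smul_zero]
  ext v
  have h := ω.2.2.2.1 (r : ℂ) x (fun j => r⁻¹ • v j) (by exact_mod_cast hr) hx
  have e1 : ∀ y : V N, (r : ℂ) • y = r • y := fun y => Complex.coe_smul r y
  simp only [e1, smul_smul, mul_inv_cancel₀ hr, one_smul] at h
  rw [h]
  have h2 := (ω.1 x).map_smul_univ (fun _ => r⁻¹) v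
  rw [h2]
  simp

/-- By homogeneity the `j`-th derivative scales with degree `-(m + j)`, so the unit sphere controls
it everywhere. -/
theorem norm_iteratedFDeriv_projForm_le (ω : ProjForm N m) {j : ℕ} {B : ℝ}
    (hB : ∀ x : V N, ‖x‖ = 1 → ‖iteratedFDeriv ℝ j ω.1 x‖ ≤ B) {x : V N} (hx : x ≠ 0) :
    ‖iteratedFDeriv ℝ j ω.1 x‖ ≤ (‖x‖⁻¹) ^ (m + j) * B := by
  have hr : 0 < ‖x‖⁻¹ := inv_pos.2 (norm_pos_iff.2 hx)
  set r := ‖x‖⁻¹ with hr_def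
  let g : V N ≃L[ℝ] V N := ContinuousLinearEquiv.smulLeft (Units.mk0 r hr.ne')
  have hg : ∀ y, g y = r • y := fun y => rfl
  have hgx : ‖g x‖ = 1 := by
    rw [hg, norm_smul, Real.norm_of_nonneg hr.le, hr_def,
      inv_mul_cancel₀ (norm_ne_zero_iff.2 hx)]
  have e : ω.1 = r ^ m • (ω.1 ∘ g) := by
    funext y
    change _ = r ^ m • ω.1 (g y)
    rw [hg, projForm_apply_smul ω hr.ne', smul_smul, ← mul_pow, mul_inv_cancel₀ hr.ne',
      one_pow, one_smul]
  have hd : ContDiffAt ℝ j (ω.1 ∘ g) x :=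
    (contDiffAt_of_mem_projForm (n := j) (by rw [← norm_ne_zero_iff, hgx]; exact one_ne_zero)).comp
      x
      g.contDiff.contDiffAt
  have hn : ‖(g : V N →L[ℝ] V N)‖ ≤ r :=
    ContinuousLinearMap.opNorm_le_bound _ hr.le fun y => by
      change ‖r • y‖ ≤ _
      rw [norm_smul, Real.norm_of_nonneg hr.le]
  have hcomp := g.iteratedFDerivWithin_comp_right ω.1 uniqueDiffOn_univ (Set.mem_univ (g x)) j
  rw [Set.preimage_univ, iteratedFDerivWithin_univ, iteratedFDerivWithin_univ] at hcomp
  rw [e, iteratedFDeriv_const_smul_apply hd, norm_smul, norm_pow, Real.norm_of_nonneg hr.le,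
    pow_add, mul_assoc, hcomp]
  refine mul_le_mul_of_nonneg_left ?_ (by positivity)
  refine (ContinuousMultilinearMap.norm_compContinuousLinearMap_le _ _).trans ?_
  rw [Finset.prod_const, Finset.card_univ, Fintype.card_fin, mul_comm]
  exact mul_le_mul (pow_le_pow_left₀ (norm_nonneg _) hn j) (hB _ hgx) (norm_nonneg _)
    (by positivity)

/-- A bound for the second derivative of `coneLift ω` in terms of those of `ω` on the sphere. -/
def coneLiftBound (N m : ℕ) (x : V N) : ℝ :=
  ‖wedgeL (V N) m‖ * ∑ i ∈ Finset.range 3, ((2).choose i : ℝ) *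
    ‖iteratedFDeriv ℝ i (fibreForm : V N → _) x‖ * (‖x‖⁻¹) ^ (m + (2 - i))

theorem norm_iteratedFDeriv_coneLift_le (ω : ProjForm N m) {B : ℝ}
    (hB : ∀ j ≤ 2, ∀ x : V N, ‖x‖ = 1 → ‖iteratedFDeriv ℝ j ω.1 x‖ ≤ B) {x : V N} (hx : x ≠ 0) :
    ‖iteratedFDeriv ℝ 2 (coneLift ω.1) x‖ ≤ coneLiftBound N m x * B := by
  have hs : IsOpen ({0}ᶜ : Set (V N)) := isOpen_compl_singleton
  have h := (wedgeL (V N) m).norm_iteratedFDerivWithin_le_of_bilinear (s := {0}ᶜ) (x := x)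
    (N := (2 : ℕ)) (n := 2) (contDiff_fibreForm (N := N) (k := 2)).contDiffOn
    (contDiffOn_infty.1 ω.2.2.1 2) hs.uniqueDiffOn hx le_rfl
  simp only [iteratedFDerivWithin_of_isOpen _ hs hx] at h
  refine h.trans ?_
  rw [coneLiftBound, mul_assoc]
  refine mul_le_mul_of_nonneg_left ?_ (norm_nonneg _)
  rw [Finset.sum_mul]
  refine Finset.sum_le_sum fun i _ => ?_
  rw [mul_assoc _ _ B]
  exact mul_le_mul_of_nonneg_left (norm_iteratedFDeriv_projForm_le ω (hB _ (Nat.sub_le 2 i)) hx)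
    (by positivity)

theorem integrable_mul_coneLiftBound {u : V N → ℝ} (hu : ContinuousOn u {0}ᶜ) :
    Integrable fun x => u x * coneLiftBound N m x := by
  have e : (fun x => u x * coneLiftBound N m x) = fun x => ∑ i ∈ Finset.range 3,
      (u x * (‖wedgeL (V N) m‖ * ((2).choose i : ℝ)) * (‖x‖⁻¹) ^ (m + (2 - i))) *
        ‖iteratedFDeriv ℝ i (fibreForm : V N → _) x‖ := by
    funext x
    rw [coneLiftBound, Finset.mul_sum, Finset.mul_sum]
    exact Finset.sum_congr rfl fun i _ => by ring
  rw [e]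
  refine integrable_finsetSum _ fun i _ => ?_
  have hc : HasCompactSupport (fibreForm : V N → _) :=
    isCompact_annulus.of_isClosed_subset (isClosed_tsupport _) tsupport_fibreForm_subset
  refine integrable_mul_of_zero_notMem_tsupport ?_ ?_ ?_ ?_
  · refine (hu.mul continuousOn_const).mul (ContinuousOn.pow (ContinuousOn.inv₀
      continuous_norm.continuousOn fun x hx => ?_) _)
    exact norm_ne_zero_iff.2 hx
  · exact ((contDiff_fibreForm (k := i)).continuous_iteratedFDeriv le_rfl).norm
  · exact (hc.iteratedFDeriv (𝕜 := ℝ) i).norm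
  · intro h
    have hsub : tsupport (fun x : V N => ‖iteratedFDeriv ℝ i (fibreForm : V N → _) x‖) ⊆
        tsupport (iteratedFDeriv ℝ i (fibreForm : V N → _)) :=
      closure_mono fun x hx h0 => hx (by simp only [h0, norm_zero])
    exact zero_notMem_annulus (N := N) (tsupport_fibreForm_subset
      (tsupport_iteratedFDeriv_subset (𝕜 := ℝ) i (hsub h)))

end SeminormEstimates

/-! ### The Green current: continuity, bidegree and closedness -/

section GreenCurrent

variable {n m : ℕ} {f : ℕ → PolarizedMap (n + 1)}

/-- The Green current on the forms of degree `m`. -/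
def greenCurrent (hf : cBarSeq f < ⊤) (m : ℕ) : ProjForm (n + 1) m →ₗ[ℝ] ℝ where
  toFun ω := ∫ x, greenFunction f x * ddc (coneLift ω.1) x (frame (n + 2) (m + 1 + 1 + 1 + 1))
  map_add' ω ω' := by
    rw [← integral_add
      ((isTestForm_coneLift ω).integrable_mul_ddc (continuousOn_greenFunction hf) _)
      ((isTestForm_coneLift ω').integrable_mul_ddc (continuousOn_greenFunction hf) _)]
    refine integral_congr_ae (Filter.Eventually.of_forall fun x => ?_)
    have e := ddc_add (contDiff_infty.1 (isTestForm_coneLift ω).1 2)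
      (contDiff_infty.1 (isTestForm_coneLift ω').1 2) x
    rw [← coneLift_add] at e
    change greenFunction f x * ddc (coneLift (ω.1 + ω'.1)) x _ = _
    rw [e]
    exact mul_add _ _ _
  map_smul' c ω := by
    rw [RingHom.id_apply, smul_eq_mul, ← integral_const_mul]
    refine integral_congr_ae (Filter.Eventually.of_forall fun x => ?_)
    have e := ddc_smul c (coneLift ω.1) x
    rw [← coneLift_smul] at e
    change greenFunction f x * ddc (coneLift (c • ω.1)) x _ = _
    rw [e]
    exact mul_left_comm _ _ _

theorem coord_zero_ne_zero : (LinearMap.proj 0 : Module.Dual ℂ (V (n + 1))) ≠ 0 := fun h => by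
  simpa using congrArg (fun l => l (Pi.single 0 1)) h

theorem greenCurrent_eq_chern (hm : m = 2 * n) (hf : cBarSeq f < ⊤)
    {s : Module.Dual ℂ (V (n + 1))} (hs : s ≠ 0) (ω : ProjForm (n + 1) m) :
    greenCurrent hf m ω = (∫ z : Fin (n + 1) → ℂ,
        negLogSection f s (Fin.cons 1 z) * chartCoeff LinearMap.id (ddc ω.1) z) +
      ∫ z, chartCoeff (divisorParam s hs) ω.1 z :=
  integral_greenFunction_mul_ddc hm hf hs (isTestForm_coneLift ω) (isFibreIntegral_coneLift ω)

/-- Both sides equal the Chern expression for the section `x₀`, which involves only `ω`. Hence the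
choice of the lift is immaterial. -/
theorem greenCurrent_eq_integral (hm : m = 2 * n) (hf : cBarSeq f < ⊤)
    {η : V (n + 1) → V (n + 1) [⋀^Fin (m + 1 + 1)]→L[ℝ] ℝ} {ω : ProjForm (n + 1) m}
    (hη : IsTestForm η) (h : IsFibreIntegral η ω) :
    greenCurrent hf m ω =
      ∫ x, greenFunction f x * ddc η x (frame (n + 2) (m + 1 + 1 + 1 + 1)) := by
  rw [greenCurrent_eq_chern hm hf coord_zero_ne_zero,
    integral_greenFunction_mul_ddc hm hf coord_zero_ne_zero hη h]

theorem ae_ne_zero (N : ℕ) : ∀ᵐ x : V N, x ≠ 0 := by simp [ae_iff]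

theorem isCurrent_greenCurrent (hf : cBarSeq f < ⊤) : IsCurrent (greenCurrent hf m) := by
  obtain ⟨C, hC0, hC⟩ := exists_norm_ddc_le (n + 1) (m + 1 + 1)
  set w := frame (n + 2) (m + 1 + 1 + 1 + 1)
  set D : ℝ := ∏ i, ‖w i‖
  have hD : 0 ≤ D := Finset.prod_nonneg fun _ _ => norm_nonneg _
  have hi := integrable_mul_coneLiftBound (m := m) (continuousOn_greenFunction hf).abs
  -- Order two suffices, because `dd^c` takes two derivatives. The constant collects `|G|`
  -- integrated against `coneLiftBound`, the norm of `dd^c`, and the lengths of the frame vectors.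
  refine ⟨2, (∫ x, |greenFunction f x| * coneLiftBound (n + 1) m x) * (C * D), fun ω B hB => ?_⟩
  have h1 : ∀ᵐ x : V (n + 1), ‖greenFunction f x * ddc (coneLift ω.1) x w‖ ≤
      (|greenFunction f x| * coneLiftBound (n + 1) m x) * (C * D * B) := by
    filter_upwards [ae_ne_zero (n + 1)] with x hx
    rw [norm_mul, Real.norm_eq_abs, mul_assoc]
    refine mul_le_mul_of_nonneg_left ?_ (abs_nonneg _)
    calc ‖ddc (coneLift ω.1) x w‖ ≤ ‖ddc (coneLift ω.1) x‖ * D :=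
          (ddc (coneLift ω.1) x).le_opNorm w
      _ ≤ (C * (coneLiftBound (n + 1) m x * B)) * D := by
          refine mul_le_mul_of_nonneg_right ((hC _ x ?_).trans ?_) hD
          · exact (contDiff_infty.1 (isTestForm_coneLift ω).1 2).contDiffAt
          · exact mul_le_mul_of_nonneg_left (norm_iteratedFDeriv_coneLift_le ω hB hx) hC0
      _ = _ := by ring
  have h2 := norm_integral_le_of_norm_le (hi.mul_const (C * D * B)) h1
  rw [integral_mul_const] at h2
  rw [mul_assoc]
  exact h2

theorem det_mulBy {N : ℕ} {c : ℂ} (hc : ‖c‖ = 1) : (mulBy N c).det = 1 := by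
  have h : ((mulBy N c : V N →L[ℝ] V N) : V N →ₗ[ℝ] V N) =
      ((c • LinearMap.id : V N →ₗ[ℂ] V N).restrictScalars ℝ) := by
    ext; rfl
  rw [ContinuousLinearMap.det, h, LinearMap.det_restrictScalars, Algebra.norm_complex_apply,
    LinearMap.det_smul, LinearMap.det_id, mul_one, map_pow, Complex.normSq_eq_norm_sq, hc]
  simp

/-- Rotating all arguments of `coneLift ω` by `c` gives a test form with fibre integral `ω'`, since
the two fibre vectors contribute only `|c|² = 1`. The rotation commutes with `dd^c` and has
determinant 1 in top degree, so the integral does not change. -/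
theorem isBidegreeOneOne_greenCurrent (hm : m = 2 * n) (hf : cBarSeq f < ⊤) :
    IsBidegreeOneOne (greenCurrent hf m) := by
  intro c ω ω' hc h
  have hη := isTestForm_coneLift ω
  set η' : V (n + 1) → V (n + 1) [⋀^Fin (m + 1 + 1)]→L[ℝ] ℝ :=
    fun x => (coneLift ω.1 x).compContinuousLinearMap (mulBy (n + 1) c) with hη'
  have hsub : tsupport η' ⊆ tsupport (coneLift ω.1) := by
    refine closure_mono fun x hx h0 => hx ?_
    simp only [hη', h0]
    rfl
  have ht : IsTestForm η' := ⟨contDiff_comp_mulBy hη.1 c,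
    hη.2.1.isCompact.of_isClosed_subset (isClosed_tsupport _) hsub, fun h0 => hη.2.2 (hsub h0)⟩
  have hn : c.re ^ 2 + c.im ^ 2 = 1 := by
    have := Complex.sq_norm c
    rw [hc, Complex.normSq_apply] at this
    nlinarith
  have hfib : IsFibreIntegral η' ω' := by
    intro x v hx
    rw [h, isFibreIntegral_coneLift ω x _ hx]
    refine integral_congr_ae (Filter.Eventually.of_forall fun t => ?_)
    have e := form_rotate (coneLift ω.1 (t • x)) c.re c.im x (Complex.I • x)
      fun j => t • c • v j
    rw [hn, one_mul] at e
    refine e.symm.trans ?_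
    change _ = coneLift ω.1 (t • x) fun j => mulBy (n + 1) c _
    congr 1
    have hci : ∀ y : V (n + 1), c • y = c.re • y + c.im • Complex.I • y := fun y => by
      nth_rewrite 1 [← Complex.re_add_im c]
      rw [add_smul, mul_smul, Complex.coe_smul, Complex.coe_smul]
    funext j
    refine Fin.cases ?_ (fun j => Fin.cases ?_ (fun j => ?_) j) j
    · simp only [mulBy_apply, Fin.cons_zero]
      exact (hci x).symm
    · simp only [mulBy_apply, Fin.cons_zero, Fin.cons_succ]
      rw [hci, smul_smul Complex.I Complex.I, Complex.I_mul_I, neg_smul, one_smul, smul_neg,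
        ← sub_eq_add_neg]
    · simp only [mulBy_apply, Fin.cons_succ]
      exact smul_comm t c (v j)
  rw [greenCurrent_eq_integral hm hf ht hfib]
  refine integral_congr_ae (Filter.Eventually.of_forall fun x => ?_)
  have e1 := ddc_comp_mulBy (contDiff_infty.1 hη.1 2).contDiffAt (x := x) hc
  have e2 := topForm_comp (k := n + 2) (by omega) (ddc (coneLift ω.1) x) (mulBy (n + 1) c)
    (frame (n + 2) (m + 1 + 1 + 1 + 1))
  rw [det_mulBy hc, one_mul] at e2
  simp only [hη', e1]
  rw [← e2]
  rfl

theorem tsupport_extDeriv_subset {N : ℕ} (σ : V N → V N [⋀^Fin m]→L[ℝ] ℝ) :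
    tsupport (extDeriv σ) ⊆ tsupport σ := by
  refine closure_minimal (fun x hx => ?_) (isClosed_tsupport σ)
  by_contra h
  have h0 : σ =ᶠ[nhds x] 0 := notMem_tsupport_iff_eventuallyEq.1 h
  apply hx
  rw [h0.extDeriv.self_of_nhds, extDeriv, fderiv_zero]
  exact map_zero (ContinuousAlternatingMap.alternatizeUncurryFinCLM ℝ (V N) ℝ)

theorem IsTestForm.extDeriv {N : ℕ} {σ : V N → V N [⋀^Fin m]→L[ℝ] ℝ} (h : IsTestForm σ) :
    IsTestForm (extDeriv σ) :=
  ⟨contDiff_infty.2 fun k => contDiff_extDeriv (contDiff_infty.1 h.1 (k + 1)) le_rfl,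
    h.2.1.isCompact.of_isClosed_subset (isClosed_tsupport _) (tsupport_extDeriv_subset σ),
    fun h0 => h.2.2 (tsupport_extDeriv_subset σ h0)⟩

theorem ddc_congr_of_eventuallyEq {N : ℕ} {σ σ' : V N → V N [⋀^Fin m]→L[ℝ] ℝ} {x : V N}
    (h : σ =ᶠ[nhds x] σ') : ddc σ x = ddc σ' x := by
  have h1 : (fun y => (σ y).compContinuousLinearMap (mulBy N Complex.I)) =ᶠ[nhds x]
      fun y => (σ' y).compContinuousLinearMap (mulBy N Complex.I) := by
    filter_upwards [h] with y hy
    rw [hy]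
  have h2 : dc σ =ᶠ[nhds x] dc σ' := by
    filter_upwards [h1.extDeriv] with y hy
    rw [dc, dc, hy]
  exact h2.extDeriv.self_of_nhds

theorem integral_extDeriv_eq_zero {N : ℕ} {σ : V N → V N [⋀^Fin m]→L[ℝ] ℝ} (h : IsTestForm σ)
    (v : Fin (m + 1) → V N) : ∫ x, extDeriv σ x v = 0 := by
  have hd : ∀ w : Fin m → V N, ContDiff ℝ 2 fun x => σ x w := fun w =>
    contDiff_apply_form (contDiff_infty.1 h.1 2) w
  have hs : ∀ w : Fin m → V N, HasCompactSupport fun x => σ x w := fun w =>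
    h.2.1.comp_left (g := fun τ : V N [⋀^Fin m]→L[ℝ] ℝ => τ w) rfl
  simp only [extDeriv_apply (h.1.differentiable (by simp) _), zsmul_eq_mul]
  rw [integral_finsetSum]
  · refine Finset.sum_eq_zero fun i _ => ?_
    rw [integral_const_mul, integral_fderiv_eq_zero _ ((hd _).of_le one_le_two) (hs _), mul_zero]
  · intro i _
    refine Integrable.const_mul ?_ _
    exact Continuous.integrable_of_hasCompactSupport
      (((hd _).continuous_fderiv two_ne_zero).clm_apply continuous_const)
      (((hs _).fderiv ℝ).comp_left (g := fun l : V N →L[ℝ] ℝ => l (v i)) rfl)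

/-- Stokes' theorem on projective space. -/
theorem integral_chartCoeff_extDeriv_eq_zero (hm : m + 1 = 2 * n) (β : ProjForm n m) :
    ∫ z : Fin n → ℂ, chartCoeff LinearMap.id (extDeriv β.1) z = 0 := by
  have hη := isTestForm_coneLift β
  rw [integral_chartCoeff (by omega)
    (isProductFibreIntegral_extDeriv hη (isFibreIntegral_coneLift β))
    (integrable_form_frame hη.extDeriv _), integral_extDeriv_eq_zero hη]

theorem isClosedCurrent_greenCurrent (hm : m = 2 * n) (hf : cBarSeq f < ⊤) :
    IsClosedCurrent (greenCurrent hf m) := by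
  intro l hl β ω h
  subst hl
  have hω : ∀ x, x ≠ 0 → ω.1 x = extDeriv β.1 x := fun x hx => by
    ext v
    exact h x v hx
  have hs := coord_zero_ne_zero (n := n)
  have hi := divisorParam_injective _ hs
  rw [greenCurrent_eq_chern hm hf hs]
  have h1 : ∀ z : Fin (n + 1) → ℂ, chartCoeff LinearMap.id (ddc ω.1) z = 0 := by
    intro z
    have hz := cons_one_ne_zero z
    have e : ω.1 =ᶠ[nhds (Fin.cons 1 z)] extDeriv β.1 := by
      filter_upwards [isOpen_compl_singleton.mem_nhds hz] with x hx
      exact hω x hx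
    have e2 : ddc ω.1 (Fin.cons 1 z) = ddc (extDeriv β.1) (Fin.cons 1 z) :=
      ddc_congr_of_eventuallyEq e
    have e3 := ddc_extDeriv (contDiffAt_of_mem_projForm (ω := β) (n := 3) hz)
    change ddc ω.1 (Fin.cons 1 z) _ = 0
    rw [e2, e3]
    rfl
  have h2 : ∀ z : Fin n → ℂ, chartCoeff (divisorParam _ hs) ω.1 z =
      chartCoeff LinearMap.id (extDeriv (projPullback hi β).1) z := by
    intro z
    have hz := ne_zero_of_injective hi (cons_one_ne_zero z)
    have e := extDeriv_linPullback (divisorParam _ hs) (η := β.1) (y := Fin.cons 1 z)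
      ((contDiffAt_of_mem_projForm (n := 1) hz).differentiableAt (by simp))
    change ω.1 _ _ = extDeriv (linPullback (divisorParam _ hs) β.1) (Fin.cons 1 z) _
    rw [hω _ hz, e]
    rfl
  simp only [h1, h2, mul_zero, integral_zero, zero_add]
  exact integral_chartCoeff_extDeriv_eq_zero hm _

end GreenCurrent

section Positivity

variable {N M m : ℕ}

theorem wedge_sum_nonneg {q : ℕ} (hm : m = 2 * q) (hN : m + 1 + 1 ≤ 2 * (N + 1))
    {τ : V N [⋀^Fin m]→L[ℝ] ℝ} (hτ : NonnegOnFrames τ) (l : V N →L[ℂ] ℂ) :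
    0 ≤ wedge (reTensorIm l) τ (frame (N + 1) (m + 1 + 1)) := by
  have h : frame (N + 1) (m + 1 + 1) = complexFrame (m + 1 + 1) _ :=
    map_frame_eq_complexFrame hN (LinearMap.id : V N →ₗ[ℂ] V N)
  rw [h]
  exact hτ.wedge_reTensorIm hm l _

/-- `dd^c log ∑ |F_k|²` is a positive current. -/
theorem integral_log_sum_mul_ddc_nonneg {q : ℕ} (hm : m = 2 * q) (hN : m + 1 + 1 ≤ 2 * (N + 1))
    {F : Fin M → V N → ℂ} (hF : ∀ k, ContDiff ℂ 2 (F k)) (h0 : ∀ x, ∑ k, ‖F k x‖ ^ 2 ≠ 0)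
    {η : V N → V N [⋀^Fin m]→L[ℝ] ℝ} (hη : ContDiff ℝ 2 η) (hc : HasCompactSupport η)
    (hpos : ∀ x, NonnegOnFrames (η x)) :
    0 ≤ ∫ x, Real.log (∑ k, ‖F k x‖ ^ 2) * ddc η x (frame (N + 1) (m + 1 + 1)) := by
  rw [integral_log_sum_mul_ddc hF h0 hη hc]
  refine mul_nonneg (by positivity) (integral_nonneg fun x => mul_nonneg (by positivity) ?_)
  exact Finset.sum_nonneg fun k _ => Finset.sum_nonneg fun j _ =>
    wedge_sum_nonneg hm hN (hpos x) _

/-- The same if the `F_k` have a common zero at the origin only. -/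
theorem integral_log_sum_mul_ddc_nonneg_of_ne_zero {q : ℕ} (hm : m = 2 * q)
    (hN : m + 1 + 1 ≤ 2 * (N + 1)) {F : Fin M → V N → ℂ} (hF : ∀ k, ContDiff ℂ 2 (F k))
    (h0 : ∀ x, x ≠ 0 → ∑ k, ‖F k x‖ ^ 2 ≠ 0)
    {η : V N → V N [⋀^Fin m]→L[ℝ] ℝ} (hη : IsTestForm η) (hpos : ∀ x, NonnegOnFrames (η x)) :
    0 ≤ ∫ x, Real.log (∑ k, ‖F k x‖ ^ 2) * ddc η x (frame (N + 1) (m + 1 + 1)) := by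
  set g : V N → ℝ := fun x => ddc η x (frame (N + 1) (m + 1 + 1)) with hg
  set P : V N → ℝ := fun x => ∑ k, ‖F k x‖ ^ 2 with hP
  have hPc : Continuous P := continuous_finsetSum _ fun k _ => (hF k).continuous.norm.pow 2
  have hP0 : ∀ x, 0 ≤ P x := fun x => Finset.sum_nonneg fun k _ => by positivity
  set δ : ℕ → ℝ := fun k => 1 / ((k : ℝ) + 1) with hδdef
  have hδ : ∀ k, 0 < δ k := fun k => by positivity
  have hδ1 : ∀ k, δ k ≤ 1 := fun k => by
    rw [hδdef]
    exact (div_le_one (by positivity)).2 (by linarith [(Nat.cast_nonneg k : (0 : ℝ) ≤ k)])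
  have hδ0 : Tendsto δ atTop (nhds 0) := tendsto_one_div_add_atTop_nhds_zero_nat
  have key : ∀ k, 0 ≤ ∫ x, Real.log (P x + δ k ^ 2) * g x := by
    intro k
    have e : ∀ x, ∑ i, ‖(Fin.cons (fun _ => (δ k : ℂ)) F : Fin (M + 1) → V N → ℂ) i x‖ ^ 2 =
        P x + δ k ^ 2 := by
      intro x
      rw [Fin.sum_univ_succ, add_comm]
      simp [hP]
    have h := integral_log_sum_mul_ddc_nonneg hm hN
      (F := (Fin.cons (fun _ => (δ k : ℂ)) F : Fin (M + 1) → V N → ℂ))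
      (fun i => Fin.cases contDiff_const hF i) (fun x => by
        rw [e]
        have := hδ k
        have := hP0 x
        positivity) (contDiff_infty.1 hη.1 2) hη.2.1 hpos
    simpa only [e] using h
  have hlog : ContinuousOn (fun x => Real.log (P x)) {0}ᶜ :=
    hPc.continuousOn.log fun x hx => h0 x hx
  refine ge_of_tendsto' (x := atTop) (f := fun k => ∫ x, Real.log (P x + δ k ^ 2) * g x) ?_ key
  have i1 : Integrable fun x => |Real.log (P x)| * |g x| := by
    simpa only [norm_mul, Real.norm_eq_abs] using
      (hη.integrable_mul_ddc hlog (frame (N + 1) (m + 1 + 1))).norm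
  have i2 : Integrable fun x => Real.log (P x + 1) * |g x| := by
    have h1 : ContinuousOn (fun x => Real.log (P x + 1)) {0}ᶜ :=
      (hPc.add continuous_const).continuousOn.log fun x _ =>
        (add_pos_of_nonneg_of_pos (hP0 x) one_pos).ne'
    have h2 := (hη.integrable_mul_ddc h1 (frame (N + 1) (m + 1 + 1))).norm
    refine h2.congr (Filter.Eventually.of_forall fun x => ?_)
    simp only [norm_mul, Real.norm_eq_abs]
    rw [abs_of_nonneg (Real.log_nonneg (by linarith [hP0 x]))]
  refine tendsto_integral_of_dominated_convergence
    (fun x => |Real.log (P x)| * |g x| + Real.log (P x + 1) * |g x|)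
    (fun k => ?_) (i1.add i2) (fun k => ?_) ?_
  · refine Continuous.aestronglyMeasurable (Continuous.mul (Continuous.log
      (hPc.add continuous_const) fun x => ?_) (hη.continuous_ddc _))
    have := hδ k
    have := hP0 x
    positivity
  · filter_upwards [ae_ne_zero N] with x hx
    have hx0 : 0 < P x := (hP0 x).lt_of_ne' (h0 x hx)
    rw [norm_mul, Real.norm_eq_abs, Real.norm_eq_abs, ← add_mul]
    refine mul_le_mul_of_nonneg_right ?_ (abs_nonneg _)
    have a1 : Real.log (P x) ≤ Real.log (P x + δ k ^ 2) :=
      Real.log_le_log hx0 (by have := hδ k; nlinarith)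
    have a2 : Real.log (P x + δ k ^ 2) ≤ Real.log (P x + 1) :=
      Real.log_le_log (by positivity) (by nlinarith [hδ k, hδ1 k])
    have a3 : 0 ≤ Real.log (P x + 1) := Real.log_nonneg (by linarith)
    rw [abs_le]
    constructor
    · linarith [neg_abs_le (Real.log (P x))]
    · linarith [abs_nonneg (Real.log (P x))]
  · filter_upwards [ae_ne_zero N] with x hx
    refine Tendsto.mul_const _ ((Real.continuousAt_log (h0 x hx)).tendsto.comp ?_)
    simpa using (hδ0.pow 2).const_add (P x)

theorem contDiff_lift (f : PolarizedMap N) : ContDiff ℂ 2 f.lift := by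
  refine contDiff_pi.2 fun k => ?_
  have h : AnalyticOnNhd ℂ (fun x : V N => MvPolynomial.aeval x (f.poly k)) Set.univ :=
    AnalyticOnNhd.aeval_mvPolynomial (fun i =>
      (ContinuousLinearMap.proj (R := ℂ) (φ := fun _ : Fin (N + 1) => ℂ) i).analyticOnNhd _) _
  simpa [PolarizedMap.lift, MvPolynomial.coe_aeval_eq_eval] using h.contDiff (n := 2)

theorem contDiff_iterLift (f : ℕ → PolarizedMap N) : ∀ l, ContDiff ℂ 2 (iterLift f l)
  | 0 => contDiff_id
  | l + 1 => (contDiff_lift (f l)).comp (contDiff_iterLift f l)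

theorem coneLift_nonneg {q : ℕ} (hm : m = 2 * q) (ω : ProjForm N m)
    (h : ∀ x, x ≠ 0 → NonnegOnFrames (ω.1 x)) (x : V N) : NonnegOnFrames (coneLift ω.1 x) := by
  intro w
  by_cases hx : x = 0
  · rw [coneLift, hx, fibreForm_eq_zero zero_notMem_annulus, ← wedgeL_apply, map_zero]
    exact le_rfl
  · rw [coneLift, fibreForm, wedge_smul_left]
    exact mul_nonneg (mul_nonneg (inv_nonneg.2 annulusMass_pos.le) annulusBump.nonneg)
      ((h x hx).wedge_reTensorIm hm (hermForm x) w)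

theorem integral_greenApprox_mul_ddc_nonneg {q : ℕ} (hm : m = 2 * q)
    (hN : m + 1 + 1 ≤ 2 * (N + 1)) (f : ℕ → PolarizedMap N) (l : ℕ)
    {η : V N → V N [⋀^Fin m]→L[ℝ] ℝ} (hη : IsTestForm η) (hpos : ∀ x, NonnegOnFrames (η x)) :
    0 ≤ ∫ x, greenApprox f l x * ddc η x (frame (N + 1) (m + 1 + 1)) := by
  have h := integral_log_sum_mul_ddc_nonneg_of_ne_zero hm hN
    (F := fun k x => iterLift f l x k) (fun k => contDiff_pi.1 (contDiff_iterLift f l) k)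
    (fun x hx => by
      rw [← euclNorm_sq]
      exact (pow_pos (euclNorm_pos (iterLift_ne_zero f hx l)) 2).ne') hη hpos
  simp only [greenApprox_eq, euclNorm_sq, mul_assoc]
  rw [integral_const_mul]
  exact mul_nonneg (by have := iterDeg_pos f l; positivity) h

theorem tendsto_integral_greenApprox_mul_ddc {f : ℕ → PolarizedMap N} (hf : cBarSeq f < ⊤)
    {η : V N → V N [⋀^Fin m]→L[ℝ] ℝ} (hη : IsTestForm η) (v : Fin (m + 1 + 1) → V N) :
    Tendsto (fun l => ∫ x, greenApprox f l x * ddc η x v) atTop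
      (nhds (∫ x, greenFunction f x * ddc η x v)) := by
  have hc : ContinuousOn (fun x => |greenFunction f x| + 4 * (cBarSeq f).toReal) {0}ᶜ :=
    (continuousOn_greenFunction hf).abs.add continuousOn_const
  have hi := (hη.integrable_mul_ddc hc v).norm
  refine tendsto_integral_of_dominated_convergence _ (fun l =>
    (hη.integrable_mul_ddc (continuousOn_greenApprox f l) v).aestronglyMeasurable) hi
    (fun l => ?_) ?_
  · filter_upwards [ae_ne_zero N] with x hx
    rw [norm_mul, norm_mul]
    refine mul_le_mul_of_nonneg_right ?_ (norm_nonneg _)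
    have h1 := dist_greenApprox_le hf hx l
    have h2 : 4 * (cBarSeq f).toReal / 2 ^ l ≤ 4 * (cBarSeq f).toReal :=
      div_le_self (mul_nonneg (by norm_num) ENNReal.toReal_nonneg)
        (one_le_pow₀ one_le_two)
    rw [Real.norm_eq_abs, Real.norm_eq_abs]
    refine le_trans ?_ (le_abs_self _)
    have h3 := abs_sub_abs_le_abs_sub (greenApprox f l x) (greenFunction f x)
    rw [Real.dist_eq] at h1
    linarith
  · filter_upwards [ae_ne_zero N] with x hx
    exact (tendsto_greenApprox hf hx).mul_const _

theorem isPositiveCurrent_greenCurrent {n : ℕ} {f : ℕ → PolarizedMap (n + 1)}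
    (hf : cBarSeq f < ⊤) : IsPositiveCurrent (greenCurrent hf (2 * n)) := by
  intro ω h
  exact ge_of_tendsto' (tendsto_integral_greenApprox_mul_ddc hf (isTestForm_coneLift ω) _)
    fun l => integral_greenApprox_mul_ddc_nonneg (q := n + 1) (by ring) (by omega) f l
      (isTestForm_coneLift ω) (coneLift_nonneg rfl ω fun x hx w => h x w hx)

end Positivity

section Main

variable {n : ℕ} {f : ℕ → PolarizedMap (n + 1)}

theorem isGreenCurrent_greenCurrent (hf : cBarSeq f < ⊤) :
    IsGreenCurrent f (greenCurrent hf (2 * n)) :=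
  ⟨isCurrent_greenCurrent hf, isBidegreeOneOne_greenCurrent rfl hf,
    isClosedCurrent_greenCurrent rfl hf, isPositiveCurrent_greenCurrent hf,
    fun _ _ hη h => greenCurrent_eq_integral rfl hf hη h⟩

theorem IsGreenCurrent.eq_greenCurrent (hf : cBarSeq f < ⊤)
    {T : ProjForm (n + 1) (2 * n) →ₗ[ℝ] ℝ} (hT : IsGreenCurrent f T) :
    T = greenCurrent hf (2 * n) :=
  LinearMap.ext fun ω =>
    hT.2.2.2.2 _ ω (isTestForm_coneLift ω) (isFibreIntegral_coneLift ω)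

theorem logTerm_greenMetric (hf : cBarSeq f < ⊤) (s : Module.Dual ℂ (V (n + 1)))
    (ω : ProjForm (n + 1) (2 * n)) :
    logTerm (greenMetric f) s ω = fun z =>
      negLogSection f s (Fin.cons 1 z) * chartCoeff LinearMap.id (ddc ω.1) z := by
  funext z
  exact congrArg (fun r : ℝ => r * chartCoeff LinearMap.id (ddc ω.1) z)
    (neg_log_greenMetric hf s (cons_one_ne_zero z))

theorem integrable_logTerm_greenMetric (hf : cBarSeq f < ⊤) {s : Module.Dual ℂ (V (n + 1))}
    (hs : s ≠ 0) (ω : ProjForm (n + 1) (2 * n)) :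
    Integrable (logTerm (greenMetric f) s ω) := by
  rw [logTerm_greenMetric hf]
  exact integrable_negLogSection_chart rfl hf hs (isTestForm_coneLift ω)
    (isFibreIntegral_coneLift ω)

theorem chernCurrent_greenMetric (hf : cBarSeq f < ⊤) {s : Module.Dual ℂ (V (n + 1))}
    (hs : s ≠ 0) (ω : ProjForm (n + 1) (2 * n)) :
    chernCurrent (greenMetric f) s hs ω = greenCurrent hf (2 * n) ω := by
  rw [chernCurrent, logTerm_greenMetric hf, greenCurrent_eq_chern rfl hf hs]
  rfl

end Main

end RandomDyn

end

/-- On `ℙ^N(ℂ)`, `N = n + 1 ≥ 1`: there is exactly one family of admissible metrics, and for every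
bounded sequence `f` the functions `G_l` converge uniformly, there is exactly one Green current `T`,
and the first Chern current of `O(1)` with the admissible metric for `f`, computed with any nonzero
section `s`, is well defined and equals `T`. -/
theorem proposition5p4 (n : ℕ) :
    (∃! h : BddSeq (n + 1) → BundleMetric (n + 1), IsAdmissibleFamily h) ∧
    ∀ h : BddSeq (n + 1) → BundleMetric (n + 1), IsAdmissibleFamily h →
      ∀ f : BddSeq (n + 1),
        TendstoUniformlyOn (greenApprox f.1) (greenFunction f.1) Filter.atTop {0}ᶜ ∧
        (∃! T : ProjForm (n + 1) (2 * n) →ₗ[ℝ] ℝ, IsGreenCurrent f.1 T) ∧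
        ∀ T : ProjForm (n + 1) (2 * n) →ₗ[ℝ] ℝ, IsGreenCurrent f.1 T →
          ∀ (s : Module.Dual ℂ (V (n + 1))) (hs : s ≠ 0) (ω : ProjForm (n + 1) (2 * n)),
            MeasureTheory.Integrable (logTerm (h f) s ω) ∧
            MeasureTheory.Integrable (divTerm s hs ω) ∧
            chernCurrent (h f) s hs ω = T ω := by
  refine ⟨⟨_, isAdmissibleFamily_greenMetric, fun h hh => hh.eq isAdmissibleFamily_greenMetric⟩,
    fun h hh f => ⟨tendstoUniformlyOn_greenApprox f.2,
      ⟨_, isGreenCurrent_greenCurrent f.2, fun T hT => hT.eq_greenCurrent f.2⟩,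
      fun T hT s hs ω => ?_⟩⟩
  rw [hh.eq isAdmissibleFamily_greenMetric, hT.eq_greenCurrent f.2]
  exact ⟨integrable_logTerm_greenMetric f.2 hs ω,
    integrable_chartCoeff_divisorParam rfl s hs (isTestForm_coneLift ω)
      (isFibreIntegral_coneLift ω),
    chernCurrent_greenMetric f.2 hs ω⟩
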